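/- **Conventions.** A *vectoid* is a symmetric monoidal category $(\mathcal A,\otimes,\mathbf 1)$ (with small $\operatorname{Hom}$-sets) such that: (V1) $\mathcal A$ has all small colimits; (V2) $\otimes$ preserves small colimits in each argument; (V3) $\mathcal A$ has finite limits; (V4) epimorphisms are universally effective (every pullback of an epimorphism is the coequalizer of its kernel pair), and every equivalence relation $R\rightrightarrows X$ is effective, i.e. is the kernel pair of $X\to X/R$; (V5) $\mathcal A$ has a small set of generators; (V6) every presheaf $\mathcal A^{op}\to\mathrm{Sets}$ which transforms small colimits into limits is representable. A *morphism of vectoids* $f:\mathcal A\to\mathcal B$ is an adjoint pair $f^*\dashv f_*$ with $f^*:\mathcal B\to\mathcal A$ a symmetric strong monoidal functor; a 2-morphism $f\to g$ is a monoidal natural transformation $f^*\to g^*$. These form a category $\operatorname{Hom}(\mathcal A,\mathcal B)$. A *cocommutative coalgebra* $C=(C,\Delta,\eta)$ in $\mathcal A$ is an object with a coassociative, cocommutative comultiplication $\Delta:C\to C\otimes C$ and a counit $\eta:C\to\mathbf 1$. Let $\mathcal N$ be the full subcategory of $\mathrm{Sets}$ on the standard finite sets $\mathbf n=\{1,\dots,n\}$,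 $n\ge 0$, with the tensor structure given by disjoint union $\mathbf m\sqcup\mathbf n\cong\mathbf{m+n}$ (the elements of $\mathbf m$ preceding those of $\mathbf n$). Let $\mathcal Q_c=\operatorname{Fun}(\mathcal N,\mathrm{Sets})=\widehat{\mathcal N^{op}}$ be the category of presheaves on $\mathcal N^{op}$, with the tensor product extending that of $\mathcal N^{op}$ cocontinuously in each argument (Day convolution), so that $h_{\mathbf m}\otimes h_{\mathbf n}\cong h_{\mathbf{m+n}}$, where $h_{\mathbf n}=\operatorname{Hom}(\mathbf n,-)$. Let $X_c=h_{\mathbf 1}$, with $\Delta_c=u^*:h_{\mathbf 1}\to h_{\mathbf 2}\cong h_{\mathbf 1}\otimes h_{\mathbf 1}$ and $\eta_c=v^*:h_{\mathbf 1}\to h_{\mathbf 0}\cong\mathbf 1$ induced by the only maps $u:\mathbf 2\to\mathbf 1$ and $v:\mathbf 0\to\mathbf 1$. For a cocommutative coalgebra $C$ in a vectoid $\mathcal A$ put $\Delta^{(0)}=\eta$ and $\Delta^{(n+1)}=(\Delta^{(n)}\otimes\mathrm{id}_C)\circ\Delta:C\to C^{\otimes(n+1)}$. For a non-decreasing map $\varphi:\mathbf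 m\to\mathbf n$ put $$\varphi^*=\Delta^{(p_1)}\otimes\cdots\otimes\Delta^{(p_n)}:C^{\otimes n}\to C^{\otimes m},\qquad p_i=\operatorname{card}\varphi^{-1}(i).$$ For a permutation $\sigma$ of $\mathbf m$ let $\sigma^*:C^{\otimes m}\to C^{\otimes m}$ be the permutation of factors whose $i$-th factor in the target is the $\sigma(i)$-th factor of the source, so that $(\sigma\circ\tau)^*=\tau^*\circ\sigma^*$. **Theorem.** 1. $\mathcal Q_c$ is a vectoid, $X_c=(h_{\mathbf 1},\Delta_c,\eta_c)$ is a cocommutative coalgebra in $\mathcal Q_c$, and $(\mathcal Q_c,X_c)$ is the classifying vectoid for cocommutative coalgebras: for every vectoid $\mathcal A$ the functor $f\mapsto f^*X_c$ is an equivalence from $\operatorname{Hom}(\mathcal A,\mathcal Q_c)$ to the category of cocommutative coalgebras in $\mathcal A$. 2. Let $C$ be a cocommutative coalgebra in a vectoid $\mathcal A$. - Every map $f:\mathbf m\to\mathbf n$ can be written as $f=\varphi\circ\sigma$ with $\sigma$ a permutation of $\mathbf m$ and $\varphi:\mathbf m\to\mathbf n$ non-decreasing, and the morphism $f^*:=\sigma^*\circ\varphi^*:C^{\otimes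 n}\to C^{\otimes m}$ does not depend on the chosen decomposition. - The assignment $\mathbf n\mapsto C^{\otimes n}$, $f\mapsto f^*$ is a functor $\Phi_C:\mathcal N^{op}\to\mathcal A$, and it is a symmetric strong monoidal functor via the canonical isomorphisms $C^{\otimes m}\otimes C^{\otimes n}\cong C^{\otimes(m+n)}$ and the identity of $\mathbf 1=C^{\otimes 0}$. - $\Phi_C$ extends along the Yoneda embedding $\mathcal N^{op}\to\mathcal Q_c$, up to a monoidal isomorphism, to the inverse image functor $\bar\Phi_C:\mathcal Q_c\to\mathcal A$ (in particular a cocontinuous symmetric monoidal functor) of a morphism of vectoids $\mathcal A\to\mathcal Q_c$; and the resulting isomorphism $\bar\Phi_C(h_{\mathbf 1})\cong\Phi_C(\mathbf 1)=C^{\otimes 1}\cong C$ is an isomorphism of coalgebras $\bar\Phi_C(X_c)\cong C$. -/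

import Mathlib

open CategoryTheory MonoidalCategory Opposite

universe w u u₁ u₂

namespace ClassifyingVectoid

open scoped DayFunctor ExternalProduct

noncomputable section

/-! ### The category of standard finite sets -/

/-- The full subcategory of the category of sets on the standard finite sets with `n` elements. -/
abbrev StdFin : Type w := FintypeCat.Skeleton.{w}

namespace StdFin

/-- The standard set with `n` elements. -/
abbrev mk (n : ℕ) : StdFin.{w} := FintypeCat.Skeleton.mk n

/-- The morphism of `StdFin` given by a map `{0, …, m - 1} → {0, …, n - 1}`. -/
def ofFun {m n : ℕ} (f : Fin m → Fin n) : mk.{w} m ⟶ mk n :=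
  fun i => ULift.up (f i.down)

/-- The disjoint union of two standard finite sets: `m ⊔ n` is identified with `m + n`, all
elements of `m` preceding those of `n`. -/
def sum (X Y : StdFin.{w}) : StdFin.{w} := mk (X.len + Y.len)

def sumInl (X Y : StdFin.{w}) : X ⟶ sum X Y := fun i => ULift.up (Fin.castAdd Y.len i.down)

def sumInr (X Y : StdFin.{w}) : Y ⟶ sum X Y := fun i => ULift.up (Fin.natAdd X.len i.down)

def sumDesc {X Y Z : StdFin.{w}} (f : X ⟶ Z) (g : Y ⟶ Z) : sum X Y ⟶ Z :=
  fun i => Fin.addCases (motive := fun _ => ULift (Fin Z.len))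
    (fun j => f (ULift.up j)) (fun j => g (ULift.up j)) i.down

theorem sumInl_desc {X Y Z : StdFin.{w}} (f : X ⟶ Z) (g : Y ⟶ Z) : sumInl X Y ≫ sumDesc f g = f := by
  funext i
  exact Fin.addCases_left (motive := fun _ => ULift (Fin Z.len)) (m := X.len) (n := Y.len)
    (left := fun j => f (ULift.up j)) (right := fun j => g (ULift.up j)) i.down

theorem sumInr_desc {X Y Z : StdFin.{w}} (f : X ⟶ Z) (g : Y ⟶ Z) : sumInr X Y ≫ sumDesc f g = g := by
  funext i
  exact Fin.addCases_right (motive := fun _ => ULift (Fin Z.len)) (m := X.len) (n := Y.len)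
    (left := fun j => f (ULift.up j)) (right := fun j => g (ULift.up j)) i.down

theorem sumInl_desc_assoc {X Y Z W : StdFin.{w}} (f : X ⟶ Z) (g : Y ⟶ Z) (h : Z ⟶ W) :
    sumInl X Y ≫ sumDesc f g ≫ h = f ≫ h := by
  rw [← Category.assoc, sumInl_desc]

theorem sumInr_desc_assoc {X Y Z W : StdFin.{w}} (f : X ⟶ Z) (g : Y ⟶ Z) (h : Z ⟶ W) :
    sumInr X Y ≫ sumDesc f g ≫ h = g ≫ h := by
  rw [← Category.assoc, sumInr_desc]

theorem sum_hom_ext {X Y Z : StdFin.{w}} {f g : sum X Y ⟶ Z}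
    (hl : sumInl X Y ≫ f = sumInl X Y ≫ g) (hr : sumInr X Y ≫ f = sumInr X Y ≫ g) : f = g := by
  funext ⟨i⟩
  refine Fin.addCases (motive := fun i => f (ULift.up i) = g (ULift.up i)) ?_ ?_ i
  · intro j; exact congrFun hl (ULift.up j)
  · intro j; exact congrFun hr (ULift.up j)

/-- The map from the empty set. -/
def fromEmpty (X : StdFin.{w}) : mk 0 ⟶ X := fun i => i.down.elim0

theorem empty_hom_ext {X : StdFin.{w}} (f g : mk.{w} 0 ⟶ X) : f = g := by
  funext i; exact i.down.elim0

/-- The tensor structure on `StdFin` given by disjoint union; the constraints are the canonical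
bijections. -/
instance : MonoidalCategoryStruct StdFin.{w} where
  tensorObj := sum
  whiskerLeft X _ _ f := sumDesc (sumInl X _) (f ≫ sumInr X _)
  whiskerRight f Y := sumDesc (f ≫ sumInl _ Y) (sumInr _ Y)
  tensorHom f g := sumDesc (f ≫ sumInl _ _) (g ≫ sumInr _ _)
  tensorUnit := mk 0
  associator X Y Z :=
    { hom := sumDesc (sumDesc (sumInl _ _) (sumInl _ _ ≫ sumInr _ _)) (sumInr _ _ ≫ sumInr _ _)
      inv := sumDesc (sumInl _ _ ≫ sumInl _ _) (sumDesc (sumInr _ _ ≫ sumInl _ _) (sumInr _ _))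
      hom_inv_id := by
        refine sum_hom_ext (sum_hom_ext ?_ ?_) ?_ <;>
          simp [sumInl_desc, sumInr_desc, sumInl_desc_assoc, sumInr_desc_assoc]
      inv_hom_id := by
        refine sum_hom_ext ?_ (sum_hom_ext ?_ ?_) <;>
          simp [sumInl_desc, sumInr_desc, sumInl_desc_assoc, sumInr_desc_assoc] }
  leftUnitor X :=
    { hom := sumDesc (fromEmpty X) (𝟙 X)
      inv := sumInr _ _
      hom_inv_id := sum_hom_ext (empty_hom_ext _ _) (by simp [sumInr_desc_assoc])
      inv_hom_id := sumInr_desc _ _ }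
  rightUnitor X :=
    { hom := sumDesc (𝟙 X) (fromEmpty X)
      inv := sumInl _ _
      hom_inv_id := sum_hom_ext (by simp [sumInl_desc_assoc]) (empty_hom_ext _ _)
      inv_hom_id := sumInl_desc _ _ }

/-- The inclusion of the first summand. -/
def inl (X Y : StdFin.{w}) : X ⟶ X ⊗ Y := sumInl X Y

/-- The inclusion of the second summand. -/
def inr (X Y : StdFin.{w}) : Y ⟶ X ⊗ Y := sumInr X Y

/-- The map out of a disjoint union with prescribed restrictions to the summands. -/
def desc {X Y Z : StdFin.{w}} (f : X ⟶ Z) (g : Y ⟶ Z) : X ⊗ Y ⟶ Z := sumDesc f g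

section

variable {X Y Z W : StdFin.{w}} (f : X ⟶ Z) (g : Y ⟶ Z) (h : Z ⟶ W)

theorem inl_desc : inl X Y ≫ desc f g = f := sumInl_desc f g

theorem inr_desc : inr X Y ≫ desc f g = g := sumInr_desc f g

theorem inl_desc_assoc : inl X Y ≫ desc f g ≫ h = f ≫ h := sumInl_desc_assoc f g h

theorem inr_desc_assoc : inr X Y ≫ desc f g ≫ h = g ≫ h := sumInr_desc_assoc f g h

end

theorem tensor_hom_ext {X Y Z : StdFin.{w}} {f g : X ⊗ Y ⟶ Z}
    (hl : inl X Y ≫ f = inl X Y ≫ g) (hr : inr X Y ≫ f = inr X Y ≫ g) : f = g :=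
  sum_hom_ext hl hr

theorem tensorHom_eq {X Y X' Y' : StdFin.{w}} (f : X ⟶ X') (g : Y ⟶ Y') :
    f ⊗ₘ g = desc (f ≫ inl X' Y') (g ≫ inr X' Y') := rfl

theorem whiskerLeft_eq (X : StdFin.{w}) {Y Y' : StdFin.{w}} (f : Y ⟶ Y') :
    X ◁ f = desc (inl X Y') (f ≫ inr X Y') := rfl

theorem whiskerRight_eq {X X' : StdFin.{w}} (f : X ⟶ X') (Y : StdFin.{w}) :
    f ▷ Y = desc (f ≫ inl X' Y) (inr X' Y) := rfl

theorem associator_hom_eq (X Y Z : StdFin.{w}) :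
    (α_ X Y Z).hom = desc
      (desc (inl X (Y ⊗ Z)) (inl Y Z ≫ inr X (Y ⊗ Z)))
      (inr Y Z ≫ inr X (Y ⊗ Z)) := rfl

theorem associator_inv_eq (X Y Z : StdFin.{w}) :
    (α_ X Y Z).inv = desc (inl X Y ≫ inl (X ⊗ Y) Z)
      (desc (inr X Y ≫ inl (X ⊗ Y) Z) (inr (X ⊗ Y) Z)) := rfl

theorem leftUnitor_hom_eq (X : StdFin.{w}) : (λ_ X).hom = desc (fromEmpty X) (𝟙 X) := rfl

theorem rightUnitor_hom_eq (X : StdFin.{w}) : (ρ_ X).hom = desc (𝟙 X) (fromEmpty X) := rfl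

instance : MonoidalCategory StdFin.{w} where
  tensorHom_def f g := by
    refine tensor_hom_ext ?_ ?_ <;> simp [tensorHom_eq, whiskerLeft_eq, whiskerRight_eq, inl_desc, inr_desc, inl_desc_assoc, inr_desc_assoc]
  id_tensorHom_id X Y := by
    refine tensor_hom_ext ?_ ?_ <;> simp [tensorHom_eq, inl_desc, inr_desc]
  tensorHom_comp_tensorHom f g h k := by
    refine tensor_hom_ext ?_ ?_ <;> simp [tensorHom_eq, inl_desc, inr_desc, inl_desc_assoc, inr_desc_assoc]
  whiskerLeft_id X Y := by
    refine tensor_hom_ext ?_ ?_ <;> simp [whiskerLeft_eq, inl_desc, inr_desc]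
  id_whiskerRight X Y := by
    refine tensor_hom_ext ?_ ?_ <;> simp [whiskerRight_eq, inl_desc, inr_desc]
  associator_naturality f g h := by
    refine tensor_hom_ext (tensor_hom_ext ?_ ?_) ?_ <;>
      simp [tensorHom_eq, associator_hom_eq, inl_desc, inr_desc, inl_desc_assoc, inr_desc_assoc]
  leftUnitor_naturality f := by
    refine tensor_hom_ext (empty_hom_ext _ _) ?_
    simp [whiskerLeft_eq, leftUnitor_hom_eq, inr_desc, inr_desc_assoc]
  rightUnitor_naturality f := by
    refine tensor_hom_ext ?_ (empty_hom_ext _ _)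
    simp [whiskerRight_eq, rightUnitor_hom_eq, inl_desc, inl_desc_assoc]
  pentagon W X Y Z := by
    refine tensor_hom_ext (tensor_hom_ext (tensor_hom_ext ?_ ?_) ?_) ?_ <;>
      simp [whiskerLeft_eq, whiskerRight_eq, associator_hom_eq, inl_desc, inr_desc, inl_desc_assoc, inr_desc_assoc]
  triangle X Y := by
    refine tensor_hom_ext (tensor_hom_ext ?_ (empty_hom_ext _ _)) ?_ <;>
      simp [whiskerLeft_eq, whiskerRight_eq, associator_hom_eq, leftUnitor_hom_eq,
        rightUnitor_hom_eq, inl_desc, inr_desc, inl_desc_assoc, inr_desc_assoc]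

instance : SymmetricCategory StdFin.{w} where
  braiding X Y :=
    { hom := desc (inr Y X) (inl Y X)
      inv := desc (inr X Y) (inl X Y)
      hom_inv_id := by
        refine tensor_hom_ext ?_ ?_ <;> simp [inl_desc, inr_desc, inl_desc_assoc, inr_desc_assoc]
      inv_hom_id := by
        refine tensor_hom_ext ?_ ?_ <;> simp [inl_desc, inr_desc, inl_desc_assoc, inr_desc_assoc] }
  braiding_naturality_right X _ _ f := by
    refine tensor_hom_ext ?_ ?_ <;>
      simp [whiskerLeft_eq, whiskerRight_eq, inl_desc, inr_desc, inl_desc_assoc, inr_desc_assoc]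
  braiding_naturality_left f Z := by
    refine tensor_hom_ext ?_ ?_ <;>
      simp [whiskerLeft_eq, whiskerRight_eq, inl_desc, inr_desc, inl_desc_assoc, inr_desc_assoc]
  hexagon_forward X Y Z := by
    refine tensor_hom_ext (tensor_hom_ext ?_ ?_) ?_ <;>
      simp [whiskerLeft_eq, whiskerRight_eq, associator_hom_eq, inl_desc, inr_desc, inl_desc_assoc, inr_desc_assoc]
  hexagon_reverse X Y Z := by
    refine tensor_hom_ext ?_ (tensor_hom_ext ?_ ?_) <;>
      simp [whiskerLeft_eq, whiskerRight_eq, associator_inv_eq, inl_desc, inr_desc, inl_desc_assoc, inr_desc_assoc]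
  symmetry X Y := by
    refine tensor_hom_ext ?_ ?_ <;> simp [inl_desc, inr_desc, inl_desc_assoc, inr_desc_assoc]

end StdFin

/-! ### Day convolution on presheaves, and the Yoneda embedding -/

section Day

set_option linter.unusedSectionVars false

variable (C : Type w) [SmallCategory C] [MonoidalCategory C] [SymmetricCategory C]


variable {C}
attribute [local instance] LawfulDayConvolutionMonoidalCategoryStruct.convolution
  LawfulDayConvolutionMonoidalCategoryStruct.convolution₂
  LawfulDayConvolutionMonoidalCategoryStruct.convolution₂'

/-- The underlying functor of a Day functor. -/
abbrev dayι : (C ⊛⥤ Type w) ⥤ (C ⥤ Type w) := LawfulDayConvolutionMonoidalCategoryStruct.ι C (Type w) (C ⊛⥤ Type w)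

/-- The symmetry of Day convolution. -/
def dayBraidingIso (F G : C ⊛⥤ Type w) : F ⊗ G ≅ G ⊗ F :=
  let i := DayConvolution.braiding (dayι.obj F) (dayι.obj G)
  { hom := ⟨i.hom⟩
    inv := ⟨i.inv⟩
    hom_inv_id := DayFunctor.hom_ext i.hom_inv_id
    inv_hom_id := DayFunctor.hom_ext i.inv_hom_id }


theorem dayι_whiskerLeft (F : C ⊛⥤ Type w) {G H : C ⊛⥤ Type w} (f : G ⟶ H) :
    dayι.map (F ◁ f) = DayConvolution.map (𝟙 (dayι.obj F)) (dayι.map f) := by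
  rw [← id_tensorHom, LawfulDayConvolutionMonoidalCategoryStruct.ι_map_tensorHom_hom_eq_tensorHom,
    CategoryTheory.Functor.map_id]

theorem dayι_whiskerRight {G H : C ⊛⥤ Type w} (f : G ⟶ H) (F : C ⊛⥤ Type w) :
    dayι.map (f ▷ F) = DayConvolution.map (dayι.map f) (𝟙 (dayι.obj F)) := by
  rw [← tensorHom_id, LawfulDayConvolutionMonoidalCategoryStruct.ι_map_tensorHom_hom_eq_tensorHom,
    CategoryTheory.Functor.map_id]

theorem dayι_associator (F G H : C ⊛⥤ Type w) : dayι.map (α_ F G H).hom =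
    (DayConvolution.associator (dayι.obj F) (dayι.obj G) (dayι.obj H)).hom :=
  LawfulDayConvolutionMonoidalCategoryStruct.ι_map_associator_hom_eq_associator_hom (C := C) (V := Type w)
    (D := C ⊛⥤ Type w) F G H

theorem dayι_associator_inv (F G H : C ⊛⥤ Type w) : dayι.map (α_ F G H).inv =
    (DayConvolution.associator (dayι.obj F) (dayι.obj G) (dayι.obj H)).inv := by
  rw [← cancel_epi (dayι.map (α_ F G H).hom), ← CategoryTheory.Functor.map_comp, Iso.hom_inv_id,
    CategoryTheory.Functor.map_id, dayι_associator]
  exact (Iso.hom_inv_id _).symm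

/-- Day convolution is symmetric. -/
instance : SymmetricCategory (C ⊛⥤ Type w) where
  braiding := dayBraidingIso
  braiding_naturality_right F G H f := by
    apply dayι.map_injective
    simp only [CategoryTheory.Functor.map_comp, dayι_whiskerLeft, dayι_whiskerRight]
    exact DayConvolution.braiding_naturality_right (dayι.obj F) (dayι.map f)
  braiding_naturality_left f F := by
    apply dayι.map_injective
    simp only [CategoryTheory.Functor.map_comp, dayι_whiskerLeft, dayι_whiskerRight]
    exact DayConvolution.braiding_naturality_left (dayι.map f) (dayι.obj F)
  hexagon_forward F G H := by
    apply dayι.map_injective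
    simp only [CategoryTheory.Functor.map_comp, dayι_whiskerLeft, dayι_whiskerRight, dayι_associator]
    exact DayConvolution.hexagon_forward (dayι.obj F) (dayι.obj G) (dayι.obj H)
  hexagon_reverse F G H := by
    apply dayι.map_injective
    simp only [CategoryTheory.Functor.map_comp, dayι_whiskerLeft, dayι_whiskerRight,
      dayι_associator_inv]
    exact DayConvolution.hexagon_reverse (dayι.obj F) (dayι.obj G) (dayι.obj H)
  symmetry F G := DayFunctor.hom_ext (DayConvolution.symmetry (dayι.obj F) (dayι.obj G))


instance : SymmetricCategory Cᵒᵖ where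
  symmetry X Y := Quiver.Hom.unop_inj (by
    simp)

variable (C) in
/-- The Yoneda embedding of `Cᵒᵖ` into functors `C ⥤ Type`, that is, presheaves on `Cᵒᵖ`; it sends
`x` to `h_x = Hom(x, -)`. -/
def dayYoneda : Cᵒᵖ ⥤ (C ⊛⥤ Type w) := coyoneda ⋙ (DayFunctor.equiv C (Type w)).inverse


/-- The action of a morphism of Day functors on elements. -/
def ev {F G : C ⊛⥤ Type w} (α : F ⟶ G) {x : C} (a : F.functor.obj x) : G.functor.obj x :=
  α.natTrans.app x a

/-- The element of a representable functor given by a morphism. -/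
def elt {x : Cᵒᵖ} {y : C} (f : x.unop ⟶ y) : ((dayYoneda C).obj x).functor.obj y := f

/-- The element of a Day convolution given by a pair of elements. -/
def dayPair {F G : C ⊛⥤ Type w} {x y : C} (a : F.functor.obj x) (b : G.functor.obj y) :
    (F ⊗ G).functor.obj (x ⊗ y) :=
  (DayFunctor.η F G).app (x, y) ((a, b) : F.functor.obj x × G.functor.obj y)

variable (C) in
/-- The canonical element of the unit for Day convolution. -/
def dayOne : (𝟙_ (C ⊛⥤ Type w)).functor.obj (𝟙_ C) := DayFunctor.ν C (Type w) PUnit.unit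

theorem ev_comp {F G H : C ⊛⥤ Type w} (α : F ⟶ G) (β : G ⟶ H) {x : C} (a : F.functor.obj x) :
    ev (α ≫ β) a = ev β (ev α a) := rfl

theorem ev_id {F : C ⊛⥤ Type w} {x : C} (a : F.functor.obj x) : ev (𝟙 F) a = a := rfl

theorem ev_map {F G : C ⊛⥤ Type w} (α : F ⟶ G) {x y : C} (f : x ⟶ y) (a : F.functor.obj x) :
    ev α (F.functor.map f a) = G.functor.map f (ev α a) :=
  ConcreteCategory.congr_hom (α.natTrans.naturality f) a

theorem elt_map {x : Cᵒᵖ} {y z : C} (f : x.unop ⟶ y) (g : y ⟶ z) :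
    ((dayYoneda C).obj x).functor.map g (elt f) = elt (f ≫ g) := rfl

theorem ev_dayYoneda_map {x y : Cᵒᵖ} (f : x ⟶ y) {z : C} (g : x.unop ⟶ z) :
    ev ((dayYoneda C).map f) (elt g) = elt (f.unop ≫ g) := rfl

theorem day_tensor_hom_ext {F G H : C ⊛⥤ Type w} {α β : F ⊗ G ⟶ H}
    (h : ∀ (x y : C) (a : F.functor.obj x) (b : G.functor.obj y),
      ev α (dayPair a b) = ev β (dayPair a b)) : α = β := by
  apply DayFunctor.tensor_hom_ext
  intro x y
  ext ⟨a, b⟩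
  exact h x y a b

theorem dayPair_map {F G : C ⊛⥤ Type w} {x y x' y' : C} (f : x ⟶ x') (g : y ⟶ y')
    (a : F.functor.obj x) (b : G.functor.obj y) :
    (F ⊗ G).functor.map (f ⊗ₘ g) (dayPair a b) =
      dayPair (F.functor.map f a) (G.functor.map g b) := by
  have h := (DayFunctor.η F G).naturality (X := (x, y)) (Y := (x', y')) (f, g)
  exact (ConcreteCategory.congr_hom h ((a, b) : F.functor.obj x × G.functor.obj y)).symm

theorem ev_tensorDesc {F G H : C ⊛⥤ Type w}
    (α : F.functor ⊠ G.functor ⟶ tensor C ⋙ H.functor) {x y : C}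
    (a : F.functor.obj x) (b : G.functor.obj y) :
    ev (DayFunctor.tensorDesc α) (dayPair a b) =
      α.app (x, y) ((a, b) : F.functor.obj x × G.functor.obj y) :=
  ConcreteCategory.congr_hom (DayFunctor.η_comp_tensorDesc_app α x y)
    ((a, b) : F.functor.obj x × G.functor.obj y)

theorem ev_whiskerLeft (F : C ⊛⥤ Type w) {G H : C ⊛⥤ Type w} (f : G ⟶ H) {x y : C}
    (a : F.functor.obj x) (b : G.functor.obj y) :
    ev (F ◁ f) (dayPair a b) = dayPair a (ev f b) :=
  ConcreteCategory.congr_hom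
    (LawfulDayConvolutionMonoidalCategoryStruct.convolutionExtensionUnit_comp_ι_map_whiskerLeft_app
      (C := C) (Type w) F f x y) ((a, b) : F.functor.obj x × G.functor.obj y)

theorem ev_whiskerRight {G H : C ⊛⥤ Type w} (f : G ⟶ H) (F : C ⊛⥤ Type w) {x y : C}
    (a : G.functor.obj x) (b : F.functor.obj y) :
    ev (f ▷ F) (dayPair a b) = dayPair (ev f a) b :=
  ConcreteCategory.congr_hom
    (LawfulDayConvolutionMonoidalCategoryStruct.convolutionExtensionUnit_comp_ι_map_whiskerRight_app
      C (Type w) f F x y) ((a, b) : G.functor.obj x × F.functor.obj y)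

theorem ev_associator (F G H : C ⊛⥤ Type w) {x y z : C}
    (a : F.functor.obj x) (b : G.functor.obj y) (c : H.functor.obj z) :
    ev (α_ F G H).hom (dayPair (dayPair a b) c) =
      (F ⊗ G ⊗ H).functor.map (α_ x y z).inv (dayPair a (dayPair b c)) :=
  ConcreteCategory.congr_hom
    (LawfulDayConvolutionMonoidalCategoryStruct.associator_hom_unit_unit (C := C)
      (Type w) F G H x y z)
    (((a, b), c) : (F.functor.obj x × G.functor.obj y) × H.functor.obj z)

theorem ev_leftUnitor (F : C ⊛⥤ Type w) {x : C} (a : F.functor.obj x) :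
    ev (λ_ F).hom (dayPair (dayOne C) a) = F.functor.map (λ_ x).inv a :=
  ConcreteCategory.congr_hom
    (LawfulDayConvolutionMonoidalCategoryStruct.leftUnitor_hom_unit_app (C := C) (Type w) F x)
    ((PUnit.unit, a) : PUnit × F.functor.obj x)

theorem ev_rightUnitor (F : C ⊛⥤ Type w) {x : C} (a : F.functor.obj x) :
    ev (ρ_ F).hom (dayPair a (dayOne C)) = F.functor.map (ρ_ x).inv a :=
  ConcreteCategory.congr_hom
    (LawfulDayConvolutionMonoidalCategoryStruct.rightUnitor_hom_unit_app (C := C) (Type w) F x)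
    ((a, PUnit.unit) : F.functor.obj x × PUnit)

theorem ev_braiding (F G : C ⊛⥤ Type w) {x y : C} (a : F.functor.obj x) (b : G.functor.obj y) :
    ev (β_ F G).hom (dayPair a b) = (G ⊗ F).functor.map (β_ y x).hom (dayPair b a) :=
  ConcreteCategory.congr_hom
    (DayConvolution.unit_app_braiding_hom_app (dayι.obj F) (dayι.obj G) x y)
    ((a, b) : F.functor.obj x × G.functor.obj y)

theorem dayYoneda_hom_ext {x : Cᵒᵖ} {F : C ⊛⥤ Type w} {α β : (dayYoneda C).obj x ⟶ F}
    (h : ev α (elt (𝟙 x.unop)) = ev β (elt (𝟙 x.unop))) : α = β :=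
  DayFunctor.hom_ext (coyonedaEquiv.injective h)

/-- The morphism out of a representable functor given by an element. -/
def dayYonedaDesc {x : Cᵒᵖ} {F : C ⊛⥤ Type w} (a : F.functor.obj x.unop) :
    (dayYoneda C).obj x ⟶ F :=
  ⟨coyonedaEquiv.symm a⟩

theorem ev_dayYonedaDesc {x : Cᵒᵖ} {F : C ⊛⥤ Type w} (a : F.functor.obj x.unop) {y : C}
    (f : x.unop ⟶ y) : ev (dayYonedaDesc a) (elt f) = F.functor.map f a := rfl

/-- The map `h_x ⊗ h_y ⟶ h_{x ⊗ y}` sending a pair `(f, g)` to `f ⊗ g`. -/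
def dayμ (x y : Cᵒᵖ) :
    (dayYoneda C).obj x ⊗ (dayYoneda C).obj y ⟶ (dayYoneda C).obj (x ⊗ y) :=
  DayFunctor.tensorDesc
    { app := fun p => TypeCat.ofHom (fun q : (x.unop ⟶ p.1) × (y.unop ⟶ p.2) =>
        (q.1 ⊗ₘ q.2 : x.unop ⊗ y.unop ⟶ p.1 ⊗ p.2))
      naturality := by
        intro p q f
        ext ⟨a, b⟩
        exact (tensorHom_comp_tensorHom (C := C) a b f.1 f.2).symm }

theorem ev_dayμ (x y : Cᵒᵖ) {a b : C} (f : x.unop ⟶ a) (g : y.unop ⟶ b) :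
    ev (dayμ x y) (dayPair (elt f) (elt g)) = elt (x := x ⊗ y) (f ⊗ₘ g) :=
  ev_tensorDesc _ _ _

/-- The map `h_{x ⊗ y} ⟶ h_x ⊗ h_y` given by the pair of identity maps. -/
def dayδ (x y : Cᵒᵖ) :
    (dayYoneda C).obj (x ⊗ y) ⟶ (dayYoneda C).obj x ⊗ (dayYoneda C).obj y :=
  dayYonedaDesc (dayPair (elt (𝟙 x.unop)) (elt (𝟙 y.unop)))

theorem ev_dayδ (x y : Cᵒᵖ) {a b : C} (f : x.unop ⟶ a) (g : y.unop ⟶ b) :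
    ev (dayδ x y) (elt (x := x ⊗ y) (f ⊗ₘ g)) = dayPair (elt f) (elt g) := by
  rw [dayδ]
  refine (ev_dayYonedaDesc (x := x ⊗ y) _ (f ⊗ₘ g)).trans ?_
  rw [dayPair_map, elt_map, elt_map, Category.id_comp, Category.id_comp]

theorem ev_dayδ_id (x y : Cᵒᵖ) :
    ev (dayδ x y) (elt (𝟙 (x ⊗ y).unop)) = dayPair (elt (𝟙 x.unop)) (elt (𝟙 y.unop)) := by
  rw [← ev_dayδ, id_tensorHom_id]
  rfl

/-- `h_x ⊗ h_y ≅ h_{x ⊗ y}`. -/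
def dayμIso (x y : Cᵒᵖ) :
    (dayYoneda C).obj x ⊗ (dayYoneda C).obj y ≅ (dayYoneda C).obj (x ⊗ y) where
  hom := dayμ x y
  inv := dayδ x y
  hom_inv_id := day_tensor_hom_ext fun a b f g => by
    rw [ev_comp, ev_id]
    exact (congrArg (ev (dayδ x y)) (ev_dayμ x y f g)).trans (ev_dayδ x y f g)
  inv_hom_id := dayYoneda_hom_ext (by
    rw [ev_comp, ev_id, ev_dayδ_id, ev_dayμ, id_tensorHom_id]
    rfl)

variable (C) in
/-- The map from the unit to the representable functor given by the unit. -/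
def dayε : 𝟙_ (C ⊛⥤ Type w) ⟶ (dayYoneda C).obj (𝟙_ Cᵒᵖ) :=
  DayFunctor.unitDesc (TypeCat.ofHom fun _ => elt (x := 𝟙_ Cᵒᵖ) (𝟙 (𝟙_ C)))

theorem ev_dayε : ev (dayε C) (dayOne C) = elt (x := 𝟙_ Cᵒᵖ) (𝟙 (𝟙_ C)) :=
  ConcreteCategory.congr_hom (DayFunctor.ν_comp_unitDesc (F := (dayYoneda C).obj (𝟙_ Cᵒᵖ))
    (TypeCat.ofHom fun _ => elt (x := 𝟙_ Cᵒᵖ) (𝟙 (𝟙_ C)))) PUnit.unit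

theorem ev_dayη : ev (dayYonedaDesc (x := 𝟙_ Cᵒᵖ) (dayOne C)) (elt (x := 𝟙_ Cᵒᵖ) (𝟙 (𝟙_ C))) =
    dayOne C := by
  refine (ev_dayYonedaDesc (x := 𝟙_ Cᵒᵖ) (dayOne C) (𝟙 (𝟙_ C))).trans ?_
  exact ConcreteCategory.congr_hom ((𝟙_ (C ⊛⥤ Type w)).functor.map_id (𝟙_ C)) (dayOne C)

variable (C) in
/-- The unit for Day convolution is representable by the unit. -/
def dayεIso : 𝟙_ (C ⊛⥤ Type w) ≅ (dayYoneda C).obj (𝟙_ Cᵒᵖ) where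
  hom := dayε C
  inv := dayYonedaDesc (dayOne C)
  hom_inv_id := DayFunctor.unit_hom_ext (by
    ext
    exact (congrArg (ev (dayYonedaDesc (x := 𝟙_ Cᵒᵖ) (dayOne C))) ev_dayε).trans ev_dayη)
  inv_hom_id := dayYoneda_hom_ext (congrArg (ev (dayε C)) ev_dayη |>.trans ev_dayε)

theorem ev_dayεIso_inv : ev (dayεIso C).inv (elt (𝟙 (𝟙_ Cᵒᵖ).unop)) = dayOne C := ev_dayη

theorem day_map_natural_left {x y : Cᵒᵖ} (f : x ⟶ y) (z : Cᵒᵖ) :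
    dayδ x z ≫ (dayYoneda C).map f ▷ (dayYoneda C).obj z =
      (dayYoneda C).map (f ▷ z) ≫ dayδ y z := by
  apply dayYoneda_hom_ext
  rw [ev_comp, ev_comp, ev_dayδ_id, ev_whiskerRight, ev_dayYoneda_map, ev_dayYoneda_map, ← ev_dayδ]
  congr 2
  simp

theorem day_map_natural_right {x y : Cᵒᵖ} (z : Cᵒᵖ) (f : x ⟶ y) :
    dayδ z x ≫ (dayYoneda C).obj z ◁ (dayYoneda C).map f =
      (dayYoneda C).map (z ◁ f) ≫ dayδ z y := by
  apply dayYoneda_hom_ext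
  rw [ev_comp, ev_comp, ev_dayδ_id, ev_whiskerLeft, ev_dayYoneda_map, ev_dayYoneda_map, ← ev_dayδ]
  congr 2
  simp

theorem elt_eq_map {x : Cᵒᵖ} {y : C} (f : x.unop ⟶ y) :
    elt f = ((dayYoneda C).obj x).functor.map f (elt (𝟙 x.unop)) := by
  rw [elt_map, Category.id_comp]

theorem day_associativity (x y z : Cᵒᵖ) :
    dayδ (x ⊗ y) z ≫ dayδ x y ▷ (dayYoneda C).obj z ≫
        (α_ ((dayYoneda C).obj x) ((dayYoneda C).obj y) ((dayYoneda C).obj z)).hom =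
      (dayYoneda C).map (α_ x y z).hom ≫ dayδ x (y ⊗ z) ≫ (dayYoneda C).obj x ◁ dayδ y z := by
  apply dayYoneda_hom_ext
  rw [ev_comp, ev_comp, ev_comp, ev_comp, ev_dayδ_id, ev_whiskerRight, ev_dayδ_id, ev_associator,
    ev_dayYoneda_map, Category.comp_id, elt_eq_map (α_ x y z).hom.unop, ev_map, ev_map,
    ev_dayδ_id, ev_whiskerLeft,
    ev_dayδ_id]
  rfl

theorem day_left_unitality (x : Cᵒᵖ) :
    (λ_ ((dayYoneda C).obj x)).inv =
      (dayYoneda C).map (λ_ x).inv ≫ dayδ (𝟙_ Cᵒᵖ) x ≫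
        (dayεIso C).inv ▷ (dayYoneda C).obj x := by
  rw [← cancel_mono (λ_ ((dayYoneda C).obj x)).hom, Iso.inv_hom_id, Category.assoc, Category.assoc]
  symm
  apply dayYoneda_hom_ext
  rw [ev_comp, ev_comp, ev_comp, ev_dayYoneda_map, elt_eq_map, ev_map, ev_map, ev_map, ev_dayδ_id,
    ev_whiskerRight, ev_dayεIso_inv, ev_leftUnitor, elt_map, elt_map, ev_id]
  congr 1
  simp

theorem day_right_unitality (x : Cᵒᵖ) :
    (ρ_ ((dayYoneda C).obj x)).inv =
      (dayYoneda C).map (ρ_ x).inv ≫ dayδ x (𝟙_ Cᵒᵖ) ≫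
        (dayYoneda C).obj x ◁ (dayεIso C).inv := by
  rw [← cancel_mono (ρ_ ((dayYoneda C).obj x)).hom, Iso.inv_hom_id, Category.assoc, Category.assoc]
  symm
  apply dayYoneda_hom_ext
  rw [ev_comp, ev_comp, ev_comp, ev_dayYoneda_map, elt_eq_map, ev_map, ev_map, ev_map, ev_dayδ_id,
    ev_whiskerLeft, ev_dayεIso_inv, ev_rightUnitor, elt_map, elt_map, ev_id]
  congr 1
  simp

theorem day_braided (x y : Cᵒᵖ) :
    (dayYoneda C).map (β_ x y).hom ≫ dayδ y x = dayδ x y ≫ (β_ _ _).hom := by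
  apply dayYoneda_hom_ext
  rw [ev_comp, ev_comp, ev_dayδ_id, ev_braiding, ev_dayYoneda_map, Category.comp_id, elt_eq_map,
    ev_map, ev_dayδ_id]
  rfl

/-- The Yoneda embedding is a symmetric monoidal functor. -/
instance : (dayYoneda C).Braided where
  toMonoidal := (Functor.CoreMonoidal.mk' (dayεIso C) dayμIso day_map_natural_left
    day_map_natural_right day_associativity day_left_unitality day_right_unitality).toMonoidal
  braided x y := by
    change dayμ x y ≫ _ = _ ≫ dayμ y x
    have h := day_braided x y
    have h1 : dayμ x y ≫ dayδ x y = 𝟙 _ := (dayμIso x y).hom_inv_id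
    have h2 : dayδ y x ≫ dayμ y x = 𝟙 _ := (dayμIso y x).inv_hom_id
    calc dayμ x y ≫ (dayYoneda C).map (β_ x y).hom
        = dayμ x y ≫ ((dayYoneda C).map (β_ x y).hom ≫ dayδ y x) ≫ dayμ y x := by
          rw [Category.assoc, h2, Category.comp_id]
      _ = _ := by rw [h, Category.assoc, ← Category.assoc (dayμ x y), h1, Category.id_comp]

end Day

/-! ### Vectoids and their morphisms -/

section Vectoid

open Limits

/-- A morphism is an effective epimorphism in the sense that it is the cokernel (coequalizer) of
its kernel pair. -/
def IsCokernelOfKernelPair {A : Type u} [Category.{w} A] {X Y : A} (f : X ⟶ Y) : Prop :=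
  ∀ ⦃R : A⦄ (a b : R ⟶ X) (h : IsKernelPair f a b), Nonempty (IsColimit (Cofork.ofπ f h.w))

/-- A vectoid: a symmetric monoidal (ACU tensor) category with small colimits, preserved by the
tensor product in each argument, with finite limits, such that epimorphisms are universally
effective and equivalence relations are effective, with a small system of generators, and such
that each presheaf of sets transforming all small colimits into limits is representable. -/
class IsVectoid (A : Type u) [Category.{w} A] [MonoidalCategory A] [SymmetricCategory A] :
    Prop where
  hasColimits : HasColimitsOfSize.{w, w} A
  tensorLeft_cocontinuous : ∀ X : A, PreservesColimitsOfSize.{w, w} (tensorLeft X)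
  tensorRight_cocontinuous : ∀ X : A, PreservesColimitsOfSize.{w, w} (tensorRight X)
  hasFiniteLimits : HasFiniteLimits A
  epi_universally_effective : ∀ ⦃X' X Y' Y : A⦄ (g' : X' ⟶ X) (f' : X' ⟶ Y') (f : X ⟶ Y)
    (g : Y' ⟶ Y), Epi f → IsPullback g' f' f g → IsCokernelOfKernelPair f'
  equivalenceRelation_effective : ∀ ⦃R X : A⦄ (p₁ p₂ : R ⟶ X), IsEquivalenceRelation p₁ p₂ →
    ∀ c : Cofork p₁ p₂, IsColimit c → IsKernelPair c.π p₁ p₂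
  exists_generators : ∃ (ι : Type w) (G : ι → A), (ObjectProperty.ofObj G).IsSeparating
  complete : ∀ F : Aᵒᵖ ⥤ Type w, PreservesLimitsOfSize.{w, w} F → F.IsRepresentable

/-- A morphism of vectoids `A ⟶ B`: an adjoint pair whose left adjoint, the inverse image functor
`B ⥤ A`, is a symmetric (strong) monoidal functor. -/
structure VectoidHom (A : Type u₁) [Category.{w} A] [MonoidalCategory A] [SymmetricCategory A]
    (B : Type u₂) [Category.{w} B] [MonoidalCategory B] [SymmetricCategory B] where
  inverseImage : B ⥤ A
  directImage : A ⥤ B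
  adj : inverseImage ⊣ directImage
  [braided : inverseImage.Braided]

attribute [instance] VectoidHom.braided

namespace VectoidHom

variable {A : Type u₁} [Category.{w} A] [MonoidalCategory A] [SymmetricCategory A]
  {B : Type u₂} [Category.{w} B] [MonoidalCategory B] [SymmetricCategory B]

/-- A 2-morphism: a natural transformation of the inverse image tensor functors. -/
structure Hom (f g : VectoidHom A B) where
  natTrans : f.inverseImage ⟶ g.inverseImage
  isMonoidal : NatTrans.IsMonoidal natTrans

theorem Hom.ext {f g : VectoidHom A B} {θ θ' : Hom f g} (h : θ.natTrans = θ'.natTrans) :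
    θ = θ' := by
  cases θ; cases θ'; cases h; rfl

instance : Category (VectoidHom A B) where
  Hom := Hom
  id f := ⟨𝟙 f.inverseImage, inferInstance⟩
  comp θ θ' := ⟨θ.natTrans ≫ θ'.natTrans,
    have := θ.isMonoidal
    have := θ'.isMonoidal
    inferInstance⟩
  id_comp _ := Hom.ext (Category.id_comp _)
  comp_id _ := Hom.ext (Category.comp_id _)
  assoc _ _ _ := Hom.ext (Category.assoc _ _ _)

end VectoidHom

end Vectoid

/-! ### Cocommutative coalgebras and their inverse images -/

section Coalgebra

open Functor.OplaxMonoidal Functor.LaxMonoidal Functor.Monoidal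

variable {A : Type u₁} [Category.{w} A] [MonoidalCategory A] [SymmetricCategory A]
  {B : Type u₂} [Category.{w} B] [MonoidalCategory B] [SymmetricCategory B]

/-- The image of a cocommutative coalgebra `X` under a symmetric monoidal functor `F`, with
comultiplication `F X ⟶ F (X ⊗ X) ≅ F X ⊗ F X` and counit `F X ⟶ F 1 ≅ 1`. -/
def mapCoalg (F : B ⥤ A) [F.Braided] (X : CommComon B) : CommComon A :=
  letI : ComonObj (F.obj X.X) := Functor.obj.instComonObj X.X F
  { X := F.obj X.X
    comm := ⟨by
      change (F.map (ComonObj.comul (X := X.X)) ≫ δ F X.X X.X) ≫ _ =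
        F.map (ComonObj.comul (X := X.X)) ≫ δ F X.X X.X
      have h : δ F X.X X.X ≫ (β_ (F.obj X.X) (F.obj X.X)).hom =
          F.map (β_ X.X X.X).hom ≫ δ F X.X X.X := by simp
      rw [Category.assoc, h, ← Category.assoc, ← F.map_comp, IsCommComonObj.comul_comm]⟩ }

theorem mapCoalg_comul (F : B ⥤ A) [F.Braided] (X : CommComon B) :
    (mapCoalg F X).comon.comul = F.map X.comon.comul ≫ δ F X.X X.X := rfl

theorem mapCoalg_counit (F : B ⥤ A) [F.Braided] (X : CommComon B) :
    (mapCoalg F X).comon.counit = F.map X.comon.counit ≫ η F := rfl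

theorem app_counit {F G : B ⥤ A} [F.Braided] [G.Braided] (θ : F ⟶ G) [NatTrans.IsMonoidal θ] :
    θ.app (𝟙_ B) ≫ η G = η F := by
  rw [← cancel_epi (ε F), ← Category.assoc, NatTrans.IsMonoidal.unit, ε_η, ε_η]

theorem app_comul {F G : B ⥤ A} [F.Braided] [G.Braided] (θ : F ⟶ G) [NatTrans.IsMonoidal θ]
    (X Y : B) : θ.app (X ⊗ Y) ≫ δ G X Y = δ F X Y ≫ (θ.app X ⊗ₘ θ.app Y) := by
  rw [← cancel_epi (μ F X Y), ← Category.assoc, NatTrans.IsMonoidal.tensor, Category.assoc, μ_δ,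
    Category.comp_id, μ_δ_assoc]

/-- The functor `f ↦ f^* X` from morphisms of vectoids `A ⟶ B` to cocommutative coalgebras in `A`
given by a cocommutative coalgebra `X` in `B`. -/
def inverseImageCoalg (X : CommComon B) : VectoidHom A B ⥤ CommComon A where
  obj f := mapCoalg f.inverseImage X
  map {f g} θ :=
    { hom :=
        { hom := θ.natTrans.app X.X
          isComonHom_hom :=
            { hom_counit := by
                have := θ.isMonoidal
                change θ.natTrans.app X.X ≫ g.inverseImage.map X.comon.counit ≫
                  η g.inverseImage = f.inverseImage.map X.comon.counit ≫ η f.inverseImage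
                rw [← NatTrans.naturality_assoc, app_counit]
              hom_comul := by
                have := θ.isMonoidal
                change θ.natTrans.app X.X ≫ g.inverseImage.map X.comon.comul ≫
                  δ g.inverseImage X.X X.X = (f.inverseImage.map X.comon.comul ≫
                    δ f.inverseImage X.X X.X) ≫ (θ.natTrans.app X.X ⊗ₘ θ.natTrans.app X.X)
                rw [← NatTrans.naturality_assoc, app_comul, Category.assoc] } } }
  map_id _ := rfl
  map_comp _ _ := rfl

/-- `Q` is a classifying vectoid for cocommutative coalgebras, with universal cocommutative
coalgebra `X`: for each vectoid `A`, the functor `f ↦ f^* X` is an equivalence from the category of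
morphisms of vectoids `A ⟶ Q` to the category of cocommutative coalgebras in `A`. -/
def IsCoalgClassifier (Q : Type u₁) [Category.{w} Q] [MonoidalCategory Q] [SymmetricCategory Q]
    (X : CommComon Q) : Prop :=
  IsVectoid Q ∧
    ∀ (A : Type u) [Category.{w} A] [MonoidalCategory A] [SymmetricCategory A] [IsVectoid A],
      (inverseImageCoalg (A := A) X).IsEquivalence

end Coalgebra

/-! ### The classifying vectoid -/

/-- The category of functors `StdFin ⥤ Type`, that is, of presheaves on `StdFinᵒᵖ`, whose tensor
structure is the Day convolution of disjoint union (the extension of disjoint union that is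
cocontinuous in each argument). -/
abbrev Qc : Type (w + 1) := StdFin.{w} ⊛⥤ Type w

theorem StdFin.hom_one_ext {X : StdFin.{w}} (f g : X ⟶ mk 1) : f = g := by
  funext i
  exact ULift.ext _ _ (Subsingleton.elim (α := Fin 1) _ _)

/-- The one-element set as a coalgebra in `StdFinᵒᵖ`: its comultiplication and counit are given by
the only possible maps `2 ⟶ 1` and `0 ⟶ 1`. -/
def pointCoalg : CommComon StdFin.{w}ᵒᵖ :=
  letI : ComonObj (op (StdFin.mk.{w} 1)) :=
    { comul := Quiver.Hom.op (X := StdFin.mk 1 ⊗ StdFin.mk 1)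
        (StdFin.ofFun (m := 2) (n := 1) (fun _ => 0))
      counit := Quiver.Hom.op (X := 𝟙_ StdFin.{w}) (StdFin.ofFun (m := 0) (n := 1) (fun _ => 0))
      counit_comul := Quiver.Hom.unop_inj (StdFin.hom_one_ext _ _)
      comul_counit := Quiver.Hom.unop_inj (StdFin.hom_one_ext _ _)
      comul_assoc := Quiver.Hom.unop_inj (StdFin.hom_one_ext _ _) }
  { X := op (StdFin.mk 1)
    comm := ⟨Quiver.Hom.unop_inj (StdFin.hom_one_ext _ _)⟩ }

/-- The universal cocommutative coalgebra: the functor `h_1` represented by the one-element set,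
with comultiplication `h_1 ⟶ h_2 ≅ h_1 ⊗ h_1` and counit `h_1 ⟶ h_0 ≅ 1` induced by the maps
`2 ⟶ 1` and `0 ⟶ 1`. -/
def univCoalg : CommComon Qc.{w} := mapCoalg (dayYoneda StdFin.{w}) pointCoalg

/-! ### Tensor powers of a coalgebra -/

section TensorPower

variable {A : Type u} [Category.{w} A] [MonoidalCategory A]

/-- The tensor power `X ⊗ ⋯ ⊗ X`. -/
def tensorPow (X : A) : ℕ → A
  | 0 => 𝟙_ A
  | n + 1 => tensorPow X n ⊗ X

/-- The canonical isomorphism between tensor powers. -/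
def tensorPowAdd (X : A) (m : ℕ) : ∀ n : ℕ,
    tensorPow X m ⊗ tensorPow X n ≅ tensorPow X (m + n)
  | 0 => ρ_ (tensorPow X m)
  | n + 1 => (α_ (tensorPow X m) (tensorPow X n) X).symm ≪≫ whiskerRightIso (tensorPowAdd X m n) X

/-- The `n`-fold coproduct `C ⟶ C ⊗ ⋯ ⊗ C`. -/
def iterComul (C : A) [ComonObj C] : ∀ n : ℕ, C ⟶ tensorPow C n
  | 0 => ComonObj.counit
  | n + 1 => ComonObj.comul ≫ iterComul C n ▷ C

/-- The sum `p 0 + ⋯ + p (n - 1)`. -/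
def blockSum : ∀ n : ℕ, (Fin n → ℕ) → ℕ
  | 0, _ => 0
  | n + 1, p => blockSum n (fun i => p i.castSucc) + p (Fin.last n)

theorem blockSum_eq : ∀ (n : ℕ) (p : Fin n → ℕ), blockSum n p = ∑ i, p i
  | 0, _ => rfl
  | n + 1, p => by rw [blockSum, blockSum_eq n, Fin.sum_univ_castSucc]

/-- The tensor product of the iterated coproducts `C ⟶ C ^ (p i)` for `i < n`. -/
def blockComul (C : A) [ComonObj C] : ∀ (n : ℕ) (p : Fin n → ℕ),
    tensorPow C n ⟶ tensorPow C (blockSum n p)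
  | 0, _ => 𝟙 _
  | n + 1, p => (blockComul C n (fun i => p i.castSucc) ⊗ₘ iterComul C (p (Fin.last n))) ≫
      (tensorPowAdd C _ _).hom

/-- The number of elements of the fibre of `φ` over `i`. -/
def fibreCard {m n : ℕ} (φ : Fin m → Fin n) (i : Fin n) : ℕ :=
  (Finset.univ.filter fun j => φ j = i).card

theorem blockSum_fibreCard {m n : ℕ} (φ : Fin m → Fin n) : blockSum n (fibreCard φ) = m := by
  rw [blockSum_eq]
  have h := Finset.card_eq_sum_card_fiberwise (f := φ) (s := Finset.univ) (t := Finset.univ)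
    (fun _ _ => Finset.mem_coe.2 (Finset.mem_univ _))
  rw [Finset.card_univ, Fintype.card_fin] at h
  exact h.symm

/-- The morphism `φ^* : C ^ n ⟶ C ^ m` given by a non-decreasing map `φ` from `m` to `n`: the
tensor product of the iterated coproducts of orders the cardinalities of the fibres of `φ`. -/
def monoMap (C : A) [ComonObj C] {m n : ℕ} (φ : Fin m →o Fin n) :
    tensorPow C n ⟶ tensorPow C m :=
  blockComul C n (fibreCard φ) ≫ eqToHom (congrArg (tensorPow C) (blockSum_fibreCard φ))

variable [SymmetricCategory A]

/-- The exchange of the last two factors. -/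
def swapLast (X : A) (n : ℕ) : tensorPow X (n + 2) ⟶ tensorPow X (n + 2) :=
  (α_ (tensorPow X n) X X).hom ≫ tensorPow X n ◁ (β_ X X).hom ≫ (α_ (tensorPow X n) X X).inv

/-- Moves the `k`-th factor to the last place, keeping the order of the others. -/
def moveLast (X : A) : ∀ n : ℕ, Fin (n + 1) → (tensorPow X (n + 1) ⟶ tensorPow X (n + 1))
  | 0, _ => 𝟙 _
  | n + 1, k => Fin.lastCases (motive := fun _ => tensorPow X (n + 2) ⟶ tensorPow X (n + 2))
      (𝟙 _) (fun j => moveLast X n j ▷ X ≫ swapLast X n) k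

/-- The permutation `τ` with `(σ last).succAbove (τ i) = σ i.castSucc`. -/
def deleteLast {n : ℕ} (σ : Equiv.Perm (Fin (n + 1))) : Equiv.Perm (Fin n) :=
  Equiv.removeNone
    ((finSuccEquivLast.symm.trans σ).trans (finSuccEquiv' (σ (Fin.last n))))

/-- The morphism `σ^* : X ^ n ⟶ X ^ n` given by permuting the factors: the `i`-th factor of the
target is the `σ i`-th factor of the source. -/
def permMap (X : A) : ∀ n : ℕ, Equiv.Perm (Fin n) → (tensorPow X n ⟶ tensorPow X n)
  | 0, _ => 𝟙 _
  | n + 1, σ => moveLast X n (σ (Fin.last n)) ≫ permMap X n (deleteLast σ) ▷ X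

end TensorPower

end

end ClassifyingVectoid

open ClassifyingVectoid

namespace ClassifyingVectoid

open Limits ComonObj CartesianMonoidalCategory

noncomputable section

/-! ### Coalgebra structures on tensor products -/

section Comon

variable {A : Type u₁} [Category.{w} A] [MonoidalCategory A] [BraidedCategory A]

attribute [local instance] ComonObj.instTensorUnit

section

variable {W X Y Z : A} [ComonObj W] [ComonObj X] [ComonObj Y] [ComonObj Z]

/-! The heart of the matter is that cocommutative coalgebras in a symmetric monoidal category `A`
form a category whose tensor product is the categorical product and whose unit object is terminal.
Indeed, the comultiplication of a cocommutative coalgebra is itself a morphism of coalgebras, so two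
coalgebra morphisms `f`, `g` out of `T` pair to `Δ ≫ (f ⊗ₘ g)`, and the counits give the
projections. On the other side, the opposite of the category of finite sets, with disjoint union, is
the free category with finite products on the one-element set. A symmetric monoidal functor from it
to `A` is therefore the same as a product-preserving functor to `CommComon A`, that is, a single
cocommutative coalgebra.

In a cartesian category a morphism to a power is known by its components. By `monoMap_proj` and
`permMap_proj`, the `i`-th component of `monoMap X φ ≫ permMap X m σ` is the projection with index
`φ (σ i)`. Hence the composite depends only on `φ ∘ σ` and is the value of the power functor there
(`powFunctor_map`). Applied to `C` as an object of `CommComon A` and transported along the strong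
monoidal forgetful functor (`map_monoMap`, `map_permMap`, `map_tensorPowAdd`), this gives `coalgPow
C` and its properties.

Conversely, every object of a cartesian category is a cocommutative coalgebra through its diagonal,
so a symmetric monoidal `Φ` lifts to `coalgLift Φ`, whose product comparison maps are the
constraints of `Φ`. Thus a coalgebra morphism between the values at the one-element set extends to a
monoidal transformation (`exists_monoidal_natTrans`), in only one way (`monoidal_natTrans_ext`).

The passage to `Qc` is Kan extension along the Yoneda embedding: `dayExt Φ` is left adjoint to `a ↦
Hom(Φ -, a)`, and it is symmetric monoidal because the tensor product of a vectoid is cocontinuous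
in each argument. This gives essential surjectivity. Transformations out of a left adjoint on Day
functors are determined by, and can be extended from, the representables (`leftAdjoint_hom_ext`,
`exists_extend_natTrans`), and monoidality can be tested there (`isMonoidal_of_restrict`); this
gives full faithfulness.

That `Qc` is a vectoid is checked on elements, as in a category of sets. Its tensor product is
cocontinuous because it has internal homs, and a presheaf turning colimits into limits is
represented by its restriction to the representables, since every Day functor is a colimit of these.
-/

instance isComonHom_tensorHom (f : W ⟶ X) (g : Y ⟶ Z) [IsComonHom f] [IsComonHom g] :
    IsComonHom (f ⊗ₘ g) := by
  let f' : Comon.mk W ⟶ Comon.mk X := ⟨f⟩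
  let g' : Comon.mk Y ⟶ Comon.mk Z := ⟨g⟩
  exact (f' ⊗ₘ g').isComonHom_hom

instance isComonHom_whiskerLeft (X : A) [ComonObj X] (g : Y ⟶ Z) [IsComonHom g] :
    IsComonHom (X ◁ g) := by
  rw [← id_tensorHom]
  infer_instance

instance isComonHom_whiskerRight (g : Y ⟶ Z) [IsComonHom g] (X : A) [ComonObj X] :
    IsComonHom (g ▷ X) := by
  rw [← tensorHom_id]
  infer_instance

instance isComonHom_associator : IsComonHom (α_ X Y Z).hom := by
  have h := (α_ (Comon.mk X) (Comon.mk Y) (Comon.mk Z)).hom.isComonHom_hom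
  have e : (α_ (Comon.mk X) (Comon.mk Y) (Comon.mk Z)).hom.hom = (α_ X Y Z).hom := by
    rw [Comon.monoidal_associator_hom_hom]
    change 𝟙 (X ⊗ Y) ▷ Z ≫ (α_ X Y Z).hom ≫ X ◁ 𝟙 (Y ⊗ Z) = _
    simp
  rw [e] at h
  exact h

instance isComonHom_leftUnitor : IsComonHom (λ_ X).hom := by
  have h := (λ_ (Comon.mk X)).hom.isComonHom_hom
  have e : (λ_ (Comon.mk X)).hom.hom = (λ_ X).hom := by
    rw [Comon.monoidal_leftUnitor_hom_hom]
    change 𝟙 (𝟙_ A) ▷ X ≫ (λ_ X).hom = _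
    simp
  rw [e] at h
  exact h

instance isComonHom_rightUnitor : IsComonHom (ρ_ X).hom := by
  have h := (ρ_ (Comon.mk X)).hom.isComonHom_hom
  have e : (ρ_ (Comon.mk X)).hom.hom = (ρ_ X).hom := by
    rw [Comon.monoidal_rightUnitor_hom_hom]
    change X ◁ 𝟙 (𝟙_ A) ≫ (ρ_ X).hom = _
    simp
  rw [e] at h
  exact h

instance isComonHom_counit : IsComonHom ε[X] where
  hom_counit := Category.comp_id _
  hom_comul := by
    change ε[X] ≫ (λ_ (𝟙_ A)).inv = _
    simp [unitors_inv_equal]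

end

/-- By naturality of `tensorμ` the counits can be applied before the middle exchange. That exchange
then only permutes two copies of the unit, so it is trivial, and the counit laws of `X` and `Y`
remain. This is the uniqueness half of the product property of `X ⊗ Y`. -/
theorem tensor_comul_projections (X Y : A) [ComonObj X] [ComonObj Y] :
    Δ[X ⊗ Y] ≫ ((X ◁ ε[Y] ≫ (ρ_ X).hom) ⊗ₘ (ε[X] ▷ Y ≫ (λ_ Y).hom)) = 𝟙 _ := by
  have h : tensorμ X (𝟙_ A) (𝟙_ A) Y =
      (X ⊗ 𝟙_ A) ◁ (𝟙 (𝟙_ A ⊗ Y)) ≫ ((ρ_ X).hom ⊗ₘ (λ_ Y).hom) ≫ ((ρ_ X).inv ⊗ₘ (λ_ Y).inv) := by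
    simp only [tensorμ, braiding_tensorUnit_left]
    monoidal
  rw [Comon.tensorObj_comul, ← tensorHom_comp_tensorHom, ← id_tensorHom, ← tensorHom_id]
  simp only [Category.assoc]
  rw [← tensorμ_natural_assoc, tensorHom_comp_tensorHom_assoc, h]
  simp

end Comon

/-! ### Consequences of symmetry and cocommutativity. -/

section CommComon

variable {A : Type u₁} [Category.{w} A] [MonoidalCategory A] [SymmetricCategory A]

variable (A) in
/-- The opposite of a symmetric monoidal category is symmetric monoidal. -/
abbrev symmetricCategoryOp : SymmetricCategory Aᵒᵖ where
  symmetry X Y := Quiver.Hom.unop_inj (by simp)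

/-- Dual to the fact that the braiding is a morphism of monoids in a symmetric category, applied in
the opposite category. -/
instance isComonHom_braiding (X Y : A) [ComonObj X] [ComonObj Y] :
    IsComonHom (β_ X Y).hom :=
  letI := Comon.ComonToMonOpOpObjMon (Comon.mk X)
  letI := Comon.ComonToMonOpOpObjMon (Comon.mk Y)
  letI := symmetricCategoryOp A
  { hom_counit := congrArg Quiver.Hom.unop (MonObj.one_braiding (op Y) (op X))
    hom_comul := by
      have h := congrArg Quiver.Hom.unop (MonObj.mul_braiding (op Y) (op X))
      rw [Comon.tensorObj_comul', Comon.tensorObj_comul']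
      exact h }

/-- Dual to the identity `(a b)(c d) = (a c)(b d)` in a commutative monoid. Cocommutativity enters
the product property here: it makes the pairing of two coalgebra morphisms a coalgebra morphism. -/
instance isComonHom_comul (X : A) [ComonObj X] [IsCommComonObj X] : IsComonHom Δ[X] where
  hom_counit := by simp [unitors_equal]
  hom_comul := by
    let _ := Comon.ComonToMonOpOpObjMon (Comon.mk X)
    have : IsCommMonObj (op X) := ⟨congrArg Quiver.Hom.op (IsCommComonObj.comul_comm X)⟩
    have h := congrArg Quiver.Hom.unop (MonObj.mul_mul_mul_comm (op X))
    rw [unop_comp, unop_comp, BraidedCategory.unop_tensorμ] at h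
    rw [Comon.tensorObj_comul]
    exact (Category.assoc _ _ _).symm.trans h

/-! ### The cartesian monoidal category of cocommutative coalgebras -/

/-- A morphism of cocommutative coalgebras given by a coalgebra morphism. -/
def commComonHom {X Y : CommComon A} (f : X.X ⟶ Y.X) (hf : IsComonHom f := by infer_instance) :
    X ⟶ Y :=
  ⟨{ hom := f, isComonHom_hom := hf }⟩

/-- The underlying morphism of a morphism of cocommutative coalgebras. -/
def und {X Y : CommComon A} (f : X ⟶ Y) : X.X ⟶ Y.X := f.hom.hom

@[simp]
theorem und_id (X : CommComon A) : und (𝟙 X) = 𝟙 X.X := rfl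

@[simp]
theorem und_comp {X Y Z : CommComon A} (f : X ⟶ Y) (g : Y ⟶ Z) :
    und (f ≫ g) = und f ≫ und g := rfl

instance {X Y : CommComon A} (f : X ⟶ Y) : IsComonHom (und f) := f.hom.isComonHom_hom

theorem und_injective {X Y : CommComon A} {f g : X ⟶ Y} (h : und f = und g) : f = g :=
  CommComon.hom_ext _ _ h

/-- An isomorphism of cocommutative coalgebras given by a coalgebra morphism. -/
def commComonIso {X Y : CommComon A} (f : X.X ≅ Y.X) (hf : IsComonHom f.hom := by infer_instance) :
    X ≅ Y where
  hom := commComonHom f.hom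
  inv := commComonHom f.inv
  hom_inv_id := und_injective f.hom_inv_id
  inv_hom_id := und_injective f.inv_hom_id

variable (A) in
/-- The underlying object of a cocommutative coalgebra. -/
def commComonForget : CommComon A ⥤ A where
  obj X := X.X
  map f := und f

instance : (commComonForget A).Faithful where
  map_injective h := und_injective h

theorem isIso_of_und {X Y : CommComon A} (f : X ⟶ Y) (hf : IsIso (und f)) : IsIso f :=
  (commComonIso (asIso (und f)) (inferInstanceAs (IsComonHom (und f)))).isIso_hom

theorem isComonHom_counit_trivial (X : CommComon A) :
    IsComonHom (N := (CommComon.trivial A).X) ε[X.X] :=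
  isComonHom_counit

theorem isComonHom_leftUnitor_trivial (X : CommComon A) :
    IsComonHom (M := (CommComon.trivial A).X ⊗ X.X) (λ_ X.X).hom :=
  isComonHom_leftUnitor

theorem isComonHom_rightUnitor_trivial (X : CommComon A) :
    IsComonHom (M := X.X ⊗ (CommComon.trivial A).X) (ρ_ X.X).hom :=
  isComonHom_rightUnitor

instance commComonMonoidalStruct : MonoidalCategoryStruct (CommComon A) where
  tensorObj X Y := { X := X.X ⊗ Y.X }
  whiskerLeft X _ _ f := commComonHom (X.X ◁ und f)
  whiskerRight f X := commComonHom (und f ▷ X.X)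
  tensorHom f g := commComonHom (und f ⊗ₘ und g)
  tensorUnit := CommComon.trivial A
  associator X Y Z := commComonIso (α_ X.X Y.X Z.X)
  leftUnitor X := commComonIso (X := { X := (CommComon.trivial A).X ⊗ X.X }) (λ_ X.X)
    (isComonHom_leftUnitor_trivial X)
  rightUnitor X := commComonIso (X := { X := X.X ⊗ (CommComon.trivial A).X }) (ρ_ X.X)
    (isComonHom_rightUnitor_trivial X)

variable (A) in
/-- The data by which the tensor product of coalgebras is induced from that of the objects. -/
def commComonInducing : Monoidal.InducingFunctorData (commComonForget A) where
  μIso _ _ := Iso.refl _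
  εIso := Iso.refl _
  whiskerLeft_eq X _ _ f := by
    change X.X ◁ und f = 𝟙 _ ≫ (X.X ◁ und f) ≫ 𝟙 _
    simp
  whiskerRight_eq f X := by
    change und f ▷ X.X = 𝟙 _ ≫ (und f ▷ X.X) ≫ 𝟙 _
    simp
  tensorHom_eq f g := by
    change und f ⊗ₘ und g = 𝟙 _ ≫ (und f ⊗ₘ und g) ≫ 𝟙 _
    simp
  associator_eq X Y Z := by
    change (α_ X.X Y.X Z.X).hom = (𝟙 _ ≫ (𝟙 (X.X ⊗ Y.X) ⊗ₘ 𝟙 Z.X)) ≫ (α_ X.X Y.X Z.X).hom ≫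
      (𝟙 X.X ⊗ₘ 𝟙 (Y.X ⊗ Z.X)) ≫ 𝟙 _
    simp
  leftUnitor_eq X := by
    change (λ_ X.X).hom = (𝟙 _ ≫ (𝟙 (𝟙_ A) ⊗ₘ 𝟙 X.X)) ≫ (λ_ X.X).hom
    simp
  rightUnitor_eq X := by
    change (ρ_ X.X).hom = (𝟙 _ ≫ (𝟙 X.X ⊗ₘ 𝟙 (𝟙_ A))) ≫ (ρ_ X.X).hom
    simp

instance commComonMonoidal : MonoidalCategory (CommComon A) :=
  Monoidal.induced _ (commComonInducing A)

/-- The counit, as a morphism of coalgebras. -/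
def commComonCounit (X : CommComon A) : X ⟶ 𝟙_ (CommComon A) :=
  commComonHom (Y := CommComon.trivial A) ε[X.X] (isComonHom_counit_trivial X)

/-- The morphism to a tensor product of coalgebras with prescribed components. -/
def commComonLift {T X Y : CommComon A} (f : T ⟶ X) (g : T ⟶ Y) : T ⟶ X ⊗ Y :=
  commComonHom (Y := X ⊗ Y) (Δ[T.X] ≫ (und f ⊗ₘ und g))
    (inferInstanceAs (IsComonHom (Δ[T.X] ≫ (und f ⊗ₘ und g))))

theorem commComonLift_fst {T X Y : CommComon A} (f : T ⟶ X) (g : T ⟶ Y) :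
    commComonLift f g ≫ X ◁ commComonCounit Y ≫ (ρ_ X).hom = f := by
  apply und_injective
  change (Δ[T.X] ≫ (und f ⊗ₘ und g)) ≫ X.X ◁ ε[Y.X] ≫ (ρ_ X.X).hom = und f
  rw [← id_tensorHom, Category.assoc, tensorHom_comp_tensorHom_assoc, IsComonHom.hom_counit]
  simp

theorem commComonLift_snd {T X Y : CommComon A} (f : T ⟶ X) (g : T ⟶ Y) :
    commComonLift f g ≫ commComonCounit X ▷ Y ≫ (λ_ Y).hom = g := by
  apply und_injective
  change (Δ[T.X] ≫ (und f ⊗ₘ und g)) ≫ ε[X.X] ▷ Y.X ≫ (λ_ Y.X).hom = und g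
  rw [← tensorHom_id, Category.assoc, tensorHom_comp_tensorHom_assoc, IsComonHom.hom_counit]
  simp

/-- Since `m` commutes with comultiplications, `Δ ≫ (m ⊗ₘ m)` is `m ≫ Δ`, and the two projections
after the latter `Δ` give the identity by `tensor_comul_projections`. -/
theorem commComonLift_uniq {T X Y : CommComon A} (m : T ⟶ X ⊗ Y) :
    m = commComonLift (m ≫ X ◁ commComonCounit Y ≫ (ρ_ X).hom)
      (m ≫ commComonCounit X ▷ Y ≫ (λ_ Y).hom) := by
  apply und_injective
  change und m = Δ[T.X] ≫ ((und m ≫ X.X ◁ ε[Y.X] ≫ (ρ_ X.X).hom) ⊗ₘ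
    (und m ≫ ε[X.X] ▷ Y.X ≫ (λ_ Y.X).hom))
  have h := IsComonHom.hom_comul (M := T.X) (N := X.X ⊗ Y.X) (und m)
  rw [← tensorHom_comp_tensorHom, ← Category.assoc, ← h, Category.assoc,
    tensor_comul_projections, Category.comp_id]

/-- The two projections of a tensor product of coalgebras make it a product. -/
instance : CartesianMonoidalCategory (CommComon A) where
  toMonoidalCategory := commComonMonoidal
  isTerminalTensorUnit := IsTerminal.ofUniqueHom commComonCounit
    (fun X m => by
      apply und_injective
      have h := IsComonHom.hom_counit (M := X.X) (N := (CommComon.trivial A).X) (und m)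
      exact (Category.comp_id _).symm.trans h)
  fst X Y := X ◁ commComonCounit Y ≫ (ρ_ X).hom
  snd X Y := commComonCounit X ▷ Y ≫ (λ_ Y).hom
  fst_def X Y := rfl
  snd_def X Y := rfl
  tensorProductIsBinaryProduct X Y := BinaryFan.isLimitMk
    (fun s => commComonLift s.fst s.snd)
    (fun s => commComonLift_fst s.fst s.snd)
    (fun s => commComonLift_snd s.fst s.snd)
    (fun s m h₁ h₂ => by
      rw [← h₁, ← h₂]
      exact commComonLift_uniq m)

instance : BraidedCategory (CommComon A) where
  braiding X Y := commComonIso (X := X ⊗ Y) (Y := Y ⊗ X) (β_ X.X Y.X)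
    (isComonHom_braiding X.X Y.X)
  braiding_naturality_right _ _ _ _ := und_injective (BraidedCategory.braiding_naturality_right ..)
  braiding_naturality_left _ _ := und_injective (BraidedCategory.braiding_naturality_left ..)
  hexagon_forward _ _ _ := und_injective (BraidedCategory.hexagon_forward ..)
  hexagon_reverse _ _ _ := und_injective (BraidedCategory.hexagon_reverse ..)

theorem und_lift {T X Y : CommComon A} (f : T ⟶ X) (g : T ⟶ Y) :
    und (lift f g) = Δ[T.X] ≫ (und f ⊗ₘ und g) := rfl

open Functor.LaxMonoidal Functor.OplaxMonoidal

instance : (commComonForget A).Braided where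
  toMonoidal := (Monoidal.fromInducedCoreMonoidal _ (commComonInducing A)).toMonoidal
  braided X Y := by
    change 𝟙 _ ≫ (β_ X.X Y.X).hom = (β_ X.X Y.X).hom ≫ 𝟙 _
    simp

end CommComon

end
end ClassifyingVectoid

namespace ClassifyingVectoid

open Limits ComonObj CartesianMonoidalCategory

noncomputable section

/-! ### Powers of an object in a cartesian monoidal category -/

section Recursion

variable {A : Type u} [Category.{w} A] [MonoidalCategory A]

/-- The morphism between tensor powers given by a morphism in all factors but the last. -/
def powWhisker (X : A) {m n : ℕ} (f : tensorPow X m ⟶ tensorPow X n) :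
    tensorPow X (m + 1) ⟶ tensorPow X (n + 1) := f ▷ X

variable [SymmetricCategory A]

theorem moveLast_last (X : A) (n : ℕ) :
    moveLast X (n + 1) (Fin.last (n + 1)) = 𝟙 (tensorPow X (n + 2)) := by
  rw [moveLast, Fin.lastCases_last]

theorem moveLast_castSucc (X : A) (n : ℕ) (j : Fin (n + 1)) :
    moveLast X (n + 1) j.castSucc = powWhisker X (moveLast X n j) ≫ swapLast X n := by
  rw [moveLast, Fin.lastCases_castSucc]
  rfl

theorem permMap_succ (X : A) (n : ℕ) (σ : Equiv.Perm (Fin (n + 1))) :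
    permMap X (n + 1) σ =
      moveLast X n (σ (Fin.last n)) ≫ powWhisker X (permMap X n (deleteLast σ)) := rfl

end Recursion

section Power

variable {D : Type u} [Category.{w} D] [CartesianMonoidalCategory D]

/-- The projection forgetting the last factor of a power. -/
def powInit (X : D) (n : ℕ) : tensorPow X (n + 1) ⟶ tensorPow X n := fst (tensorPow X n) X

/-- The projection to the last factor of a power. -/
def powLast (X : D) (n : ℕ) : tensorPow X (n + 1) ⟶ X := snd (tensorPow X n) X

theorem pow_succ_hom_ext {T X : D} {n : ℕ} {f g : T ⟶ tensorPow X (n + 1)}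
    (h₁ : f ≫ powInit X n = g ≫ powInit X n) (h₂ : f ≫ powLast X n = g ≫ powLast X n) : f = g :=
  CartesianMonoidalCategory.hom_ext (X := tensorPow X n) (Y := X) f g h₁ h₂

/-- The projections of a power. -/
def powProj (X : D) : ∀ n : ℕ, Fin n → (tensorPow X n ⟶ X)
  | 0, i => i.elim0
  | n + 1, i => Fin.lastCases (motive := fun _ => tensorPow X (n + 1) ⟶ X) (powLast X n)
      (fun j => powInit X n ≫ powProj X n j) i

/-- The morphism to a power with prescribed components. -/
def powLift {T X : D} : ∀ n : ℕ, (Fin n → (T ⟶ X)) → (T ⟶ tensorPow X n)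
  | 0, _ => toUnit T
  | n + 1, f => lift (powLift n (fun i => f i.castSucc)) (f (Fin.last n))

@[simp]
theorem powProj_last (X : D) (n : ℕ) : powProj X (n + 1) (Fin.last n) = powLast X n := by
  rw [powProj, Fin.lastCases_last]

@[simp]
theorem powProj_castSucc (X : D) (n : ℕ) (i : Fin n) :
    powProj X (n + 1) i.castSucc = powInit X n ≫ powProj X n i := by
  rw [powProj, Fin.lastCases_castSucc]

theorem powLift_init {T X : D} (n : ℕ) (f : Fin (n + 1) → (T ⟶ X)) :
    powLift (n + 1) f ≫ powInit X n = powLift n (fun i => f i.castSucc) :=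
  lift_fst _ _

theorem powLift_last {T X : D} (n : ℕ) (f : Fin (n + 1) → (T ⟶ X)) :
    powLift (n + 1) f ≫ powLast X n = f (Fin.last n) :=
  lift_snd _ _

@[simp]
theorem powLift_proj {T X : D} : ∀ (n : ℕ) (f : Fin n → (T ⟶ X)) (i : Fin n),
    powLift n f ≫ powProj X n i = f i
  | 0, _, i => i.elim0
  | n + 1, f, i => by
    refine Fin.lastCases ?_ (fun j => ?_) i
    · rw [powProj_last, powLift_last]
    · rw [powProj_castSucc, reassoc_of% @powLift_init, powLift_proj]

theorem pow_hom_ext {T X : D} : ∀ (n : ℕ) {f g : T ⟶ tensorPow X n}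
    (_ : ∀ i, f ≫ powProj X n i = g ≫ powProj X n i), f = g
  | 0, f, g, _ => toUnit_unique (C := D) f g
  | n + 1, f, g, h => by
    refine pow_succ_hom_ext (pow_hom_ext n fun i => ?_) ?_
    · simpa using h i.castSucc
    · simpa using h (Fin.last n)

theorem tensorPowAdd_init (X : D) (m n : ℕ) :
    (tensorPowAdd X m (n + 1)).hom ≫ powInit X (m + n) =
      tensorPow X m ◁ powInit X n ≫ (tensorPowAdd X m n).hom := by
  change ((α_ (tensorPow X m) (tensorPow X n) X).inv ≫ (tensorPowAdd X m n).hom ▷ X) ≫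
    fst (tensorPow X (m + n)) X = tensorPow X m ◁ fst (tensorPow X n) X ≫ (tensorPowAdd X m n).hom
  rw [Category.assoc, whiskerRight_fst, ← Category.assoc]
  congr 1
  apply CartesianMonoidalCategory.hom_ext <;> simp

theorem tensorPowAdd_last (X : D) (m n : ℕ) :
    (tensorPowAdd X m (n + 1)).hom ≫ powLast X (m + n) =
      snd (tensorPow X m) (tensorPow X (n + 1)) ≫ powLast X n := by
  change ((α_ (tensorPow X m) (tensorPow X n) X).inv ≫ (tensorPowAdd X m n).hom ▷ X) ≫
    snd (tensorPow X (m + n)) X = snd (tensorPow X m) (tensorPow X n ⊗ X) ≫ snd (tensorPow X n) X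
  simp

@[simp]
theorem tensorPowAdd_proj_left (X : D) (m : ℕ) : ∀ (n : ℕ) (i : Fin m),
    (tensorPowAdd X m n).hom ≫ powProj X (m + n) (Fin.castAdd n i) =
      fst (tensorPow X m) (tensorPow X n) ≫ powProj X m i
  | 0, i => congrArg (· ≫ powProj X m i) (rightUnitor_hom (tensorPow X m))
  | n + 1, i => by
    have h := powProj_castSucc X (m + n) (Fin.castAdd n i)
    refine (congrArg ((tensorPowAdd X m (n + 1)).hom ≫ ·) h).trans ?_
    rw [reassoc_of% @tensorPowAdd_init, tensorPowAdd_proj_left, whiskerLeft_fst_assoc]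

@[simp]
theorem tensorPowAdd_proj_right (X : D) (m : ℕ) : ∀ (n : ℕ) (i : Fin n),
    (tensorPowAdd X m n).hom ≫ powProj X (m + n) (Fin.natAdd m i) =
      snd (tensorPow X m) (tensorPow X n) ≫ powProj X n i
  | 0, i => i.elim0
  | n + 1, i => by
    refine Fin.lastCases ?_ (fun j => ?_) i
    · have h := powProj_last X (m + n)
      refine (congrArg ((tensorPowAdd X m (n + 1)).hom ≫ ·) h).trans ?_
      rw [tensorPowAdd_last, powProj_last]
    · have h := powProj_castSucc X (m + n) (Fin.natAdd m j)
      refine (congrArg ((tensorPowAdd X m (n + 1)).hom ≫ ·) h).trans ?_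
      rw [reassoc_of% @tensorPowAdd_init, tensorPowAdd_proj_right, whiskerLeft_snd_assoc, powProj_castSucc]

theorem iterComul_init (X : D) [ComonObj X] (n : ℕ) :
    iterComul X (n + 1) ≫ powInit X n = iterComul X n := by
  change (Δ[X] ≫ iterComul X n ▷ X) ≫ fst (tensorPow X n) X = _
  simp

theorem iterComul_last (X : D) [ComonObj X] (n : ℕ) :
    iterComul X (n + 1) ≫ powLast X n = 𝟙 X := by
  change (Δ[X] ≫ iterComul X n ▷ X) ≫ snd (tensorPow X n) X = _
  simp

/-- In a cartesian category the comultiplication can only be the diagonal, so the iterated one is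
the diagonal of the power. -/
theorem iterComul_proj (X : D) [ComonObj X] : ∀ (n : ℕ) (i : Fin n),
    iterComul X n ≫ powProj X n i = 𝟙 X
  | 0, i => i.elim0
  | n + 1, i => by
    refine Fin.lastCases ?_ (fun j => ?_) i
    · rw [powProj_last, iterComul_last]
    · rw [powProj_castSucc, reassoc_of% @iterComul_init, iterComul_proj]

/-- The index of the block containing an element of a sum of blocks. -/
def blockIndex : ∀ (n : ℕ) (p : Fin n → ℕ), Fin (blockSum n p) → Fin n
  | 0, _, i => i
  | n + 1, p, i => Fin.addCases (motive := fun _ => Fin (n + 1))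
      (fun j => (blockIndex n (fun i => p i.castSucc) j).castSucc) (fun _ => Fin.last n) i

theorem blockIndex_castAdd (n : ℕ) (p : Fin (n + 1) → ℕ)
    (j : Fin (blockSum n (fun i => p i.castSucc))) :
    blockIndex (n + 1) p (Fin.castAdd (p (Fin.last n)) j) =
      (blockIndex n (fun i => p i.castSucc) j).castSucc :=
  Fin.addCases_left (motive := fun _ => Fin (n + 1)) _

theorem blockIndex_natAdd (n : ℕ) (p : Fin (n + 1) → ℕ) (j : Fin (p (Fin.last n))) :
    blockIndex (n + 1) p (Fin.natAdd (blockSum n (fun i => p i.castSucc)) j) = Fin.last n :=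
  Fin.addCases_right (motive := fun _ => Fin (n + 1)) _

/-- Each block is a diagonal copy of one source factor, so a component is the projection indexed by
the block it lies in. -/
theorem blockComul_proj (X : D) [ComonObj X] : ∀ (n : ℕ) (p : Fin n → ℕ) (i : Fin (blockSum n p)),
    blockComul X n p ≫ powProj X (blockSum n p) i = powProj X n (blockIndex n p i)
  | 0, _, i => i.elim0
  | n + 1, p, i => by
    have key : ∀ i : Fin (blockSum n (fun i => p i.castSucc) + p (Fin.last n)),
        ((blockComul X n (fun i => p i.castSucc) ⊗ₘ iterComul X (p (Fin.last n))) ≫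
          (tensorPowAdd X _ _).hom) ≫ powProj X (blockSum n _ + p (Fin.last n)) i =
            powProj X (n + 1) (blockIndex (n + 1) p i) := by
      intro i
      refine Fin.addCases (fun j => ?_) (fun j => ?_) i
      · rw [blockIndex_castAdd, powProj_castSucc, Category.assoc, tensorPowAdd_proj_left,
          tensorHom_fst_assoc, blockComul_proj]
        rfl
      · rw [blockIndex_natAdd, powProj_last, Category.assoc, tensorPowAdd_proj_right,
          tensorHom_snd_assoc, iterComul_proj, Category.comp_id]
        rfl
    exact key i

theorem eqToHom_powProj (X : D) {m n : ℕ} (h : m = n) (i : Fin n) :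
    eqToHom (congrArg (tensorPow X) h) ≫ powProj X n i = powProj X m (Fin.cast h.symm i) := by
  subst h
  simp

theorem blockIndex_monotone : ∀ (n : ℕ) (p : Fin n → ℕ), Monotone (blockIndex n p)
  | 0, _ => fun i => i.elim0
  | n + 1, p => by
    intro i j
    change Fin (blockSum n (fun i => p i.castSucc) + p (Fin.last n)) at i j
    induction i using Fin.addCases with
    | left i =>
      induction j using Fin.addCases with
      | left j =>
        intro h
        rw [blockIndex_castAdd, blockIndex_castAdd]
        exact Fin.castSucc_le_castSucc_iff.2 (blockIndex_monotone n _ h)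
      | right j =>
        intro _
        rw [blockIndex_natAdd]
        exact Fin.le_last _
    | right i =>
      induction j using Fin.addCases with
      | left j =>
        intro h
        have h' : blockSum n (fun i => p i.castSucc) + (i : ℕ) ≤ j := h
        omega
      | right j =>
        intro _
        rw [blockIndex_natAdd, blockIndex_natAdd]

theorem fibreCard_blockIndex : ∀ (n : ℕ) (p : Fin n → ℕ), fibreCard (blockIndex n p) = p
  | 0, _ => funext fun i => i.elim0
  | n + 1, p => by
    funext k
    unfold fibreCard
    simp only [Finset.card_filter]
    change ∑ i : Fin (blockSum n (fun i => p i.castSucc) + p (Fin.last n)), _ = _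
    rw [Fin.sum_univ_add]
    simp only [blockIndex_castAdd, blockIndex_natAdd]
    refine Fin.lastCases ?_ (fun k => ?_) k
    · simp [Fin.castSucc_ne_last]
    · have h := congrFun (fibreCard_blockIndex n (fun i => p i.castSucc)) k
      simp only [fibreCard, Finset.card_filter] at h
      simp [h, (Fin.castSucc_ne_last k).symm]

/-- A non-decreasing map is determined by the cardinalities of its fibres. -/
theorem eq_of_fibreCard_eq {m n : ℕ} {φ ψ : Fin m → Fin n} (hφ : Monotone φ) (hψ : Monotone ψ)
    (h : fibreCard φ = fibreCard ψ) : φ = ψ := by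
  apply List.ofFn_injective
  -- Listed in order, the values of each map form a sorted list. The fibre cardinalities are the
  -- multiplicities, and two sorted lists with equal multiplicities coincide.
  refine List.Perm.eq_of_pairwise (le := (· ≤ ·)) (fun a b _ _ => le_antisymm)
    (List.pairwise_ofFn.2 fun i j hij => hφ hij.le) (List.pairwise_ofFn.2 fun i j hij => hψ hij.le) ?_
  rw [List.perm_iff_count]
  intro a
  have key : ∀ χ : Fin m → Fin n, List.count a (List.ofFn χ) = fibreCard χ a := by
    intro χ
    rw [fibreCard, ← Multiset.coe_count, ← Fin.univ_val_map, Multiset.count_map, Finset.card_def,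
      Finset.filter_val]
    simp only [eq_comm]
  rw [key, key, h]

/-- Up to the identification of `blockSum n (fibreCard φ)` with `m`, the block index function is
`φ`: both are non-decreasing and have the same fibre cardinalities. -/
theorem monoMap_proj (X : D) [ComonObj X] {m n : ℕ} (φ : Fin m →o Fin n) (i : Fin m) :
    monoMap X φ ≫ powProj X m i = powProj X n (φ i) := by
  rw [monoMap, Category.assoc, eqToHom_powProj X (blockSum_fibreCard φ), blockComul_proj]
  congr 1
  have h : blockIndex n (fibreCard φ) = φ ∘ Fin.cast (blockSum_fibreCard φ) := by
    apply eq_of_fibreCard_eq (blockIndex_monotone _ _)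
    · exact φ.monotone.comp (fun _ _ h => h)
    · rw [fibreCard_blockIndex]
      have : ∀ {k : ℕ} (e : k = m), fibreCard φ = fibreCard (φ ∘ Fin.cast e) := by
        rintro _ rfl
        rfl
      exact this _
  rw [h]
  rfl

theorem powWhisker_init (X : D) {m n : ℕ} (f : tensorPow X m ⟶ tensorPow X n) :
    powWhisker X f ≫ powInit X n = powInit X m ≫ f :=
  whiskerRight_fst _ _

theorem powWhisker_last (X : D) {m n : ℕ} (f : tensorPow X m ⟶ tensorPow X n) :
    powWhisker X f ≫ powLast X n = powLast X m :=
  whiskerRight_snd _ _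

/-! ### Permutations of the factors of a power. -/

section Perm

variable [BraidedCategory D]

theorem swapLast_init_init (X : D) (n : ℕ) :
    swapLast X n ≫ powInit X (n + 1) ≫ powInit X n = powInit X (n + 1) ≫ powInit X n := by
  change ((α_ (tensorPow X n) X X).hom ≫ tensorPow X n ◁ (β_ X X).hom ≫
    (α_ (tensorPow X n) X X).inv) ≫ fst (tensorPow X n ⊗ X) X ≫ fst (tensorPow X n) X =
      fst (tensorPow X n ⊗ X) X ≫ fst (tensorPow X n) X
  simp

theorem swapLast_init_last (X : D) (n : ℕ) :
    swapLast X n ≫ powInit X (n + 1) ≫ powLast X n = powLast X (n + 1) := by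
  change ((α_ (tensorPow X n) X X).hom ≫ tensorPow X n ◁ (β_ X X).hom ≫
    (α_ (tensorPow X n) X X).inv) ≫ fst (tensorPow X n ⊗ X) X ≫ snd (tensorPow X n) X =
      snd (tensorPow X n ⊗ X) X
  simp

theorem swapLast_last (X : D) (n : ℕ) :
    swapLast X n ≫ powLast X (n + 1) = powInit X (n + 1) ≫ powLast X n := by
  change ((α_ (tensorPow X n) X X).hom ≫ tensorPow X n ◁ (β_ X X).hom ≫
    (α_ (tensorPow X n) X X).inv) ≫ snd (tensorPow X n ⊗ X) X =
      fst (tensorPow X n ⊗ X) X ≫ snd (tensorPow X n) X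
  simp

theorem moveLast_powLast (X : D) : ∀ (n : ℕ) (k : Fin (n + 1)),
    moveLast X n k ≫ powLast X n = powProj X (n + 1) k
  | 0, k => by
    obtain rfl : k = Fin.last 0 := Fin.ext (by omega)
    rw [powProj_last]
    exact Category.id_comp _
  | n + 1, k => by
    refine Fin.lastCases ?_ (fun j => ?_) k
    · rw [moveLast_last, powProj_last, Category.id_comp]
    · rw [moveLast_castSucc, Category.assoc, swapLast_last, reassoc_of% @powWhisker_init,
        moveLast_powLast, powProj_castSucc]

/-- The factors other than the `k`-th keep their order, and `k.succAbove` is the increasing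
enumeration of their indices. -/
theorem moveLast_powInit (X : D) : ∀ (n : ℕ) (k : Fin (n + 1)) (i : Fin n),
    moveLast X n k ≫ powInit X n ≫ powProj X n i = powProj X (n + 1) (k.succAbove i)
  | 0, _, i => i.elim0
  | n + 1, k, i => by
    refine Fin.lastCases ?_ (fun j => ?_) k
    · rw [moveLast_last, Fin.succAbove_last, powProj_castSucc, Category.id_comp]
    · rw [moveLast_castSucc, Category.assoc]
      refine Fin.lastCases ?_ (fun l => ?_) i
      · rw [powProj_last, swapLast_init_last, powWhisker_last,
          Fin.succAbove_of_le_castSucc _ _ (Fin.castSucc_le_castSucc_iff.2 (Fin.le_last j)), Fin.succ_last, powProj_last]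
      · rw [powProj_castSucc, reassoc_of% @swapLast_init_init, reassoc_of% @powWhisker_init, moveLast_powInit,
          ← powProj_castSucc, Fin.castSucc_succAbove_castSucc]

theorem succAbove_deleteLast {n : ℕ} (σ : Equiv.Perm (Fin (n + 1))) (i : Fin n) :
    (σ (Fin.last n)).succAbove (deleteLast σ i) = σ i.castSucc := by
  set k := σ (Fin.last n) with hk
  let e := (finSuccEquivLast.symm.trans σ).trans (finSuccEquiv' k)
  have he : e (some i) = finSuccEquiv' k (σ i.castSucc) := by
    simp [e]
  -- Injectivity of `σ` excludes the value `none`, so `Equiv.removeNone` never uses its fallback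
  -- value here.
  have hne : σ i.castSucc ≠ k := fun h => Fin.castSucc_ne_last i (σ.injective h)
  obtain ⟨z, hz⟩ := Fin.exists_succAbove_eq hne
  have hs : e (some i) = some z := by
    rw [he, ← hz, finSuccEquiv'_succAbove]
  have h := Equiv.removeNone_some e ⟨z, hs⟩
  rw [hs] at h
  have h' : deleteLast σ i = z := Option.some_injective _ h
  rw [h', hz]

/-- The last component is the factor brought to the end by `moveLast`. For the others the two
reindexings compose to `σ` by `succAbove_deleteLast`. -/
theorem permMap_proj (X : D) : ∀ (n : ℕ) (σ : Equiv.Perm (Fin n)) (i : Fin n),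
    permMap X n σ ≫ powProj X n i = powProj X n (σ i)
  | 0, _, i => i.elim0
  | n + 1, σ, i => by
    rw [permMap_succ, Category.assoc]
    refine Fin.lastCases ?_ (fun j => ?_) i
    · rw [powProj_last, powWhisker_last, moveLast_powLast]
    · rw [powProj_castSucc, reassoc_of% @powWhisker_init, permMap_proj, moveLast_powInit,
        succAbove_deleteLast]

end Perm

end Power

end
end ClassifyingVectoid

namespace ClassifyingVectoid

open Limits (IsTerminal BinaryFan BinaryFan.isLimitMk PreservesFiniteProducts)
open ComonObj CartesianMonoidalCategory

noncomputable section

/-! ### The power functor -/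

/-- The opposite of the category of standard finite sets is cartesian monoidal. -/
instance : CartesianMonoidalCategory StdFin.{w}ᵒᵖ where
  toMonoidalCategory := monoidalCategoryOp
  isTerminalTensorUnit := IsTerminal.ofUniqueHom (fun X => (StdFin.fromEmpty X.unop).op)
    (fun _ _ => Quiver.Hom.unop_inj (StdFin.empty_hom_ext _ _))
  fst X Y := (StdFin.inl X.unop Y.unop).op
  snd X Y := (StdFin.inr X.unop Y.unop).op
  fst_def _ _ := Quiver.Hom.unop_inj (StdFin.inl_desc _ _).symm
  snd_def X Y := Quiver.Hom.unop_inj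
    ((StdFin.inr_desc (StdFin.fromEmpty X.unop ≫ StdFin.inl X.unop Y.unop) _).symm)
  tensorProductIsBinaryProduct _ _ := BinaryFan.isLimitMk
    (fun s => (StdFin.desc s.fst.unop s.snd.unop).op)
    (fun _ => Quiver.Hom.unop_inj (StdFin.inl_desc _ _))
    (fun _ => Quiver.Hom.unop_inj (StdFin.inr_desc _ _))
    (fun s _ h₁ h₂ => Quiver.Hom.unop_inj (StdFin.tensor_hom_ext
      ((congrArg Quiver.Hom.unop h₁).trans (StdFin.inl_desc s.fst.unop s.snd.unop).symm)
      ((congrArg Quiver.Hom.unop h₂).trans (StdFin.inr_desc s.fst.unop s.snd.unop).symm)))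

/-- The comparison maps form the canonical oplax monoidal structure of a functor between cartesian
categories; when they are invertible it is strong, which amounts to preserving finite products. -/
theorem preservesFiniteProducts_of_isIso_comparison {C : Type u₁} [Category.{w} C]
    [CartesianMonoidalCategory C] {D : Type u₂} [Category.{w} D] [CartesianMonoidalCategory D]
    (F : C ⥤ D) (h₀ : IsIso (terminalComparison F)) (h : ∀ X Y, IsIso (prodComparison F X Y)) :
    PreservesFiniteProducts F := by
  let _ := Functor.OplaxMonoidal.ofChosenFiniteProducts F
  have : IsIso (Functor.OplaxMonoidal.η F) := h₀
  have : ∀ X Y, IsIso (Functor.OplaxMonoidal.δ F X Y) := h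
  let _ := Functor.Monoidal.ofOplaxMonoidal F
  infer_instance

section PowFunctor

variable {D : Type u} [Category.{w} D] [CartesianMonoidalCategory D]

/-- The powers of an object as a functor on the opposite of the category of standard finite
sets. -/
def powFunctor (X : D) : StdFin.{w}ᵒᵖ ⥤ D where
  obj s := tensorPow X s.unop.len
  map {s t} f := powLift t.unop.len (fun i => powProj X s.unop.len (f.unop ⟨i⟩).down)
  map_id s := pow_hom_ext _ fun i => by
    rw [powLift_proj, Category.id_comp]
    rfl
  map_comp f g := pow_hom_ext _ fun i => by
    rw [powLift_proj, Category.assoc, powLift_proj, powLift_proj]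
    rfl

/-- The projections of a value of the power functor. -/
def powFunctorProj (X : D) (s : StdFin.{w}ᵒᵖ) (i : Fin s.unop.len) : (powFunctor X).obj s ⟶ X :=
  powProj X s.unop.len i

theorem powFunctor_hom_ext {T X : D} {s : StdFin.{w}ᵒᵖ} {f g : T ⟶ (powFunctor X).obj s}
    (h : ∀ i, f ≫ powFunctorProj X s i = g ≫ powFunctorProj X s i) : f = g :=
  pow_hom_ext s.unop.len h

theorem powFunctor_map_proj (X : D) {s t : StdFin.{w}ᵒᵖ} (f : s ⟶ t) (i : Fin t.unop.len) :
    (powFunctor X).map f ≫ powFunctorProj X t i = powFunctorProj X s (f.unop ⟨i⟩).down :=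
  powLift_proj _ _ _

/-- The canonical isomorphism exhibiting the power functor as monoidal. -/
def powμIso (X : D) (s t : StdFin.{w}ᵒᵖ) :
    (powFunctor X).obj s ⊗ (powFunctor X).obj t ≅ (powFunctor X).obj (s ⊗ t) :=
  tensorPowAdd X s.unop.len t.unop.len

theorem powμIso_map_fst (X : D) (s t : StdFin.{w}ᵒᵖ) :
    (powμIso X s t).hom ≫ (powFunctor X).map (fst s t) = fst _ _ :=
  powFunctor_hom_ext fun i => by
    rw [Category.assoc, powFunctor_map_proj]
    exact tensorPowAdd_proj_left X s.unop.len t.unop.len i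

theorem powμIso_map_snd (X : D) (s t : StdFin.{w}ᵒᵖ) :
    (powμIso X s t).hom ≫ (powFunctor X).map (snd s t) = snd _ _ :=
  powFunctor_hom_ext fun i => by
    rw [Category.assoc, powFunctor_map_proj]
    exact tensorPowAdd_proj_right X s.unop.len t.unop.len i

instance (X : D) : PreservesFiniteProducts (powFunctor X) := by
  apply preservesFiniteProducts_of_isIso_comparison
  · exact ⟨𝟙 (𝟙_ D), powFunctor_hom_ext fun i => i.elim0, toUnit_unique _ _⟩
  · intro s t
    -- The concatenation of powers is inverse to the product comparison, as its projections show.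
    have h : (powμIso X s t).hom ≫ prodComparison (powFunctor X) s t = 𝟙 _ := by
      apply CartesianMonoidalCategory.hom_ext
      · rw [Category.assoc, prodComparison_fst, powμIso_map_fst, Category.id_comp]
      · rw [Category.assoc, prodComparison_snd, powμIso_map_snd, Category.id_comp]
    have : prodComparison (powFunctor X) s t = (powμIso X s t).inv := by
      rw [← cancel_epi (powμIso X s t).hom, h, Iso.hom_inv_id]
    rw [this]
    infer_instance

variable [BraidedCategory D]

instance (X : D) : (powFunctor X).Braided := .ofChosenFiniteProducts _

open Functor.LaxMonoidal Functor.OplaxMonoidal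

theorem powFunctor_μ (X : D) (s t : StdFin.{w}ᵒᵖ) : μ (powFunctor X) s t = (powμIso X s t).hom := by
  rw [← cancel_mono (δ (powFunctor X) s t), Functor.Monoidal.μ_δ]
  apply CartesianMonoidalCategory.hom_ext
  · rw [Category.assoc, Functor.OplaxMonoidal.δ_fst, powμIso_map_fst, Category.id_comp]
  · rw [Category.assoc, Functor.OplaxMonoidal.δ_snd, powμIso_map_snd, Category.id_comp]

theorem powFunctor_ε (X : D) : Functor.LaxMonoidal.ε (powFunctor X) = 𝟙 (𝟙_ D) :=
  powFunctor_hom_ext fun i => i.elim0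

/-- Both sides have the projection with index `φ (σ i)` as `i`-th component. Independence of the
decomposition follows, because the left side sees only `φ ∘ σ`. -/
theorem powFunctor_map (X : D) [ComonObj X] {m n : ℕ} (σ : Equiv.Perm (Fin m))
    (φ : Fin m →o Fin n) :
    (powFunctor X).map (StdFin.ofFun (φ ∘ σ)).op = monoMap X φ ≫ permMap X m σ :=
  powFunctor_hom_ext (s := op (StdFin.mk m)) fun i => by
    change Fin m at i
    have h : (monoMap X φ ≫ permMap X m σ) ≫ powProj X m i = powProj X n (φ (σ i)) := by
      rw [Category.assoc, permMap_proj, monoMap_proj]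
    exact (powFunctor_map_proj X (StdFin.ofFun (φ ∘ σ)).op i).trans h.symm

end PowFunctor

/-! ### Tensor powers and monoidal functors -/

section Transfer

open Functor.LaxMonoidal Functor.OplaxMonoidal

variable {D : Type u₁} [Category.{w} D] [MonoidalCategory D] {A : Type u₂} [Category.{w} A]
  [MonoidalCategory A] (G : D ⥤ A) [G.Monoidal]

/-- A monoidal functor preserves tensor powers. -/
def mapTensorPow (X : D) : ∀ n : ℕ, G.obj (tensorPow X n) ≅ tensorPow (G.obj X) n
  | 0 => (Functor.Monoidal.εIso G).symm
  | n + 1 => (Functor.Monoidal.μIso G (tensorPow X n) X).symm ≪≫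
      whiskerRightIso (mapTensorPow X n) (G.obj X)

/-- Induction on `n`: the base case is the right unitality of `G`, the inductive step its
associativity. -/
theorem map_tensorPowAdd (X : D) (m : ℕ) : ∀ n : ℕ,
    G.map (tensorPowAdd X m n).hom ≫ (mapTensorPow G X (m + n)).hom =
      δ G (tensorPow X m) (tensorPow X n) ≫
        ((mapTensorPow G X m).hom ⊗ₘ (mapTensorPow G X n).hom) ≫ (tensorPowAdd (G.obj X) m n).hom
  | 0 => by
    change G.map (ρ_ (tensorPow X m)).hom ≫ (mapTensorPow G X m).hom =
      δ G (tensorPow X m) (𝟙_ D) ≫ ((mapTensorPow G X m).hom ⊗ₘ η G) ≫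
        (ρ_ (tensorPow (G.obj X) m)).hom
    rw [tensorHom_def', Category.assoc, rightUnitor_naturality]
    simp
  | n + 1 => by
    have h := map_tensorPowAdd X m n
    change G.map ((α_ (tensorPow X m) (tensorPow X n) X).inv ≫ (tensorPowAdd X m n).hom ▷ X) ≫
        δ G (tensorPow X (m + n)) X ≫ (mapTensorPow G X (m + n)).hom ▷ G.obj X =
      δ G (tensorPow X m) (tensorPow X n ⊗ X) ≫
        ((mapTensorPow G X m).hom ⊗ₘ
          (δ G (tensorPow X n) X ≫ (mapTensorPow G X n).hom ▷ G.obj X)) ≫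
        (α_ (tensorPow (G.obj X) m) (tensorPow (G.obj X) n) (G.obj X)).inv ≫
          (tensorPowAdd (G.obj X) m n).hom ▷ G.obj X
    rw [G.map_comp, Category.assoc, ← δ_natural_left_assoc, ← comp_whiskerRight, h]
    have h₁ : (mapTensorPow G X m).hom ⊗ₘ (δ G (tensorPow X n) X ≫
        (mapTensorPow G X n).hom ▷ G.obj X) = G.obj (tensorPow X m) ◁ δ G (tensorPow X n) X ≫
          ((mapTensorPow G X m).hom ⊗ₘ ((mapTensorPow G X n).hom ⊗ₘ 𝟙 (G.obj X))) := by
      rw [← id_tensorHom, tensorHom_comp_tensorHom, Category.id_comp, tensorHom_id]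
    rw [h₁, Category.assoc, associator_inv_naturality_assoc, tensorHom_id]
    simp only [comp_whiskerRight, ← Functor.OplaxMonoidal.associativity_inv_assoc]

theorem map_eqToHom_tensorPow (X : D) {m n : ℕ} (h : m = n) :
    G.map (eqToHom (congrArg (tensorPow X) h)) ≫ (mapTensorPow G X n).hom =
      (mapTensorPow G X m).hom ≫ eqToHom (congrArg (tensorPow (G.obj X)) h) := by
  subst h
  simp

theorem map_powWhisker (X : D) {m n : ℕ} {f : tensorPow X m ⟶ tensorPow X n}
    {f' : tensorPow (G.obj X) m ⟶ tensorPow (G.obj X) n}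
    (h : G.map f ≫ (mapTensorPow G X n).hom = (mapTensorPow G X m).hom ≫ f') :
    G.map (powWhisker X f) ≫ (mapTensorPow G X (n + 1)).hom =
      (mapTensorPow G X (m + 1)).hom ≫ powWhisker (G.obj X) f' := by
  change G.map (f ▷ X) ≫ δ G (tensorPow X n) X ≫ (mapTensorPow G X n).hom ▷ G.obj X =
    (δ G (tensorPow X m) X ≫ (mapTensorPow G X m).hom ▷ G.obj X) ≫ f' ▷ G.obj X
  rw [← δ_natural_left_assoc, ← comp_whiskerRight, h, comp_whiskerRight, Category.assoc]

section Comon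

theorem map_iterComul (X : D) [ComonObj X] [ComonObj (G.obj X)] (hε : G.map ε[X] ≫ η G = ε[G.obj X])
    (hΔ : G.map Δ[X] ≫ δ G X X = Δ[G.obj X]) : ∀ n : ℕ,
    G.map (iterComul X n) ≫ (mapTensorPow G X n).hom = iterComul (G.obj X) n
  | 0 => hε
  | n + 1 => by
    have h := map_iterComul X hε hΔ n
    change G.map (Δ[X] ≫ iterComul X n ▷ X) ≫ δ G (tensorPow X n) X ≫
      (mapTensorPow G X n).hom ▷ G.obj X = Δ[G.obj X] ≫ iterComul (G.obj X) n ▷ G.obj X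
    rw [G.map_comp, Category.assoc, ← δ_natural_left_assoc, ← comp_whiskerRight, h, ← hΔ,
      Category.assoc]

theorem map_blockComul (X : D) [ComonObj X] [ComonObj (G.obj X)] (hε : G.map ε[X] ≫ η G = ε[G.obj X])
    (hΔ : G.map Δ[X] ≫ δ G X X = Δ[G.obj X]) : ∀ (n : ℕ) (p : Fin n → ℕ),
    G.map (blockComul X n p) ≫ (mapTensorPow G X (blockSum n p)).hom =
      (mapTensorPow G X n).hom ≫ blockComul (G.obj X) n p
  | 0, _ => by
    change G.map (𝟙 (tensorPow X 0)) ≫ (mapTensorPow G X 0).hom = (mapTensorPow G X 0).hom ≫ 𝟙 _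
    rw [G.map_id, Category.id_comp, Category.comp_id]
  | n + 1, p => by
    have h := map_blockComul X hε hΔ n (fun i => p i.castSucc)
    change G.map ((blockComul X n (fun i => p i.castSucc) ⊗ₘ iterComul X (p (Fin.last n))) ≫
        (tensorPowAdd X _ _).hom) ≫ (mapTensorPow G X (blockSum n _ + p (Fin.last n))).hom =
      (δ G (tensorPow X n) X ≫ (mapTensorPow G X n).hom ▷ G.obj X) ≫
        (blockComul (G.obj X) n (fun i => p i.castSucc) ⊗ₘ
          iterComul (G.obj X) (p (Fin.last n))) ≫ (tensorPowAdd (G.obj X) _ _).hom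
    rw [G.map_comp, Category.assoc, map_tensorPowAdd, ← δ_natural_assoc,
      tensorHom_comp_tensorHom_assoc, h, map_iterComul G X hε hΔ, Category.assoc, ← tensorHom_id,
      tensorHom_comp_tensorHom_assoc, Category.id_comp]

theorem map_monoMap (X : D) [ComonObj X] [ComonObj (G.obj X)] (hε : G.map ε[X] ≫ η G = ε[G.obj X])
    (hΔ : G.map Δ[X] ≫ δ G X X = Δ[G.obj X])
    {m n : ℕ} (φ : Fin m →o Fin n) :
    G.map (monoMap X φ) ≫ (mapTensorPow G X m).hom =
      (mapTensorPow G X n).hom ≫ monoMap (G.obj X) φ := by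
  rw [monoMap, monoMap, G.map_comp, Category.assoc, map_eqToHom_tensorPow G X (blockSum_fibreCard φ),
    ← Category.assoc, map_blockComul G X hε hΔ, Category.assoc]

end Comon

end Transfer

section TransferBraided

open Functor.LaxMonoidal Functor.OplaxMonoidal

variable {D : Type u₁} [Category.{w} D] [MonoidalCategory D] [SymmetricCategory D]
  {A : Type u₂} [Category.{w} A] [MonoidalCategory A] [SymmetricCategory A] (G : D ⥤ A) [G.Braided]

theorem map_swapLast (X : D) (n : ℕ) : G.map (swapLast X n) ≫ (mapTensorPow G X (n + 2)).hom =
    (mapTensorPow G X (n + 2)).hom ≫ swapLast (G.obj X) n := by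
  -- Associativity of `δ` regroups the identification so that the last two factors are split from
  -- each other by a single `δ G X X`, where the compatibility of `G` with the braiding applies.
  have key : (mapTensorPow G X (n + 2)).hom = G.map (α_ (tensorPow X n) X X).hom ≫
      δ G (tensorPow X n) (X ⊗ X) ≫ ((mapTensorPow G X n).hom ⊗ₘ δ G X X) ≫
        (α_ (tensorPow (G.obj X) n) (G.obj X) (G.obj X)).inv := by
    have h : (mapTensorPow G X (n + 2)).hom = δ G (tensorPow X n ⊗ X) X ≫
      (δ G (tensorPow X n) X ≫ (mapTensorPow G X n).hom ▷ G.obj X) ▷ G.obj X := rfl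
    refine h.trans ?_
    rw [tensorHom_def', Category.assoc, ← tensorHom_id _ (G.obj X ⊗ G.obj X),
      ← id_tensorHom_id, associator_inv_naturality, tensorHom_id, tensorHom_id]
    simp
    rfl
  refine (congrArg (G.map (swapLast X n) ≫ ·) key).trans (Eq.trans ?_
    (congrArg (· ≫ swapLast (G.obj X) n) key.symm))
  change G.map ((α_ (tensorPow X n) X X).hom ≫ tensorPow X n ◁ (β_ X X).hom ≫
      (α_ (tensorPow X n) X X).inv) ≫ G.map (α_ (tensorPow X n) X X).hom ≫
      δ G (tensorPow X n) (X ⊗ X) ≫ ((mapTensorPow G X n).hom ⊗ₘ δ G X X) ≫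
        (α_ (tensorPow (G.obj X) n) (G.obj X) (G.obj X)).inv =
    (G.map (α_ (tensorPow X n) X X).hom ≫
      δ G (tensorPow X n) (X ⊗ X) ≫ ((mapTensorPow G X n).hom ⊗ₘ δ G X X) ≫
        (α_ (tensorPow (G.obj X) n) (G.obj X) (G.obj X)).inv) ≫
      (α_ (tensorPow (G.obj X) n) (G.obj X) (G.obj X)).hom ≫
        tensorPow (G.obj X) n ◁ (β_ (G.obj X) (G.obj X)).hom ≫
        (α_ (tensorPow (G.obj X) n) (G.obj X) (G.obj X)).inv
  have hβ : G.map (β_ X X).hom ≫ δ G X X = δ G X X ≫ (β_ (G.obj X) (G.obj X)).hom := by simp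
  simp only [← G.map_comp_assoc, Category.assoc, Iso.inv_hom_id, Category.comp_id,
    Iso.inv_hom_id_assoc]
  rw [G.map_comp, Category.assoc, ← δ_natural_right_assoc, ← id_tensorHom,
    tensorHom_comp_tensorHom_assoc, Category.id_comp, hβ, ← id_tensorHom,
    tensorHom_comp_tensorHom_assoc, Category.comp_id]

theorem map_moveLast (X : D) : ∀ (n : ℕ) (k : Fin (n + 1)),
    G.map (moveLast X n k) ≫ (mapTensorPow G X (n + 1)).hom =
      (mapTensorPow G X (n + 1)).hom ≫ moveLast (G.obj X) n k
  | 0, k => by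
    change G.map (𝟙 (tensorPow X 1)) ≫ _ = _ ≫ 𝟙 _
    rw [G.map_id, Category.id_comp, Category.comp_id]
  | n + 1, k => by
    refine Fin.lastCases ?_ (fun j => ?_) k
    · rw [moveLast_last, moveLast_last, G.map_id, Category.id_comp, Category.comp_id]
    · rw [moveLast_castSucc, moveLast_castSucc, G.map_comp, Category.assoc, map_swapLast,
        ← Category.assoc, map_powWhisker G X (map_moveLast X n j), Category.assoc]

theorem map_permMap (X : D) : ∀ (n : ℕ) (σ : Equiv.Perm (Fin n)),
    G.map (permMap X n σ) ≫ (mapTensorPow G X n).hom =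
      (mapTensorPow G X n).hom ≫ permMap (G.obj X) n σ
  | 0, _ => by
    change G.map (𝟙 (tensorPow X 0)) ≫ _ = _ ≫ 𝟙 _
    rw [G.map_id, Category.id_comp, Category.comp_id]
  | n + 1, σ => by
    rw [permMap_succ, permMap_succ, G.map_comp, Category.assoc,
      map_powWhisker G X (map_permMap X n (deleteLast σ)), ← Category.assoc, map_moveLast,
      Category.assoc]

end TransferBraided

end
end ClassifyingVectoid

namespace ClassifyingVectoid

open ComonObj CartesianMonoidalCategory

noncomputable section

/-! ### The tensor functor of a cocommutative coalgebra -/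

theorem exists_perm_monotone {m n : ℕ} (f : Fin m → Fin n) :
    ∃ (σ : Equiv.Perm (Fin m)) (φ : Fin m →o Fin n), f = φ ∘ σ :=
  ⟨(Tuple.sort f).symm, ⟨f ∘ Tuple.sort f, Tuple.monotone_sort f⟩, by
    funext i
    simp⟩

section CoalgPow

open Functor.LaxMonoidal Functor.OplaxMonoidal

variable {A : Type u} [Category.{w} A] [MonoidalCategory A] [SymmetricCategory A]

/-- A cocommutative coalgebra is a coalgebra in the cartesian monoidal category of cocommutative
coalgebras. -/
instance commComonComonObj (C : CommComon A) : ComonObj C :=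
  (cartesianComon (CommComon A)).obj C |>.comon

instance commComonForgetComonObj (C : CommComon A) : ComonObj ((commComonForget A).obj C) := C.comon

theorem und_counit (C : CommComon A) : und ε[C] = ε[C.X] := rfl

theorem und_comul (C : CommComon A) : und Δ[C] = Δ[C.X] := by
  change und (lift (𝟙 C) (𝟙 C)) = _
  rw [und_lift, und_id, id_tensorHom_id, Category.comp_id]

/-- The tensor powers of a cocommutative coalgebra as a functor on the opposite of the category of
standard finite sets. -/
def coalgPow (C : CommComon A) : StdFin.{w}ᵒᵖ ⥤ A := powFunctor C ⋙ commComonForget A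

instance (C : CommComon A) : (coalgPow C).Braided :=
  inferInstanceAs (powFunctor C ⋙ commComonForget A).Braided

/-- The values of `coalgPow C` are the tensor powers of `C`. -/
def coalgPowIso (C : CommComon A) (n : ℕ) :
    (coalgPow C).obj (op (StdFin.mk n)) ≅ tensorPow C.X n :=
  mapTensorPow (commComonForget A) C n

/-- The formula holds in the cartesian category `CommComon A` and is carried to `A` by the forgetful
functor, whose monoidal constraints are identities. -/
theorem coalgPow_map (C : CommComon A) {m n : ℕ} (σ : Equiv.Perm (Fin m)) (φ : Fin m →o Fin n) :
    (coalgPow C).map (StdFin.ofFun (φ ∘ σ)).op =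
      (coalgPowIso C n).hom ≫ (monoMap C.X φ ≫ permMap C.X m σ) ≫ (coalgPowIso C m).inv := by
  have h₁ := map_monoMap (commComonForget A) C
    ((Category.comp_id _).trans (und_counit C)) ((Category.comp_id _).trans (und_comul C)) φ
  have h₂ := map_permMap (commComonForget A) C m σ
  rw [← Category.assoc, Iso.eq_comp_inv]
  refine (congrArg (fun f => (commComonForget A).map f ≫ (coalgPowIso C m).hom)
    (powFunctor_map C σ φ)).trans ?_
  refine (congrArg (· ≫ (mapTensorPow (commComonForget A) C m).hom)
    ((commComonForget A).map_comp (monoMap C φ) (permMap C m σ))).trans ?_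
  refine (Category.assoc _ _ _).trans ?_
  refine (congrArg ((commComonForget A).map (monoMap C φ) ≫ ·) h₂).trans ?_
  refine (Category.assoc _ _ _).symm.trans ?_
  refine (congrArg (· ≫ permMap C.X m σ) h₁).trans ?_
  exact Category.assoc _ _ _

theorem monoMap_permMap_eq (C : CommComon A) {m n : ℕ} {σ σ' : Equiv.Perm (Fin m)}
    {φ φ' : Fin m →o Fin n} (h : (φ ∘ σ : Fin m → Fin n) = φ' ∘ σ') :
    monoMap C.X φ ≫ permMap C.X m σ = monoMap C.X φ' ≫ permMap C.X m σ' := by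
  have h₁ := coalgPow_map C σ φ
  rw [h, coalgPow_map, Iso.cancel_iso_hom_left, Iso.cancel_iso_inv_right] at h₁
  exact h₁.symm

theorem coalgPow_ε (C : CommComon A) :
    Functor.LaxMonoidal.ε (coalgPow C) ≫ (coalgPowIso C 0).hom = 𝟙 (𝟙_ A) := by
  have h : Functor.LaxMonoidal.ε (coalgPow C) = Functor.LaxMonoidal.ε (commComonForget A) ≫
    (commComonForget A).map (Functor.LaxMonoidal.ε (powFunctor C)) := rfl
  rw [h, powFunctor_ε]
  refine (congrArg (fun f => (Functor.LaxMonoidal.ε (commComonForget A) ≫ f) ≫ _)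
    ((commComonForget A).map_id _)).trans ?_
  rw [Category.comp_id]
  exact Functor.Monoidal.ε_η (commComonForget A)

theorem coalgPow_μ (C : CommComon A) (m n : ℕ) :
    μ (coalgPow C) (op (StdFin.mk m)) (op (StdFin.mk n)) ≫ (coalgPowIso C (m + n)).hom =
      ((coalgPowIso C m).hom ⊗ₘ (coalgPowIso C n).hom) ≫ (tensorPowAdd C.X m n).hom := by
  have h : μ (coalgPow C) (op (StdFin.mk m)) (op (StdFin.mk n)) =
    μ (commComonForget A) (tensorPow C m) (tensorPow C n) ≫ (commComonForget A).map
      (μ (powFunctor C) (op (StdFin.mk m)) (op (StdFin.mk n))) := rfl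
  rw [h, powFunctor_μ]
  refine (Category.assoc _ _ _).trans ?_
  refine (congrArg (μ (commComonForget A) (tensorPow C m) (tensorPow C n) ≫ ·)
    (map_tensorPowAdd (commComonForget A) C m n)).trans ?_
  exact Functor.Monoidal.μ_δ_assoc (commComonForget A) _ _ _

end CoalgPow

/-! ### Tensor functors on the opposite of the category of standard finite sets -/

section Extend

variable {D : Type u} [Category.{w} D] [CartesianMonoidalCategory D]

/-- The morphism in the opposite of the category of standard finite sets given by an element. -/
def pointAt (s : StdFin.{w}ᵒᵖ) (i : Fin s.unop.len) : s ⟶ op (StdFin.mk 1) :=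
  Quiver.Hom.op (X := StdFin.mk 1) (StdFin.ofFun (n := s.unop.len) (fun _ => i))

theorem comp_pointAt {s t : StdFin.{w}ᵒᵖ} (f : s ⟶ t) (i : Fin t.unop.len) :
    f ≫ pointAt t i = pointAt s (f.unop ⟨i⟩).down := rfl

theorem pointAt_one : pointAt (op (StdFin.mk.{w} 1)) (0 : Fin 1) = 𝟙 _ :=
  Quiver.Hom.unop_inj (StdFin.hom_one_ext _ _)

theorem fst_pointAt (n : ℕ) (i : Fin n) :
    fst (op (StdFin.mk.{w} n)) (op (StdFin.mk 1)) ≫ pointAt (op (StdFin.mk n)) i =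
      pointAt (op (StdFin.mk (n + 1))) i.castSucc := rfl

theorem snd_pointAt (n : ℕ) :
    snd (op (StdFin.mk.{w} n)) (op (StdFin.mk 1)) =
      pointAt (op (StdFin.mk (n + 1))) (Fin.last n) :=
  Quiver.Hom.unop_inj (by
    funext i
    obtain ⟨i⟩ := i
    change Fin 1 at i
    obtain rfl := Subsingleton.elim i 0
    rfl)

theorem tensor_hom_ext_of_comparison (G : StdFin.{w}ᵒᵖ ⥤ D) {s t : StdFin.{w}ᵒᵖ}
    [IsIso (prodComparison G s t)] {T : D} {f g : T ⟶ G.obj (s ⊗ t)}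
    (h₁ : f ≫ G.map (fst s t) = g ≫ G.map (fst s t))
    (h₂ : f ≫ G.map (snd s t) = g ≫ G.map (snd s t)) : f = g := by
  rw [← cancel_mono (prodComparison G s t)]
  apply CartesianMonoidalCategory.hom_ext
  · rw [Category.assoc, Category.assoc, prodComparison_fst, h₁]
  · rw [Category.assoc, Category.assoc, prodComparison_snd, h₂]

theorem exists_lift_tensor_of_comparison (G : StdFin.{w}ᵒᵖ ⥤ D) (s t : StdFin.{w}ᵒᵖ)
    [IsIso (prodComparison G s t)] {T : D} (f : T ⟶ G.obj s) (g : T ⟶ G.obj t) :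
    ∃ h : T ⟶ G.obj (s ⊗ t), h ≫ G.map (fst s t) = f ∧ h ≫ G.map (snd s t) = g :=
  ⟨lift f g ≫ inv (prodComparison G s t), by simp, by simp⟩

/-- A product-preserving `G` sends the set of `n` elements to the `n`-th power of its value at the
point, with the morphisms `pointAt` as projections. The induction uses that the set of `n + 1`
elements is by definition the product, in the opposite category, of those of `n` and `1` elements.
-/
theorem hom_ext_pointAt (G : StdFin.{w}ᵒᵖ ⥤ D) [IsIso (terminalComparison G)]
    [∀ s t, IsIso (prodComparison G s t)] {T : D} : ∀ (n : ℕ) (f g : T ⟶ G.obj (op (StdFin.mk n))),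
    (∀ i : Fin n, f ≫ G.map (pointAt (op (StdFin.mk n)) i) =
      g ≫ G.map (pointAt (op (StdFin.mk n)) i)) → f = g
  | 0, f, g, _ => by
    change T ⟶ G.obj (𝟙_ StdFin.{w}ᵒᵖ) at f g
    rw [← cancel_mono (terminalComparison G)]
    exact toUnit_unique _ _
  | n + 1, f, g, h => by
    let f' : T ⟶ G.obj (op (StdFin.mk n) ⊗ op (StdFin.mk 1)) := f
    let g' : T ⟶ G.obj (op (StdFin.mk n) ⊗ op (StdFin.mk 1)) := g
    refine tensor_hom_ext_of_comparison G (f := f') (g := g') ?_ ?_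
    · refine hom_ext_pointAt G n _ _ fun i => ?_
      rw [Category.assoc, Category.assoc, ← G.map_comp, fst_pointAt]
      exact h i.castSucc
    · rw [snd_pointAt]
      exact h (Fin.last n)

theorem exists_lift_pointAt (G : StdFin.{w}ᵒᵖ ⥤ D) [IsIso (terminalComparison G)]
    [∀ s t, IsIso (prodComparison G s t)] {T : D} :
    ∀ (n : ℕ) (a : Fin n → (T ⟶ G.obj (op (StdFin.mk 1)))),
      ∃ f : T ⟶ G.obj (op (StdFin.mk n)), ∀ i : Fin n,
        f ≫ G.map (pointAt (op (StdFin.mk n)) i) = a i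
  | 0, _ => ⟨toUnit T ≫ inv (terminalComparison G), fun i => i.elim0⟩
  | n + 1, a => by
    obtain ⟨f, hf⟩ := exists_lift_pointAt G n (fun i => a i.castSucc)
    obtain ⟨g, h₁, h₂⟩ := exists_lift_tensor_of_comparison G (op (StdFin.mk n)) (op (StdFin.mk 1))
      f (a (Fin.last n))
    refine ⟨g, fun i => ?_⟩
    refine Fin.lastCases ?_ (fun j => ?_) i
    · rw [snd_pointAt] at h₂
      exact h₂
    · rw [← hf j, ← h₁, Category.assoc, ← G.map_comp, fst_pointAt]
      rfl

/-- Freeness of `StdFinᵒᵖ` on the point: naturality with respect to the morphisms `pointAt`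
prescribes all components in the products `G.obj s`, and naturality in general is checked on these
components. Only `G` has to preserve products. -/
theorem exists_natTrans_of_point (F G : StdFin.{w}ᵒᵖ ⥤ D) [IsIso (terminalComparison G)]
    [∀ s t, IsIso (prodComparison G s t)]
    (c : F.obj (op (StdFin.mk 1)) ⟶ G.obj (op (StdFin.mk 1))) :
    ∃ θ : F ⟶ G, θ.app (op (StdFin.mk 1)) = c := by
  choose a ha using fun s : StdFin.{w}ᵒᵖ =>
    exists_lift_pointAt G s.unop.len (fun i => F.map (pointAt s i) ≫ c)
  change (s : StdFin.{w}ᵒᵖ) → (F.obj s ⟶ G.obj s) at a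
  have ha' : ∀ (s : StdFin.{w}ᵒᵖ) (i : Fin s.unop.len),
    a s ≫ G.map (pointAt s i) = F.map (pointAt s i) ≫ c := ha
  refine ⟨{ app := a, naturality := fun s t f => ?_ }, ?_⟩
  · refine hom_ext_pointAt G t.unop.len _ _ fun i => ?_
    change (F.map f ≫ a t) ≫ G.map (pointAt t i) = (a s ≫ G.map f) ≫ G.map (pointAt t i)
    rw [Category.assoc, Category.assoc, ha', ← G.map_comp, ← F.map_comp_assoc, comp_pointAt, ha']
  · have h := ha' (op (StdFin.mk 1)) (0 : Fin 1)
    rw [pointAt_one, F.map_id, Category.id_comp] at h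
    refine Eq.trans ?_ h
    rw [G.map_id, Category.comp_id]

end Extend

/-! ### Symmetric monoidal functors as product-preserving functors to coalgebras. -/

section Lift

open Functor.LaxMonoidal Functor.OplaxMonoidal

/-- The coalgebra structure of an object of the opposite of the category of standard finite
sets. -/
def stdCoalg (s : StdFin.{w}ᵒᵖ) : CommComon StdFin.{w}ᵒᵖ :=
  let _ : ComonObj s := (cartesianComon _).obj s |>.comon
  { X := s
    comm := ⟨by
      change lift (𝟙 s) (𝟙 s) ≫ _ = lift (𝟙 s) (𝟙 s)
      simp⟩ }

variable {A : Type u} [Category.{w} A] [MonoidalCategory A] [SymmetricCategory A]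
  (Φ : StdFin.{w}ᵒᵖ ⥤ A) [Φ.Braided]

/-- Every morphism of a cartesian category respects diagonals and terminal maps, and `δ Φ` is
natural. -/
theorem isComonHom_map_stdCoalg {s t : StdFin.{w}ᵒᵖ} (f : s ⟶ t) :
    IsComonHom (M := (mapCoalg Φ (stdCoalg s)).X) (N := (mapCoalg Φ (stdCoalg t)).X) (Φ.map f) where
  hom_counit := by
    change Φ.map f ≫ Φ.map (toUnit t) ≫ η Φ = Φ.map (toUnit s) ≫ η Φ
    rw [← Φ.map_comp_assoc, toUnit_unique (f ≫ toUnit t) (toUnit s)]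
  hom_comul := by
    change Φ.map f ≫ Φ.map (lift (𝟙 t) (𝟙 t)) ≫ δ Φ t t =
      (Φ.map (lift (𝟙 s) (𝟙 s)) ≫ δ Φ s s) ≫ (Φ.map f ⊗ₘ Φ.map f)
    rw [Category.assoc, δ_natural, ← Φ.map_comp_assoc, ← Φ.map_comp_assoc, comp_lift, lift_map]
    simp

/-- A symmetric monoidal functor on the opposite of the category of standard finite sets takes
values in cocommutative coalgebras. -/
def coalgLift : StdFin.{w}ᵒᵖ ⥤ CommComon A where
  obj s := mapCoalg Φ (stdCoalg s)
  map f := commComonHom (Φ.map f) (isComonHom_map_stdCoalg Φ f)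
  map_id s := und_injective (Φ.map_id s)
  map_comp f g := und_injective (Φ.map_comp f g)

theorem und_terminalComparison : und (terminalComparison (coalgLift Φ)) = η Φ := by
  change Φ.map (toUnit (𝟙_ StdFin.{w}ᵒᵖ)) ≫ η Φ = η Φ
  rw [toUnit_unique (toUnit (𝟙_ StdFin.{w}ᵒᵖ)) (𝟙 _), Φ.map_id, Category.id_comp]

/-- The diagonal followed by the two projections on its factors is the identity, so only the
constraint of `Φ` remains. As it is invertible, the lift preserves products. -/
theorem und_prodComparison (s t : StdFin.{w}ᵒᵖ) :
    und (prodComparison (coalgLift Φ) s t) = δ Φ s t := by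
  change (Φ.map (lift (𝟙 (s ⊗ t)) (𝟙 (s ⊗ t))) ≫ δ Φ (s ⊗ t) (s ⊗ t)) ≫
    (Φ.map (fst s t) ⊗ₘ Φ.map (snd s t)) = δ Φ s t
  rw [Category.assoc, δ_natural, ← Φ.map_comp_assoc, lift_map]
  simp

instance : IsIso (terminalComparison (coalgLift Φ)) :=
  isIso_of_und _ (by
    rw [und_terminalComparison]
    exact (inferInstance : IsIso (η Φ)))

instance (s t : StdFin.{w}ᵒᵖ) : IsIso (prodComparison (coalgLift Φ) s t) :=
  isIso_of_und _ (by
    rw [und_prodComparison]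
    exact (inferInstance : IsIso (δ Φ s t)))

/-- The two coalgebra structures on the image of the one-element set agree. -/
def mapPointIso : mapCoalg Φ pointCoalg ≅ mapCoalg Φ (stdCoalg (op (StdFin.mk 1))) :=
  commComonIso (Iso.refl (Φ.obj (op (StdFin.mk 1))))
    { hom_counit := by
        change 𝟙 _ ≫ Φ.map (stdCoalg (op (StdFin.mk 1))).comon.counit ≫ η Φ =
          Φ.map pointCoalg.comon.counit ≫ η Φ
        rw [Category.id_comp, show (stdCoalg (op (StdFin.mk.{w} 1))).comon.counit =
          pointCoalg.comon.counit from Quiver.Hom.unop_inj (StdFin.hom_one_ext _ _)]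
        rfl
      hom_comul := by
        change 𝟙 _ ≫ Φ.map (stdCoalg (op (StdFin.mk 1))).comon.comul ≫ δ Φ _ _ =
          (Φ.map pointCoalg.comon.comul ≫ δ Φ _ _) ≫ (𝟙 _ ⊗ₘ 𝟙 _)
        rw [Category.id_comp, id_tensorHom_id, Category.comp_id,
          show (stdCoalg (op (StdFin.mk.{w} 1))).comon.comul =
          pointCoalg.comon.comul from Quiver.Hom.unop_inj (StdFin.hom_one_ext _ _)]
        rfl }

theorem und_mapPointIso_hom : und (mapPointIso Φ).hom = 𝟙 (Φ.obj (op (StdFin.mk 1))) := rfl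

theorem und_mapPointIso_inv : und (mapPointIso Φ).inv = 𝟙 (Φ.obj (op (StdFin.mk 1))) := rfl

/-- A natural transformation between the functors to coalgebras is monoidal. -/
theorem isMonoidal_whiskerRight_forget {Φ Ψ : StdFin.{w}ᵒᵖ ⥤ A} [Φ.Braided] [Ψ.Braided]
    (θ : coalgLift Φ ⟶ coalgLift Ψ) :
    NatTrans.IsMonoidal (F₁ := Φ) (F₂ := Ψ) (Functor.whiskerRight θ (commComonForget A)) where
  unit := by
    have h := congrArg und (toUnit_unique (θ.app (𝟙_ _) ≫ terminalComparison (coalgLift Ψ))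
      (terminalComparison (coalgLift Φ)))
    rw [und_comp, und_terminalComparison, und_terminalComparison] at h
    let a : Φ.obj (𝟙_ _) ⟶ Ψ.obj (𝟙_ _) := und (θ.app (𝟙_ _))
    have h' : a ≫ η Ψ = η Φ := h
    change Functor.LaxMonoidal.ε Φ ≫ a = Functor.LaxMonoidal.ε Ψ
    rw [← cancel_mono (η Ψ), Category.assoc, h', Functor.Monoidal.ε_η, Functor.Monoidal.ε_η]
  tensor s t := by
    -- Any natural transformation commutes with product comparisons. On underlying objects these are
    -- the constraints `δ`, whose inverses are the `μ`.
    have h₀ : θ.app (s ⊗ t) ≫ prodComparison (coalgLift Ψ) s t =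
        prodComparison (coalgLift Φ) s t ≫ (θ.app s ⊗ₘ θ.app t) := by
      apply CartesianMonoidalCategory.hom_ext <;> simp
    have h := congrArg und h₀
    rw [und_comp, und_comp, und_prodComparison, und_prodComparison] at h
    let a (s : StdFin.{w}ᵒᵖ) : Φ.obj s ⟶ Ψ.obj s := und (θ.app s)
    have h' : a (s ⊗ t) ≫ δ Ψ s t = δ Φ s t ≫ (a s ⊗ₘ a t) := h
    change μ Φ s t ≫ a (s ⊗ t) = (a s ⊗ₘ a t) ≫ μ Ψ s t
    rw [← cancel_mono (δ Ψ s t), Category.assoc, Category.assoc, Functor.Monoidal.μ_δ,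
      Category.comp_id, h', Functor.Monoidal.μ_δ_assoc]

/-- A coalgebra morphism between the values at the point extends to the lifts by freeness of
`StdFinᵒᵖ`; forgetting the coalgebra structures leaves a monoidal transformation. -/
theorem exists_monoidal_natTrans (Φ Ψ : StdFin.{w}ᵒᵖ ⥤ A) [Φ.Braided] [Ψ.Braided]
    (c : mapCoalg Φ pointCoalg ⟶ mapCoalg Ψ pointCoalg) :
    ∃ θ : Φ ⟶ Ψ, NatTrans.IsMonoidal θ ∧ θ.app (op (StdFin.mk 1)) = und c := by
  obtain ⟨θ, hθ⟩ := exists_natTrans_of_point (coalgLift Φ) (coalgLift Ψ)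
    ((mapPointIso Φ).inv ≫ c ≫ (mapPointIso Ψ).hom)
  refine ⟨Functor.whiskerRight θ (commComonForget A), isMonoidal_whiskerRight_forget θ, ?_⟩
  refine (congrArg und hθ).trans ?_
  change und (mapPointIso Φ).inv ≫ und c ≫ und (mapPointIso Ψ).hom = und c
  rw [und_mapPointIso_inv, und_mapPointIso_hom]
  exact (Category.id_comp _).trans (Category.comp_id _)

/-- A monoidal natural transformation is determined by its value at the one-element set. -/
theorem monoidal_natTrans_ext {Φ Ψ : StdFin.{w}ᵒᵖ ⥤ A} [Φ.Braided] [Ψ.Braided] (θ θ' : Φ ⟶ Ψ)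
    [NatTrans.IsMonoidal θ] [NatTrans.IsMonoidal θ']
    (h : θ.app (op (StdFin.mk 1)) = θ'.app (op (StdFin.mk 1))) (n : ℕ) :
    θ.app (op (StdFin.mk n)) = θ'.app (op (StdFin.mk n)) := by
  induction n with
  | zero =>
    change θ.app (𝟙_ _) = θ'.app (𝟙_ _)
    rw [← cancel_epi (Functor.LaxMonoidal.ε Φ), NatTrans.IsMonoidal.unit, NatTrans.IsMonoidal.unit]
  | succ n ih =>
    -- The set of `n + 1` elements is a tensor product by definition, and the invertible `μ Φ`
    -- expresses the component there through those at `n` and `1`.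
    change θ.app (op (StdFin.mk n) ⊗ op (StdFin.mk 1)) =
      θ'.app (op (StdFin.mk n) ⊗ op (StdFin.mk 1))
    rw [← cancel_epi (μ Φ _ _), NatTrans.IsMonoidal.tensor, NatTrans.IsMonoidal.tensor, h, ih]

end Lift

end
end ClassifyingVectoid

namespace ClassifyingVectoid

open scoped DayFunctor ExternalProduct

noncomputable section

/-! ### Day functors by elements -/

set_option linter.unusedSectionVars false

section DayElements

variable {C : Type w} [SmallCategory C] [MonoidalCategory C] [SymmetricCategory C]

/-- A morphism of Day functors given by its action on elements. -/
def dayHom {F G : C ⊛⥤ Type w} (app : ∀ x, F.functor.obj x → G.functor.obj x)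
    (happ : ∀ {x y : C} (f : x ⟶ y) (a : F.functor.obj x),
      app y (F.functor.map f a) = G.functor.map f (app x a)) : F ⟶ G :=
  ⟨{ app := fun x => TypeCat.ofHom (app x)
     naturality := fun _ _ f => by
      ext a
      exact happ f a }⟩

theorem day_hom_ext {F G : C ⊛⥤ Type w} {α β : F ⟶ G}
    (h : ∀ (x : C) (a : F.functor.obj x), ev α a = ev β a) : α = β := by
  apply DayFunctor.hom_ext
  ext x a
  exact h x a

theorem day_unit_hom_ext {F : C ⊛⥤ Type w} {α β : 𝟙_ (C ⊛⥤ Type w) ⟶ F}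
    (h : ev α (dayOne C) = ev β (dayOne C)) : α = β :=
  DayFunctor.unit_hom_ext (by
    ext
    exact h)

theorem day_map_id (F : C ⊛⥤ Type w) {x : C} (a : F.functor.obj x) : F.functor.map (𝟙 x) a = a :=
  ConcreteCategory.congr_hom (F.functor.map_id x) a

theorem day_map_comp (F : C ⊛⥤ Type w) {x y z : C} (f : x ⟶ y) (g : y ⟶ z) (a : F.functor.obj x) :
    F.functor.map (f ≫ g) a = F.functor.map g (F.functor.map f a) :=
  ConcreteCategory.congr_hom (F.functor.map_comp f g) a

/-- A morphism out of a Day convolution given by its action on pairs of elements. -/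
def dayTensorDesc {F G H : C ⊛⥤ Type w}
    (app : ∀ x y, F.functor.obj x → G.functor.obj y → H.functor.obj (x ⊗ y))
    (happ : ∀ {x y x' y' : C} (f : x ⟶ x') (g : y ⟶ y') (a : F.functor.obj x)
      (b : G.functor.obj y), app x' y' (F.functor.map f a) (G.functor.map g b) =
        H.functor.map (f ⊗ₘ g) (app x y a b)) : F ⊗ G ⟶ H :=
  DayFunctor.tensorDesc
    { app := fun p => TypeCat.ofHom (fun q : F.functor.obj p.1 × G.functor.obj p.2 =>
        app p.1 p.2 q.1 q.2)
      naturality := fun p q f => by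
        ext ⟨a, b⟩
        exact happ f.1 f.2 a b }

theorem ev_dayTensorDesc {F G H : C ⊛⥤ Type w}
    (app : ∀ x y, F.functor.obj x → G.functor.obj y → H.functor.obj (x ⊗ y))
    (happ : ∀ {x y x' y' : C} (f : x ⟶ x') (g : y ⟶ y') (a : F.functor.obj x)
      (b : G.functor.obj y), app x' y' (F.functor.map f a) (G.functor.map g b) =
        H.functor.map (f ⊗ₘ g) (app x y a b)) {x y : C} (a : F.functor.obj x)
      (b : G.functor.obj y) : ev (dayTensorDesc app happ) (dayPair a b) = app x y a b :=
  ev_tensorDesc _ _ _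

/-- The Day functor `x ↦ H (x ⊗ y)`. -/
def dayShift (H : C ⊛⥤ Type w) (y : C) : C ⊛⥤ Type w := ⟨tensorRight y ⋙ H.functor⟩

/-- Not every element of `F ⊗ G` is a pair. For a fixed `c` in `H z`, however, evaluation at
`dayPair p c` is a morphism from `F ⊗ G` to a shift of `K`, and such a morphism is determined by
pairs. -/
theorem day_tensor_tensor_hom_ext {F G H K : C ⊛⥤ Type w} {α β : (F ⊗ G) ⊗ H ⟶ K}
    (h : ∀ (x y z : C) (a : F.functor.obj x) (b : G.functor.obj y) (c : H.functor.obj z),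
      ev α (dayPair (dayPair a b) c) = ev β (dayPair (dayPair a b) c)) : α = β := by
  have key (γ : (F ⊗ G) ⊗ H ⟶ K) {z : C} (c : H.functor.obj z) {x y : C} (f : x ⟶ y)
      (p : (F ⊗ G).functor.obj x) : ev γ (dayPair ((F ⊗ G).functor.map f p) c) =
        K.functor.map (f ▷ z) (ev γ (dayPair p c)) := by
    rw [← ev_map, ← tensorHom_id, dayPair_map, day_map_id]
  let curry (γ : (F ⊗ G) ⊗ H ⟶ K) {z : C} (c : H.functor.obj z) : F ⊗ G ⟶ dayShift K z :=
    dayHom (fun x p => ev γ (dayPair p c)) (fun f p => key γ c f p)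
  apply day_tensor_hom_ext
  intro x z p c
  have hc : curry α c = curry β c := day_tensor_hom_ext fun x y a b => h x y z a b c
  exact congrArg (fun γ => ev γ p) hc

end DayElements

/-! ### The extension of a functor along the Yoneda embedding -/

section Extension

variable {C : Type w} [SmallCategory C] [MonoidalCategory C] [SymmetricCategory C]
  {A : Type u} [Category.{w} A]

/-- The functor `a ↦ Hom(Φ -, a)`. -/
def dayNerve (Φ : Cᵒᵖ ⥤ A) : A ⥤ (C ⊛⥤ Type w) where
  obj a := ⟨{ obj := fun x => (Φ.obj (op x) ⟶ a)
              map := fun f => TypeCat.ofHom (fun φ => Φ.map f.op ≫ φ)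
              map_id := fun x => by
                ext φ
                change Φ.map (𝟙 (op x)) ≫ φ = φ
                rw [Φ.map_id, Category.id_comp]
              map_comp := fun f g => by
                ext φ
                change Φ.map (g.op ≫ f.op) ≫ φ = Φ.map g.op ≫ Φ.map f.op ≫ φ
                rw [Φ.map_comp, Category.assoc] }⟩
  map g := dayHom (fun _ φ => φ ≫ g) (fun _ _ => Category.assoc _ _ _)
  map_id a := day_hom_ext fun _ φ => Category.comp_id φ
  map_comp g h := day_hom_ext fun _ φ => (Category.assoc φ g h).symm

open Limits

variable [HasColimitsOfSize.{w, w} A] (Φ : Cᵒᵖ ⥤ A)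

/-- The diagram whose colimit is the value of the extension of `Φ` along the Yoneda embedding. -/
abbrev dayDiagram (G : C ⊛⥤ Type w) : G.functor.Elementsᵒᵖ ⥤ A :=
  (CategoryOfElements.π G.functor).op ⋙ Φ

/-- Morphisms out of the colimit defining the extension of `Φ` along the Yoneda embedding. -/
def dayColimitEquiv (G : C ⊛⥤ Type w) (a : A) :
    (colimit (dayDiagram Φ G) ⟶ a) ≃ (G ⟶ (dayNerve Φ).obj a) where
  toFun f := dayHom (fun x g => colimit.ι (dayDiagram Φ G) (op ⟨x, g⟩) ≫ f) (fun {x y} k g => by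
    let p : G.functor.Elements := ⟨x, g⟩
    let q : G.functor.Elements := ⟨y, G.functor.map k g⟩
    let m : p ⟶ q := ⟨k, rfl⟩
    have h := colimit.w (dayDiagram Φ G) m.op
    change colimit.ι (dayDiagram Φ G) (op ⟨y, G.functor.map k g⟩) ≫ f =
      Φ.map k.op ≫ colimit.ι (dayDiagram Φ G) (op ⟨x, g⟩) ≫ f
    rw [← h, Category.assoc]
    rfl)
  invFun α := colimit.desc (dayDiagram Φ G)
    { pt := a
      ι := { app := fun p => ev α p.unop.2
             naturality := fun p q k => by
              have h := ev_map α k.unop.1 q.unop.2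
              rw [k.unop.2] at h
              exact h.symm.trans (Category.comp_id _).symm } }
  left_inv f := by
    apply colimit.hom_ext
    intro p
    rw [colimit.ι_desc]
    rfl
  right_inv α := day_hom_ext fun x g => colimit.ι_desc _ _

theorem dayColimitEquiv_naturality (G : C ⊛⥤ Type w) (a b : A) (f : a ⟶ b)
    (g : colimit (dayDiagram Φ G) ⟶ a) : dayColimitEquiv Φ G b (g ≫ f) =
      dayColimitEquiv Φ G a g ≫ (dayNerve Φ).map f :=
  day_hom_ext fun _ _ => (Category.assoc _ _ _).symm

/-- The extension of `Φ` along the Yoneda embedding. -/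
def dayExt : (C ⊛⥤ Type w) ⥤ A :=
  Adjunction.leftAdjointOfEquiv (dayColimitEquiv Φ) (dayColimitEquiv_naturality Φ)

/-- The extension of `Φ` along the Yoneda embedding is left adjoint to `a ↦ Hom(Φ -, a)`. -/
def dayExtAdj : dayExt Φ ⊣ dayNerve Φ :=
  Adjunction.adjunctionOfEquivLeft (dayColimitEquiv Φ) (dayColimitEquiv_naturality Φ)

/-- The component at an element of `G` of the universal cocone under the extension. -/
def dayExtι {G : C ⊛⥤ Type w} {x : C} (g : G.functor.obj x) :
    Φ.obj (op x) ⟶ (dayExt Φ).obj G :=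
  ev ((dayExtAdj Φ).unit.app G) g

theorem dayExtι_map {G H : C ⊛⥤ Type w} (α : G ⟶ H) {x : C} (g : G.functor.obj x) :
    dayExtι Φ g ≫ (dayExt Φ).map α = dayExtι Φ (ev α g) :=
  (congrArg (fun β => ev β g) ((dayExtAdj Φ).unit.naturality α)).symm

theorem map_dayExtι (G : C ⊛⥤ Type w) {x y : C} (k : x ⟶ y) (g : G.functor.obj x) :
    Φ.map k.op ≫ dayExtι Φ g = dayExtι Φ (G.functor.map k g) :=
  (ev_map ((dayExtAdj Φ).unit.app G) k g).symm

theorem ev_dayExtAdj_homEquiv {G : C ⊛⥤ Type w} {a : A} (f : (dayExt Φ).obj G ⟶ a) {x : C}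
    (g : G.functor.obj x) : ev ((dayExtAdj Φ).homEquiv G a f) g = dayExtι Φ g ≫ f := by
  rw [Adjunction.homEquiv_unit]
  rfl

/-- The morphism out of a value of the extension given by a compatible family. -/
def dayExtDesc {G : C ⊛⥤ Type w} {a : A} (φ : G ⟶ (dayNerve Φ).obj a) : (dayExt Φ).obj G ⟶ a :=
  ((dayExtAdj Φ).homEquiv G a).symm φ

theorem dayExtι_desc {G : C ⊛⥤ Type w} {a : A} (φ : G ⟶ (dayNerve Φ).obj a) {x : C}
    (g : G.functor.obj x) : dayExtι Φ g ≫ dayExtDesc Φ φ = ev φ g := by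
  rw [← ev_dayExtAdj_homEquiv, dayExtDesc, Equiv.apply_symm_apply]

theorem dayExt_hom_ext {G : C ⊛⥤ Type w} {a : A} {f f' : (dayExt Φ).obj G ⟶ a}
    (h : ∀ (x : C) (g : G.functor.obj x), dayExtι Φ g ≫ f = dayExtι Φ g ≫ f') : f = f' := by
  apply ((dayExtAdj Φ).homEquiv G a).injective
  refine day_hom_ext fun x g => ?_
  rw [ev_dayExtAdj_homEquiv, ev_dayExtAdj_homEquiv, h]

theorem dayExt_unit_hom_ext {a : A} {f f' : (dayExt Φ).obj (𝟙_ (C ⊛⥤ Type w)) ⟶ a}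
    (h : dayExtι Φ (dayOne C) ≫ f = dayExtι Φ (dayOne C) ≫ f') : f = f' := by
  apply ((dayExtAdj Φ).homEquiv _ a).injective
  apply day_unit_hom_ext
  rw [ev_dayExtAdj_homEquiv, ev_dayExtAdj_homEquiv, h]

theorem dayExt_tensor_hom_ext {G H : C ⊛⥤ Type w} {a : A} {f f' : (dayExt Φ).obj (G ⊗ H) ⟶ a}
    (h : ∀ (x y : C) (g : G.functor.obj x) (k : H.functor.obj y),
      dayExtι Φ (dayPair g k) ≫ f = dayExtι Φ (dayPair g k) ≫ f') : f = f' := by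
  apply ((dayExtAdj Φ).homEquiv _ a).injective
  refine day_tensor_hom_ext fun x y g k => ?_
  rw [ev_dayExtAdj_homEquiv, ev_dayExtAdj_homEquiv, h]

theorem dayExt_tensor_tensor_hom_ext {G H K : C ⊛⥤ Type w} {a : A}
    {f f' : (dayExt Φ).obj ((G ⊗ H) ⊗ K) ⟶ a}
    (h : ∀ (x y z : C) (g : G.functor.obj x) (k : H.functor.obj y) (l : K.functor.obj z),
      dayExtι Φ (dayPair (dayPair g k) l) ≫ f = dayExtι Φ (dayPair (dayPair g k) l) ≫ f') :
    f = f' := by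
  apply ((dayExtAdj Φ).homEquiv _ a).injective
  refine day_tensor_tensor_hom_ext fun x y z g k l => ?_
  rw [ev_dayExtAdj_homEquiv, ev_dayExtAdj_homEquiv, h]

/-- The universal cocone under a value of the extension. -/
def dayExtCocone (G : C ⊛⥤ Type w) : Cocone (dayDiagram Φ G) where
  pt := (dayExt Φ).obj G
  ι :=
    { app := fun p => dayExtι Φ p.unop.2
      naturality := fun p q k => by
        have h := map_dayExtι Φ G k.unop.1 q.unop.2
        rw [k.unop.2] at h
        exact h.trans (Category.comp_id _).symm }

/-- The values of the extension are colimits. -/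
def isColimitDayExtCocone (G : C ⊛⥤ Type w) : IsColimit (dayExtCocone Φ G) where
  desc s := dayExtDesc Φ (dayHom (fun x g => s.ι.app (op ⟨x, g⟩)) (fun {x y} k g => by
    let p : G.functor.Elements := ⟨x, g⟩
    let q : G.functor.Elements := ⟨y, G.functor.map k g⟩
    let m : p ⟶ q := ⟨k, rfl⟩
    exact (s.w m.op).symm))
  fac s p := dayExtι_desc Φ _ _
  uniq s f hf := dayExt_hom_ext Φ fun x g => by
    rw [dayExtι_desc]
    exact hf (op ⟨x, g⟩)

/-- The canonical morphism from the value of the extension at a representable functor. -/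
def dayExtYonedaDesc (x : Cᵒᵖ) : (dayExt Φ).obj ((dayYoneda C).obj x) ⟶ Φ.obj x :=
  dayExtDesc Φ (dayYonedaDesc (𝟙 (Φ.obj x) : ((dayNerve Φ).obj (Φ.obj x)).functor.obj x.unop))

theorem dayExtι_yonedaDesc (x : Cᵒᵖ) {y : C} (f : x.unop ⟶ y) :
    dayExtι Φ (elt f) ≫ dayExtYonedaDesc Φ x = Φ.map f.op :=
  (dayExtι_desc Φ _ _).trans (Category.comp_id (Φ.map f.op))

/-- The extension restricts to `Φ` along the Yoneda embedding. -/
def dayExtYonedaIso : dayYoneda C ⋙ dayExt Φ ≅ Φ :=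
  NatIso.ofComponents
    (fun x =>
      { hom := dayExtYonedaDesc Φ x
        inv := dayExtι Φ (elt (𝟙 x.unop))
        hom_inv_id := dayExt_hom_ext Φ fun y g => by
          change x.unop ⟶ y at g
          change dayExtι Φ (elt g) ≫ _ = dayExtι Φ (elt g) ≫ 𝟙 _
          rw [reassoc_of% @dayExtι_yonedaDesc, map_dayExtι, elt_map, Category.id_comp, Category.comp_id]
        inv_hom_id := by
          rw [dayExtι_yonedaDesc]
          exact Φ.map_id x })
    (fun {x y} f => dayExt_hom_ext Φ fun z g => by
      change x.unop ⟶ z at g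
      change dayExtι Φ (elt g) ≫ (dayExt Φ).map ((dayYoneda C).map f) ≫ dayExtYonedaDesc Φ y =
        dayExtι Φ (elt g) ≫ dayExtYonedaDesc Φ x ≫ Φ.map f
      rw [reassoc_of% @dayExtι_map, ev_dayYoneda_map, dayExtι_yonedaDesc, reassoc_of% @dayExtι_yonedaDesc,
        ← Φ.map_comp]
      rfl)

end Extension

/-! ### The monoidal structure of the extension. -/

section MonoidalExtension

open Limits Functor.LaxMonoidal Functor.OplaxMonoidal

variable {C : Type w} [SmallCategory C] [MonoidalCategory C] [SymmetricCategory C]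
  {A : Type u} [Category.{w} A] [MonoidalCategory A] [SymmetricCategory A]
  [HasColimitsOfSize.{w, w} A] [∀ X : A, PreservesColimitsOfSize.{w, w} (tensorLeft X)]
  [∀ X : A, PreservesColimitsOfSize.{w, w} (tensorRight X)] (Φ : Cᵒᵖ ⥤ A)

/-- Tensoring with `X` preserves the colimit that defines the extension. This and its analogues
below are where cocontinuity of the tensor product of `A` is used. -/
theorem whiskerLeft_dayExt_hom_ext (X : A) {G : C ⊛⥤ Type w} {a : A}
    {f f' : X ⊗ (dayExt Φ).obj G ⟶ a}
    (h : ∀ (x : C) (g : G.functor.obj x), X ◁ dayExtι Φ g ≫ f = X ◁ dayExtι Φ g ≫ f') :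
    f = f' :=
  (isColimitOfPreserves (tensorLeft X) (isColimitDayExtCocone Φ G)).hom_ext
    fun p => h p.unop.1 p.unop.2

theorem whiskerRight_dayExt_hom_ext (X : A) {G : C ⊛⥤ Type w} {a : A}
    {f f' : (dayExt Φ).obj G ⊗ X ⟶ a}
    (h : ∀ (x : C) (g : G.functor.obj x), dayExtι Φ g ▷ X ≫ f = dayExtι Φ g ▷ X ≫ f') :
    f = f' :=
  (isColimitOfPreserves (tensorRight X) (isColimitDayExtCocone Φ G)).hom_ext
    fun p => h p.unop.1 p.unop.2

theorem exists_whiskerLeft_dayExt_desc (X : A) {G : C ⊛⥤ Type w} {a : A}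
    (φ : ∀ x : C, G.functor.obj x → (X ⊗ Φ.obj (op x) ⟶ a))
    (hφ : ∀ (x y : C) (k : x ⟶ y) (g : G.functor.obj x),
      X ◁ Φ.map k.op ≫ φ x g = φ y (G.functor.map k g)) :
    ∃ f : X ⊗ (dayExt Φ).obj G ⟶ a, ∀ (x : C) (g : G.functor.obj x),
      X ◁ dayExtι Φ g ≫ f = φ x g := by
  let s : Cocone (dayDiagram Φ G ⋙ tensorLeft X) :=
    { pt := a
      ι := { app := fun p => φ p.unop.1 p.unop.2
             naturality := fun p q k => by
              have h := hφ _ _ k.unop.1 q.unop.2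
              rw [k.unop.2] at h
              exact h.trans (Category.comp_id _).symm } }
  have hs := isColimitOfPreserves (tensorLeft X) (isColimitDayExtCocone Φ G)
  exact ⟨hs.desc s, fun x g => hs.fac s (op ⟨x, g⟩)⟩

theorem exists_whiskerRight_dayExt_desc (X : A) {G : C ⊛⥤ Type w} {a : A}
    (φ : ∀ x : C, G.functor.obj x → (Φ.obj (op x) ⊗ X ⟶ a))
    (hφ : ∀ (x y : C) (k : x ⟶ y) (g : G.functor.obj x),
      Φ.map k.op ▷ X ≫ φ x g = φ y (G.functor.map k g)) :
    ∃ f : (dayExt Φ).obj G ⊗ X ⟶ a, ∀ (x : C) (g : G.functor.obj x),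
      dayExtι Φ g ▷ X ≫ f = φ x g := by
  let s : Cocone (dayDiagram Φ G ⋙ tensorRight X) :=
    { pt := a
      ι := { app := fun p => φ p.unop.1 p.unop.2
             naturality := fun p q k => by
              have h := hφ _ _ k.unop.1 q.unop.2
              rw [k.unop.2] at h
              exact h.trans (Category.comp_id _).symm } }
  have hs := isColimitOfPreserves (tensorRight X) (isColimitDayExtCocone Φ G)
  exact ⟨hs.desc s, fun x g => hs.fac s (op ⟨x, g⟩)⟩

theorem tensor_dayExt_hom_ext {G H : C ⊛⥤ Type w} {a : A}
    {f f' : (dayExt Φ).obj G ⊗ (dayExt Φ).obj H ⟶ a}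
    (h : ∀ (x y : C) (g : G.functor.obj x) (k : H.functor.obj y),
      (dayExtι Φ g ⊗ₘ dayExtι Φ k) ≫ f = (dayExtι Φ g ⊗ₘ dayExtι Φ k) ≫ f') : f = f' := by
  refine whiskerRight_dayExt_hom_ext Φ _ fun x g => ?_
  refine whiskerLeft_dayExt_hom_ext Φ _ fun y k => ?_
  rw [← Category.assoc, ← Category.assoc, ← MonoidalCategory.tensorHom_def', h]

theorem exists_tensor_dayExt_desc {G H : C ⊛⥤ Type w} {a : A}
    (φ : ∀ x y : C, G.functor.obj x → H.functor.obj y → (Φ.obj (op x) ⊗ Φ.obj (op y) ⟶ a))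
    (hφ : ∀ (x y x' y' : C) (k : x ⟶ x') (l : y ⟶ y') (g : G.functor.obj x) (h : H.functor.obj y),
      (Φ.map k.op ⊗ₘ Φ.map l.op) ≫ φ x y g h =
        φ x' y' (G.functor.map k g) (H.functor.map l h)) :
    ∃ f : (dayExt Φ).obj G ⊗ (dayExt Φ).obj H ⟶ a,
      ∀ (x y : C) (g : G.functor.obj x) (h : H.functor.obj y),
        (dayExtι Φ g ⊗ₘ dayExtι Φ h) ≫ f = φ x y g h := by
  -- The two colimits are treated one at a time: for fixed `g` the family in `h` descends to `ψ x
  -- g`, and then the family of the `ψ x g` descends in turn. Each compatibility is the joint one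
  -- with an identity in the other variable.
  choose ψ hψ using fun (x : C) (g : G.functor.obj x) =>
    exists_whiskerLeft_dayExt_desc Φ (Φ.obj (op x)) (fun y (h : H.functor.obj y) => φ x y g h)
      (fun y y' l h => by
        rw [← day_map_id G g, ← hφ _ _ _ _ (𝟙 x) l, op_id, Φ.map_id, id_tensorHom, day_map_id])
  obtain ⟨f, hf⟩ := exists_whiskerRight_dayExt_desc Φ ((dayExt Φ).obj H) ψ (fun x x' k g => by
    refine whiskerLeft_dayExt_hom_ext Φ _ fun y h => ?_
    rw [hψ, whisker_exchange_assoc, hψ, ← day_map_id H h, ← hφ _ _ _ _ k (𝟙 y), op_id, Φ.map_id,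
      tensorHom_id, day_map_id])
  refine ⟨f, fun x y g h => ?_⟩
  rw [MonoidalCategory.tensorHom_def', Category.assoc, hf, hψ]

variable [Φ.Braided]

/-- The comparison of the extension of a monoidal functor with Day convolution. -/
def dayExtδ (G H : C ⊛⥤ Type w) :
    (dayExt Φ).obj (G ⊗ H) ⟶ (dayExt Φ).obj G ⊗ (dayExt Φ).obj H :=
  dayExtDesc Φ (dayTensorDesc
    (fun x y g h => δ Φ (op x) (op y) ≫ (dayExtι Φ g ⊗ₘ dayExtι Φ h)) (fun {x y x' y'} k l g h => by
      change _ = Φ.map (k.op ⊗ₘ l.op) ≫ _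
      rw [← map_dayExtι, ← map_dayExtι, ← tensorHom_comp_tensorHom, δ_natural_assoc]))

theorem dayExtι_δ {G H : C ⊛⥤ Type w} {x y : C} (g : G.functor.obj x) (h : H.functor.obj y) :
    dayExtι Φ (dayPair g h) ≫ dayExtδ Φ G H =
      δ Φ (op x) (op y) ≫ (dayExtι Φ g ⊗ₘ dayExtι Φ h) := by
  rw [dayExtδ, dayExtι_desc]
  exact ev_tensorDesc _ _ _

theorem isIso_dayExtδ (G H : C ⊛⥤ Type w) : IsIso (dayExtδ Φ G H) := by
  -- The inverse is induced by `μ Φ`: tensor products of values of the extension are colimits in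
  -- both variables, so a compatible family on pairs defines a map out of them.
  obtain ⟨f, hf⟩ := exists_tensor_dayExt_desc Φ (G := G) (H := H)
    (fun x y g h => μ Φ (op x) (op y) ≫ dayExtι Φ (dayPair g h)) (fun x y x' y' k l g h => by
      rw [μ_natural_assoc, ← dayPair_map, ← map_dayExtι]
      rfl)
  refine ⟨f, ?_, ?_⟩
  · refine dayExt_tensor_hom_ext Φ fun x y g h => ?_
    rw [reassoc_of% @dayExtι_δ, hf, Functor.Monoidal.δ_μ_assoc, Category.comp_id]
  · refine tensor_dayExt_hom_ext Φ fun x y g h => ?_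
    rw [← Category.assoc, hf, Category.assoc, dayExtι_δ, Functor.Monoidal.μ_δ_assoc,
      Category.comp_id]

/-- The extension of a monoidal functor is compatible with Day convolution. -/
def dayExtμIso (G H : C ⊛⥤ Type w) :
    (dayExt Φ).obj G ⊗ (dayExt Φ).obj H ≅ (dayExt Φ).obj (G ⊗ H) :=
  have := isIso_dayExtδ Φ G H
  (asIso (dayExtδ Φ G H)).symm

/-- The extension of a monoidal functor preserves the unit. -/
def dayExtεIso : 𝟙_ A ≅ (dayExt Φ).obj (𝟙_ (C ⊛⥤ Type w)) where
  hom := Functor.LaxMonoidal.ε Φ ≫ dayExtι Φ (dayOne C)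
  inv := dayExtDesc Φ (DayFunctor.unitDesc (TypeCat.ofHom fun _ => η Φ))
  hom_inv_id := by
    rw [Category.assoc, dayExtι_desc]
    refine (congrArg (Functor.LaxMonoidal.ε Φ ≫ ·) (ConcreteCategory.congr_hom
      (DayFunctor.ν_comp_unitDesc (F := (dayNerve Φ).obj (𝟙_ A)) (TypeCat.ofHom fun _ => η Φ))
      PUnit.unit)).trans ?_
    exact Functor.Monoidal.ε_η Φ
  inv_hom_id := dayExt_unit_hom_ext Φ (by
    rw [reassoc_of% @dayExtι_desc]
    refine (congrArg (· ≫ Functor.LaxMonoidal.ε Φ ≫ dayExtι Φ (dayOne C))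
      (ConcreteCategory.congr_hom
      (DayFunctor.ν_comp_unitDesc (F := (dayNerve Φ).obj (𝟙_ A)) (TypeCat.ofHom fun _ => η Φ))
      PUnit.unit)).trans ?_
    rw [Category.comp_id]
    exact Functor.Monoidal.η_ε_assoc Φ _)

theorem dayExtι_one : dayExtι Φ (dayOne C) ≫ (dayExtεIso Φ).inv = η Φ := by
  rw [Iso.comp_inv_eq]
  exact (Functor.Monoidal.η_ε_assoc Φ (dayExtι Φ (dayOne C))).symm

theorem dayExtδ_natural_left {G H : C ⊛⥤ Type w} (α : G ⟶ H) (K : C ⊛⥤ Type w) :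
    dayExtδ Φ G K ≫ (dayExt Φ).map α ▷ (dayExt Φ).obj K =
      (dayExt Φ).map (α ▷ K) ≫ dayExtδ Φ H K := by
  refine dayExt_tensor_hom_ext Φ fun x y g h => ?_
  rw [reassoc_of% @dayExtι_δ, reassoc_of% @dayExtι_map, ev_whiskerRight, dayExtι_δ, ← tensorHom_id,
    tensorHom_comp_tensorHom, dayExtι_map, Category.comp_id]

theorem dayExtδ_natural_right {G H : C ⊛⥤ Type w} (K : C ⊛⥤ Type w) (α : G ⟶ H) :
    dayExtδ Φ K G ≫ (dayExt Φ).obj K ◁ (dayExt Φ).map α =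
      (dayExt Φ).map (K ◁ α) ≫ dayExtδ Φ K H := by
  refine dayExt_tensor_hom_ext Φ fun x y g h => ?_
  rw [reassoc_of% @dayExtι_δ, reassoc_of% @dayExtι_map, ev_whiskerLeft, dayExtι_δ, ← id_tensorHom,
    tensorHom_comp_tensorHom, dayExtι_map, Category.comp_id]

theorem dayExtδ_associativity (G H K : C ⊛⥤ Type w) :
    dayExtδ Φ (G ⊗ H) K ≫ dayExtδ Φ G H ▷ (dayExt Φ).obj K ≫
        (α_ ((dayExt Φ).obj G) ((dayExt Φ).obj H) ((dayExt Φ).obj K)).hom =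
      (dayExt Φ).map (α_ G H K).hom ≫ dayExtδ Φ G (H ⊗ K) ≫
        (dayExt Φ).obj G ◁ dayExtδ Φ H K := by
  refine dayExt_tensor_tensor_hom_ext Φ fun x y z g h k => ?_
  rw [reassoc_of% @dayExtι_δ, reassoc_of% @dayExtι_map, ev_associator, ← map_dayExtι, Category.assoc,
    reassoc_of% @dayExtι_δ, ← tensorHom_id, tensorHom_comp_tensorHom_assoc, dayExtι_δ, Category.comp_id,
    ← id_tensorHom, tensorHom_comp_tensorHom, dayExtι_δ, Category.comp_id]
  have h₁ : (δ Φ (op x) (op y) ≫ (dayExtι Φ g ⊗ₘ dayExtι Φ h)) ⊗ₘ dayExtι Φ k =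
      δ Φ (op x) (op y) ▷ Φ.obj (op z) ≫ ((dayExtι Φ g ⊗ₘ dayExtι Φ h) ⊗ₘ dayExtι Φ k) := by
    rw [← tensorHom_id, tensorHom_comp_tensorHom, Category.id_comp]
  have h₂ : dayExtι Φ g ⊗ₘ (δ Φ (op y) (op z) ≫ (dayExtι Φ h ⊗ₘ dayExtι Φ k)) =
      Φ.obj (op x) ◁ δ Φ (op y) (op z) ≫ (dayExtι Φ g ⊗ₘ (dayExtι Φ h ⊗ₘ dayExtι Φ k)) := by
    rw [← id_tensorHom, tensorHom_comp_tensorHom, Category.id_comp]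
  have h₃ := Functor.OplaxMonoidal.associativity_assoc Φ (op x) (op y) (op z)
    (dayExtι Φ g ⊗ₘ (dayExtι Φ h ⊗ₘ dayExtι Φ k))
  rw [h₁, h₂, Category.assoc, associator_naturality]
  exact h₃

theorem dayExtδ_left_unitality (G : C ⊛⥤ Type w) :
    (λ_ ((dayExt Φ).obj G)).inv = (dayExt Φ).map (λ_ G).inv ≫ dayExtδ Φ (𝟙_ _) G ≫
      (dayExtεIso Φ).inv ▷ (dayExt Φ).obj G := by
  refine dayExt_hom_ext Φ fun x g => ?_
  -- The inverse unitor has no direct formula on elements. Here `g` is recognised as the image under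
  -- the unitor of the pair of the unit element with `g`, transported along `λ_ x`.
  have h : ev (λ_ G).inv g = (𝟙_ (C ⊛⥤ Type w) ⊗ G).functor.map (λ_ x).hom
      (dayPair (dayOne C) g) := by
    have h₁ : g = ev (λ_ G).hom ((𝟙_ (C ⊛⥤ Type w) ⊗ G).functor.map (λ_ x).hom
        (dayPair (dayOne C) g)) := by
      rw [ev_map, ev_leftUnitor, ← day_map_comp, Iso.inv_hom_id, day_map_id]
    conv_lhs => rw [h₁]
    rw [← ev_comp, Iso.hom_inv_id, ev_id]
  rw [reassoc_of% @dayExtι_map, h, ← map_dayExtι, Category.assoc, reassoc_of% @dayExtι_δ, ← tensorHom_id,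
    tensorHom_comp_tensorHom, dayExtι_one, Category.comp_id, leftUnitor_inv_naturality,
    Functor.OplaxMonoidal.left_unitality, Category.assoc, Category.assoc,
    ← MonoidalCategory.tensorHom_def]
  rfl

theorem dayExtδ_right_unitality (G : C ⊛⥤ Type w) :
    (ρ_ ((dayExt Φ).obj G)).inv = (dayExt Φ).map (ρ_ G).inv ≫ dayExtδ Φ G (𝟙_ _) ≫
      (dayExt Φ).obj G ◁ (dayExtεIso Φ).inv := by
  refine dayExt_hom_ext Φ fun x g => ?_
  have h : ev (ρ_ G).inv g = (G ⊗ 𝟙_ (C ⊛⥤ Type w)).functor.map (ρ_ x).hom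
      (dayPair g (dayOne C)) := by
    have h₁ : g = ev (ρ_ G).hom ((G ⊗ 𝟙_ (C ⊛⥤ Type w)).functor.map (ρ_ x).hom
        (dayPair g (dayOne C))) := by
      rw [ev_map, ev_rightUnitor, ← day_map_comp, Iso.inv_hom_id, day_map_id]
    conv_lhs => rw [h₁]
    rw [← ev_comp, Iso.hom_inv_id, ev_id]
  rw [reassoc_of% @dayExtι_map, h, ← map_dayExtι, Category.assoc, reassoc_of% @dayExtι_δ, ← id_tensorHom,
    tensorHom_comp_tensorHom, dayExtι_one, Category.comp_id, rightUnitor_inv_naturality,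
    Functor.OplaxMonoidal.right_unitality, Category.assoc, Category.assoc,
    ← MonoidalCategory.tensorHom_def']
  rfl

theorem dayExtδ_braided (G H : C ⊛⥤ Type w) :
    (dayExt Φ).map (β_ G H).hom ≫ dayExtδ Φ H G = dayExtδ Φ G H ≫ (β_ _ _).hom := by
  refine dayExt_tensor_hom_ext Φ fun x y g h => ?_
  rw [reassoc_of% @dayExtι_map, ev_braiding, ← map_dayExtι, Category.assoc, dayExtι_δ, reassoc_of% @dayExtι_δ,
    BraidedCategory.braiding_naturality]
  have h₁ : Φ.map (β_ (op x) (op y)).hom ≫ δ Φ (op y) (op x) =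
      δ Φ (op x) (op y) ≫ (β_ _ _).hom := by simp
  refine Eq.trans ?_ (Eq.trans (congrArg (· ≫ (dayExtι Φ h ⊗ₘ dayExtι Φ g)) h₁)
    (Category.assoc _ _ _))
  rw [Category.assoc]
  rfl

/-- The extension of a symmetric monoidal functor along the Yoneda embedding is symmetric
monoidal. -/
instance : (dayExt Φ).Braided where
  toMonoidal := (Functor.CoreMonoidal.mk' (dayExtεIso Φ) (dayExtμIso Φ)
    (fun α K => dayExtδ_natural_left Φ α K) (fun K α => dayExtδ_natural_right Φ K α)
    (dayExtδ_associativity Φ) (dayExtδ_left_unitality Φ) (dayExtδ_right_unitality Φ)).toMonoidal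
  braided G H := by
    change (dayExtμIso Φ G H).hom ≫ _ = _ ≫ (dayExtμIso Φ H G).hom
    have h : (dayExt Φ).map (β_ G H).hom ≫ (dayExtμIso Φ H G).inv =
      (dayExtμIso Φ G H).inv ≫ (β_ _ _).hom := dayExtδ_braided Φ G H
    rw [← Iso.comp_inv_eq, Category.assoc, h, Iso.hom_inv_id_assoc]

theorem dayExt_δ (G H : C ⊛⥤ Type w) : δ (dayExt Φ) G H = dayExtδ Φ G H := rfl

theorem dayExtι_μ {G H : C ⊛⥤ Type w} {x y : C} (g : G.functor.obj x) (h : H.functor.obj y) :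
    (dayExtι Φ g ⊗ₘ dayExtι Φ h) ≫ μ (dayExt Φ) G H =
      μ Φ (op x) (op y) ≫ dayExtι Φ (dayPair g h) := by
  rw [← cancel_mono (δ (dayExt Φ) G H), Category.assoc, Category.assoc, Functor.Monoidal.μ_δ,
    dayExt_δ, dayExtι_δ, Functor.Monoidal.μ_δ_assoc, Category.comp_id]

/-- The inverse is evaluation of the universal cocone at identity elements, so both axioms reduce to
explicit formulas on generators; the forward direction then follows formally. -/
instance dayExtYonedaIso_inv_isMonoidal : NatTrans.IsMonoidal (dayExtYonedaIso Φ).inv where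
  unit := by
    change Functor.LaxMonoidal.ε Φ ≫ dayExtι Φ (elt (𝟙 (𝟙_ Cᵒᵖ).unop)) =
      (Functor.LaxMonoidal.ε Φ ≫ dayExtι Φ (dayOne C)) ≫ (dayExt Φ).map (dayε C)
    rw [Category.assoc, dayExtι_map, ev_dayε]
    rfl
  tensor x y := by
    change μ Φ x y ≫ dayExtι Φ (elt (𝟙 (x ⊗ y).unop)) =
      (dayExtι Φ (elt (𝟙 x.unop)) ⊗ₘ dayExtι Φ (elt (𝟙 y.unop))) ≫
        μ (dayExt Φ) _ _ ≫ (dayExt Φ).map (dayμ x y)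
    rw [reassoc_of% @dayExtι_μ, dayExtι_map, ev_dayμ, id_tensorHom_id]
    rfl

theorem dayExtYonedaIso_isMonoidal : NatTrans.IsMonoidal (dayExtYonedaIso Φ).hom :=
  have : NatTrans.IsMonoidal (dayExtYonedaIso Φ).symm.hom :=
    inferInstanceAs (NatTrans.IsMonoidal (dayExtYonedaIso Φ).inv)
  inferInstanceAs (NatTrans.IsMonoidal (dayExtYonedaIso Φ).symm.inv)

end MonoidalExtension

end
end ClassifyingVectoid

namespace ClassifyingVectoid

open ComonObj CartesianMonoidalCategory

noncomputable section

/-! ### Images of coalgebras -/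

section MapCoalg

open Functor.LaxMonoidal Functor.OplaxMonoidal

variable {A : Type u₁} [Category.{w} A] [MonoidalCategory A] [SymmetricCategory A]
  {B : Type u₂} [Category.{w} B] [MonoidalCategory B] [SymmetricCategory B]

/-- A monoidal natural transformation induces a morphism between the images of a coalgebra. -/
def mapCoalgHom {F G : B ⥤ A} [F.Braided] [G.Braided] (θ : F ⟶ G) (hθ : NatTrans.IsMonoidal θ)
    (X : CommComon B) : mapCoalg F X ⟶ mapCoalg G X :=
  commComonHom (θ.app X.X)
    { hom_counit := by
        change θ.app X.X ≫ G.map X.comon.counit ≫ η G = F.map X.comon.counit ≫ η F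
        rw [← NatTrans.naturality_assoc, app_counit]
      hom_comul := by
        change θ.app X.X ≫ G.map X.comon.comul ≫ δ G X.X X.X =
          (F.map X.comon.comul ≫ δ F X.X X.X) ≫ (θ.app X.X ⊗ₘ θ.app X.X)
        rw [← NatTrans.naturality_assoc, app_comul, Category.assoc] }

/-- The image of a coalgebra under a composite of monoidal functors. -/
def mapCoalgComp {S : Type u} [Category.{w} S] [MonoidalCategory S] [SymmetricCategory S]
    (G : S ⥤ B) (F : B ⥤ A) [G.Braided] [F.Braided] (X : CommComon S) :
    mapCoalg F (mapCoalg G X) ≅ mapCoalg (G ⋙ F) X :=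
  commComonIso (Iso.refl (F.obj (G.obj X.X)))
    { hom_counit := by
        change 𝟙 _ ≫ F.map (G.map X.comon.counit) ≫ F.map (η G) ≫ η F =
          F.map (G.map X.comon.counit ≫ η G) ≫ η F
        rw [Category.id_comp, F.map_comp, Category.assoc]
      hom_comul := by
        change 𝟙 _ ≫ F.map (G.map X.comon.comul) ≫ F.map (δ G X.X X.X) ≫ δ F _ _ =
          (F.map (G.map X.comon.comul ≫ δ G X.X X.X) ≫ δ F _ _) ≫ (𝟙 _ ⊗ₘ 𝟙 _)
        rw [Category.id_comp, F.map_comp, Category.assoc, id_tensorHom_id, Category.comp_id,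
          Category.assoc] }

theorem coalgPow_η (C : CommComon A) : η (coalgPow C) = und (η (powFunctor C)) :=
  Category.comp_id (und (η (powFunctor C)))

theorem coalgPow_δ (C : CommComon A) (s t : StdFin.{w}ᵒᵖ) :
    δ (coalgPow C) s t = und (δ (powFunctor C) s t) :=
  Category.comp_id (und (δ (powFunctor C) s t))

/-- The value of the tensor functor of a coalgebra at the point is the coalgebra. -/
def coalgPowPointHom (C : CommComon A) : mapCoalg (coalgPow C) pointCoalg ⟶ tensorPow C 1 :=
  let X := mapCoalg (powFunctor C) pointCoalg
  commComonHom (𝟙 (tensorPow C 1).X)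
    { hom_counit := by
        have h : und X.comon.counit = ε[(tensorPow C 1).X] :=
          congrArg und (toUnit_unique X.comon.counit (toUnit (tensorPow C 1)))
        change 𝟙 _ ≫ ε[(tensorPow C 1).X] = ((coalgPow C).map pointCoalg.comon.counit) ≫
          η (coalgPow C)
        rw [Category.id_comp, ← h, coalgPow_η]
        rfl
      hom_comul := by
        -- An object of a cartesian category carries only one coalgebra structure, the diagonal one.
        -- Hence the structure transported from the point is that of `tensorPow C 1` as an object of
        -- `CommComon A`.
        have h : und X.comon.comul = Δ[(tensorPow C 1).X] := by
          have h₁ := @comul_eq_lift _ _ _ X.X X.comon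
          refine (congrArg und h₁).trans ?_
          rw [und_lift, und_id, id_tensorHom_id, Category.comp_id]
          rfl
        change 𝟙 _ ≫ Δ[(tensorPow C 1).X] = ((coalgPow C).map pointCoalg.comon.comul ≫
          δ (coalgPow C) _ _) ≫ (𝟙 _ ⊗ₘ 𝟙 _)
        rw [Category.id_comp, id_tensorHom_id, Category.comp_id, ← h, coalgPow_δ]
        rfl }

end MapCoalg

/-! ### The classifying morphism of a coalgebra. -/

section Extension

open Functor.LaxMonoidal Functor.OplaxMonoidal

variable {A : Type u} [Category.{w} A] [MonoidalCategory A] [SymmetricCategory A] [IsVectoid A]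

open Limits

instance : HasColimitsOfSize.{w, w} A := IsVectoid.hasColimits

instance (X : A) : PreservesColimitsOfSize.{w, w} (tensorLeft X) :=
  IsVectoid.tensorLeft_cocontinuous X

instance (X : A) : PreservesColimitsOfSize.{w, w} (tensorRight X) :=
  IsVectoid.tensorRight_cocontinuous X

/-- The morphism of vectoids to the classifying vectoid given by a tensor functor on the opposite
of the category of standard finite sets. -/
def extVectoidHom (Φ : StdFin.{w}ᵒᵖ ⥤ A) [Φ.Braided] : VectoidHom A Qc.{w} where
  inverseImage := dayExt Φ
  directImage := dayNerve Φ
  adj := dayExtAdj Φ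

/-- The morphism of vectoids classifying a cocommutative coalgebra. -/
abbrev classifyingHom (C : CommComon A) : VectoidHom A Qc.{w} := extVectoidHom (coalgPow C)

/-- The inverse image of the universal coalgebra under the classifying morphism of `C` maps
to `C`. -/
def classifyingCoalgHom (C : CommComon A) :
    mapCoalg (classifyingHom C).inverseImage univCoalg ⟶ C :=
  (mapCoalgComp (dayYoneda StdFin.{w}) (dayExt (coalgPow C)) pointCoalg).hom ≫
    mapCoalgHom (dayExtYonedaIso (coalgPow C)).hom
      (dayExtYonedaIso_isMonoidal (coalgPow C)) pointCoalg ≫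
    coalgPowPointHom C ≫ (λ_ C).hom

/-- The comparison isomorphisms of `mapCoalgComp` and `coalgPowPointHom` are identities on
underlying objects. The left unitor remains because `tensorPow C.X 1` is `𝟙_ A ⊗ C.X`. -/
theorem und_classifyingCoalgHom (C : CommComon A) : und (classifyingCoalgHom C) =
    (dayExtYonedaIso (coalgPow C)).hom.app (op (StdFin.mk 1)) ≫ (coalgPowIso C 1).hom ≫
      (λ_ C.X).hom := by
  have h : (coalgPowIso C 1).hom = 𝟙 (tensorPow C 1).X := by
    change 𝟙 (𝟙_ A ⊗ C.X) ≫ 𝟙 (𝟙_ A) ▷ C.X = 𝟙 (𝟙_ A ⊗ C.X)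
    rw [id_whiskerRight, Category.comp_id]
  rw [h]
  change 𝟙 ((dayExt (coalgPow C)).obj ((dayYoneda StdFin.{w}).obj (op (StdFin.mk 1)))) ≫
    (dayExtYonedaIso (coalgPow C)).hom.app (op (StdFin.mk 1)) ≫
    𝟙 (𝟙_ A ⊗ C.X) ≫ (λ_ C.X).hom = _
  exact Category.id_comp _

/-- The inverse image of the universal coalgebra under the classifying morphism of `C` is `C`. -/
def classifyingCoalgIso (C : CommComon A) :
    mapCoalg (classifyingHom C).inverseImage univCoalg ≅ C :=
  have : IsIso (classifyingCoalgHom C) := isIso_of_und _ (by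
    rw [und_classifyingCoalgHom]
    exact ((dayExtYonedaIso (coalgPow C)).app (op (StdFin.mk 1)) ≪≫ coalgPowIso C 1 ≪≫
      λ_ C.X).isIso_hom)
  asIso (classifyingCoalgHom C)

end Extension

end
end ClassifyingVectoid

namespace ClassifyingVectoid

open scoped DayFunctor ExternalProduct
open Functor.LaxMonoidal Functor.OplaxMonoidal

noncomputable section

set_option linter.unusedSectionVars false

/-! ### Natural transformations between cocontinuous functors -/

section Density

variable {C : Type w} [SmallCategory C] [MonoidalCategory C] [SymmetricCategory C]

theorem ev_dayYonedaDesc_id {F : C ⊛⥤ Type w} {x : Cᵒᵖ} (a : F.functor.obj x.unop) :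
    ev (dayYonedaDesc a) (elt (𝟙 x.unop)) = a :=
  day_map_id F a

theorem dayYonedaDesc_comp {F G : C ⊛⥤ Type w} {x : Cᵒᵖ} (a : F.functor.obj x.unop) (α : F ⟶ G) :
    dayYonedaDesc a ≫ α = dayYonedaDesc (ev α a) :=
  dayYoneda_hom_ext (by rw [ev_comp, ev_dayYonedaDesc_id, ev_dayYonedaDesc_id])

theorem dayYonedaDesc_elt_id (x : Cᵒᵖ) : dayYonedaDesc (elt (𝟙 x.unop)) = 𝟙 _ :=
  dayYoneda_hom_ext (by rw [ev_dayYonedaDesc_id, ev_id])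

theorem dayYoneda_map_dayYonedaDesc {F : C ⊛⥤ Type w} {x y : Cᵒᵖ} (f : x ⟶ y)
    (a : F.functor.obj y.unop) :
    (dayYoneda C).map f ≫ dayYonedaDesc a = dayYonedaDesc (F.functor.map f.unop a) :=
  dayYoneda_hom_ext (by
    rw [ev_comp, ev_dayYonedaDesc_id, ev_dayYoneda_map, Category.comp_id, ev_dayYonedaDesc])

theorem ev_tensorHom {F G F' G' : C ⊛⥤ Type w} (α : F ⟶ F') (β : G ⟶ G') {x y : C}
    (a : F.functor.obj x) (b : G.functor.obj y) :
    ev (α ⊗ₘ β) (dayPair a b) = dayPair (ev α a) (ev β b) := by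
  rw [MonoidalCategory.tensorHom_def, ev_comp, ev_whiskerRight, ev_whiskerLeft]

variable {A : Type u} [Category.{w} A]

/-- Transposition turns `u` and `v` into morphisms of Day functors, which are determined by elements
of `P`, that is, by morphisms from representables. -/
theorem leftAdjoint_hom_ext {F : (C ⊛⥤ Type w) ⥤ A} {R : A ⥤ (C ⊛⥤ Type w)} (adj : F ⊣ R)
    {P : C ⊛⥤ Type w} {a : A} {u v : F.obj P ⟶ a}
    (h : ∀ (x : Cᵒᵖ) (p : P.functor.obj x.unop),
      F.map (dayYonedaDesc p) ≫ u = F.map (dayYonedaDesc p) ≫ v) : u = v := by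
  apply (adj.homEquiv P a).injective
  refine day_hom_ext fun x p => ?_
  have h₁ := congrArg (fun w => ev (adj.homEquiv _ a w) (elt (𝟙 x))) (h (op x) p)
  simp only [Adjunction.homEquiv_naturality_left] at h₁
  rw [ev_comp, ev_comp, ev_dayYonedaDesc_id (x := op x)] at h₁
  exact h₁

theorem leftAdjoint_tensor_hom_ext {F : (C ⊛⥤ Type w) ⥤ A} {R : A ⥤ (C ⊛⥤ Type w)} (adj : F ⊣ R)
    {P Q : C ⊛⥤ Type w} {a : A} {u v : F.obj (P ⊗ Q) ⟶ a}
    (h : ∀ (x y : Cᵒᵖ) (p : P.functor.obj x.unop) (q : Q.functor.obj y.unop),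
      F.map (dayYonedaDesc p ⊗ₘ dayYonedaDesc q) ≫ u =
        F.map (dayYonedaDesc p ⊗ₘ dayYonedaDesc q) ≫ v) : u = v := by
  apply (adj.homEquiv (P ⊗ Q) a).injective
  refine day_tensor_hom_ext fun x y p q => ?_
  have h₁ := congrArg (fun w => ev (adj.homEquiv _ a w) (dayPair (elt (𝟙 x)) (elt (𝟙 y))))
    (h (op x) (op y) p q)
  simp only [Adjunction.homEquiv_naturality_left] at h₁
  rw [ev_comp, ev_comp, ev_tensorHom, ev_dayYonedaDesc_id (x := op x),
    ev_dayYonedaDesc_id (x := op y)] at h₁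
  exact h₁

theorem exists_extend_natTrans {F F' : (C ⊛⥤ Type w) ⥤ A} {R : A ⥤ (C ⊛⥤ Type w)} (adj : F ⊣ R)
    (θ : dayYoneda C ⋙ F ⟶ dayYoneda C ⋙ F') :
    ∃ Θ : F ⟶ F', ∀ x : Cᵒᵖ, Θ.app ((dayYoneda C).obj x) = θ.app x := by
  -- An element `p` of `P x` is a morphism from a representable, so naturality forces the
  -- restriction of the extension along `F p` to be `θ` followed by `F' p`. The transposes of these
  -- composites form the map `e P`.
  let e (P : C ⊛⥤ Type w) : P ⟶ R.obj (F'.obj P) :=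
    dayHom (fun x p => ev (adj.homEquiv _ _ (θ.app (op x) ≫ F'.map (dayYonedaDesc p)))
      (elt (𝟙 x))) (fun {x y} f p => by
        have h : θ.app (op y) ≫ F'.map (dayYonedaDesc (x := op y) (P.functor.map f p)) =
            F.map ((dayYoneda C).map f.op) ≫ θ.app (op x) ≫
              F'.map (dayYonedaDesc (x := op x) p) := by
          have h₁ := θ.naturality_assoc f.op (F'.map (dayYonedaDesc (x := op x) p))
          refine Eq.trans ?_ h₁.symm
          rw [Functor.comp_map, ← F'.map_comp, dayYoneda_map_dayYonedaDesc]
          rfl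
        have h₂ : ev ((dayYoneda C).map f.op) (elt (𝟙 y)) =
            ((dayYoneda C).obj (op x)).functor.map f (elt (𝟙 x)) :=
          (Category.comp_id f).trans (Category.id_comp f).symm
        rw [h, Adjunction.homEquiv_naturality_left, ev_comp, ← ev_map]
        exact congrArg (ev _) h₂)
  let Θ (P : C ⊛⥤ Type w) : F.obj P ⟶ F'.obj P := (adj.homEquiv _ _).symm (e P)
  have hΘ (P : C ⊛⥤ Type w) (x : Cᵒᵖ) (p : P.functor.obj x.unop) :
      F.map (dayYonedaDesc p) ≫ Θ P = θ.app x ≫ F'.map (dayYonedaDesc p) := by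
    apply (adj.homEquiv _ _).injective
    rw [Adjunction.homEquiv_naturality_left, Equiv.apply_symm_apply]
    apply dayYoneda_hom_ext
    rw [ev_comp, ev_dayYonedaDesc_id]
    rfl
  refine ⟨{ app := Θ, naturality := fun P Q α => leftAdjoint_hom_ext adj fun x p => ?_ },
    fun x => ?_⟩
  · rw [← F.map_comp_assoc, dayYonedaDesc_comp, hΘ, reassoc_of% (hΘ P), ← F'.map_comp,
      dayYonedaDesc_comp]
  · have h := hΘ ((dayYoneda C).obj x) x (elt (𝟙 x.unop))
    rw [dayYonedaDesc_elt_id, F.map_id, F'.map_id, Category.id_comp] at h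
    exact h.trans (Category.comp_id _)

variable [MonoidalCategory A]

theorem isMonoidal_of_restrict {F F' : (C ⊛⥤ Type w) ⥤ A} [F.Monoidal] [F'.Monoidal]
    {R : A ⥤ (C ⊛⥤ Type w)} (adj : F ⊣ R) (Θ : F ⟶ F')
    (hΘ : NatTrans.IsMonoidal (Functor.whiskerLeft (dayYoneda C) Θ)) : NatTrans.IsMonoidal Θ where
  unit := by
    -- The unit is itself representable, so the axiom there is the restricted one up to the
    -- isomorphism `dayε C`.
    have h : (Functor.LaxMonoidal.ε F ≫ F.map (dayε C)) ≫ Θ.app _ =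
      Functor.LaxMonoidal.ε F' ≫ F'.map (dayε C) := hΘ.unit
    have : IsIso (dayε C) := (dayεIso C).isIso_hom
    rw [Category.assoc, Θ.naturality, ← Category.assoc, cancel_mono] at h
    exact h
  tensor P Q := by
    have h₀ (x y : Cᵒᵖ) : μ F ((dayYoneda C).obj x) ((dayYoneda C).obj y) ≫ Θ.app _ =
        (Θ.app _ ⊗ₘ Θ.app _) ≫ μ F' _ _ := by
      have h : (μ F ((dayYoneda C).obj x) ((dayYoneda C).obj y) ≫ F.map (dayμ x y)) ≫ Θ.app _ =
        (Θ.app _ ⊗ₘ Θ.app _) ≫ μ F' _ _ ≫ F'.map (dayμ x y) := hΘ.tensor x y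
      have : IsIso (dayμ x y) := (dayμIso x y).isIso_hom
      rw [Category.assoc, Θ.naturality, ← Category.assoc, ← Category.assoc, cancel_mono] at h
      exact h
    -- With `F (P ⊗ Q)` as the source, the equation can be tested on tensor products of morphisms
    -- from representables, where it is `h₀` by naturality.
    rw [← cancel_epi (δ F P Q), Functor.Monoidal.δ_μ_assoc]
    refine leftAdjoint_tensor_hom_ext adj fun x y p q => ?_
    rw [Θ.naturality, ← δ_natural_assoc, tensorHom_comp_tensorHom_assoc, Θ.naturality,
      Θ.naturality, ← tensorHom_comp_tensorHom_assoc, μ_natural, ← reassoc_of% h₀ x y,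
      Functor.Monoidal.δ_μ_assoc]

end Density

/-! ### The category of morphisms to the classifying vectoid -/

section Classification

variable {A : Type u} [Category.{w} A] [MonoidalCategory A] [SymmetricCategory A]

/-- The value at `h_1` determines a monoidal transformation on every `h_n`, and the representables
determine it everywhere because the source functor is a left adjoint. -/
instance inverseImageCoalg_faithful :
    (inverseImageCoalg (A := A) univCoalg.{w}).Faithful where
  map_injective {f g} θ θ' h := by
    have := θ.isMonoidal
    have := θ'.isMonoidal
    have h' : θ.natTrans.app univCoalg.{w}.X = θ'.natTrans.app univCoalg.{w}.X := congrArg und h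
    apply VectoidHom.Hom.ext
    ext P
    refine leftAdjoint_hom_ext f.adj fun x p => ?_
    rw [NatTrans.naturality, NatTrans.naturality]
    have h₁ := monoidal_natTrans_ext (Functor.whiskerLeft (dayYoneda StdFin.{w}) θ.natTrans)
      (Functor.whiskerLeft (dayYoneda StdFin.{w}) θ'.natTrans) h' x.unop.len
    exact congrArg (· ≫ g.inverseImage.map (dayYonedaDesc p)) h₁

instance inverseImageCoalg_full : (inverseImageCoalg (A := A) univCoalg.{w}).Full where
  map_surjective {f g} c := by
    obtain ⟨θ, hθ, hθc⟩ := exists_monoidal_natTrans (dayYoneda StdFin.{w} ⋙ f.inverseImage)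
      (dayYoneda StdFin.{w} ⋙ g.inverseImage) ((mapCoalgComp _ _ _).inv ≫ c ≫
        (mapCoalgComp _ _ _).hom)
    obtain ⟨Θ, hΘ⟩ := exists_extend_natTrans f.adj θ
    have h : Functor.whiskerLeft (dayYoneda StdFin.{w}) Θ = θ := by
      ext x
      exact hΘ x
    refine ⟨⟨Θ, isMonoidal_of_restrict f.adj Θ (h ▸ hθ)⟩, und_injective ?_⟩
    change Θ.app ((dayYoneda StdFin.{w}).obj (op (StdFin.mk 1))) = und c
    rw [hΘ, hθc]
    change 𝟙 _ ≫ und c ≫ 𝟙 _ = und c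
    exact (Category.id_comp _).trans (Category.comp_id _)

instance inverseImageCoalg_essSurj [IsVectoid A] :
    (inverseImageCoalg (A := A) univCoalg.{w}).EssSurj where
  mem_essImage C := ⟨classifyingHom C, ⟨classifyingCoalgIso C⟩⟩

theorem inverseImageCoalg_isEquivalence [IsVectoid A] :
    (inverseImageCoalg (A := A) univCoalg.{w}).IsEquivalence where

end Classification

end
end ClassifyingVectoid

namespace ClassifyingVectoid

open scoped DayFunctor ExternalProduct
open Limits

noncomputable section

set_option linter.unusedSectionVars false

/-! ### Day functors form a vectoid -/

section DayVectoid

variable {C : Type w} [SmallCategory C] [MonoidalCategory C] [SymmetricCategory C]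

instance : HasColimitsOfSize.{w, w} (C ⊛⥤ Type w) :=
  Adjunction.has_colimits_of_equivalence (DayFunctor.equiv C (Type w)).functor

instance : HasLimitsOfSize.{w, w} (C ⊛⥤ Type w) :=
  Adjunction.has_limits_of_equivalence (DayFunctor.equiv C (Type w)).functor

/-- An element of a shift of `H` as an element of `H`. -/
def dayShiftElt {H : C ⊛⥤ Type w} {x y : C} (a : (dayShift H y).functor.obj x) :
    H.functor.obj (x ⊗ y) := a

theorem dayShiftElt_map {H : C ⊛⥤ Type w} {x x' y : C} (f : x ⟶ x')
    (a : (dayShift H y).functor.obj x) :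
    dayShiftElt ((dayShift H y).functor.map f a) = H.functor.map (f ▷ y) (dayShiftElt a) := rfl

/-- The functoriality of shifts. -/
def dayShiftMap (H : C ⊛⥤ Type w) {y y' : C} (g : y ⟶ y') : dayShift H y ⟶ dayShift H y' :=
  dayHom (fun x a => H.functor.map (x ◁ g) (dayShiftElt a)) (fun {x x'} f a => by
    change _ = H.functor.map (f ▷ y') (H.functor.map (x ◁ g) (dayShiftElt a))
    rw [dayShiftElt_map, ← day_map_comp, ← day_map_comp, whisker_exchange])

theorem dayShiftElt_ev_map (H : C ⊛⥤ Type w) {x y y' : C} (g : y ⟶ y')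
    (a : (dayShift H y).functor.obj x) :
    dayShiftElt (ev (dayShiftMap H g) a) = H.functor.map (x ◁ g) (dayShiftElt a) := rfl

theorem dayShiftMap_id (H : C ⊛⥤ Type w) (y : C) : dayShiftMap H (𝟙 y) = 𝟙 _ :=
  day_hom_ext fun x a => (dayShiftElt_ev_map H (𝟙 y) a).trans (by
    rw [whiskerLeft_id, day_map_id]
    rfl)

theorem dayShiftMap_comp (H : C ⊛⥤ Type w) {y y' y'' : C} (g : y ⟶ y') (h : y' ⟶ y'') :
    dayShiftMap H (g ≫ h) = dayShiftMap H g ≫ dayShiftMap H h :=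
  day_hom_ext fun x a => (dayShiftElt_ev_map H (g ≫ h) a).trans (by
    rw [whiskerLeft_comp, day_map_comp]
    rfl)

/-- The internal hom of Day functors. -/
def dayIhom (F H : C ⊛⥤ Type w) : C ⊛⥤ Type w :=
  ⟨{ obj := fun y => (F ⟶ dayShift H y)
     map := fun g => TypeCat.ofHom (fun α => α ≫ dayShiftMap H g)
     map_id := fun y => by
      refine ConcreteCategory.hom_ext _ _ fun (α : F ⟶ dayShift H _) => ?_
      exact (congrArg (α ≫ ·) (dayShiftMap_id H y)).trans (Category.comp_id α)
     map_comp := fun {y y' y''} f g => by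
      refine ConcreteCategory.hom_ext _ _ fun (α : F ⟶ dayShift H _) => ?_
      exact (congrArg (α ≫ ·) (dayShiftMap_comp H f g)).trans (Category.assoc α _ _).symm }⟩

/-- The morphism given by an element of an internal hom. -/
def dayIhomElt {F H : C ⊛⥤ Type w} {y : C} (α : (dayIhom F H).functor.obj y) :
    F ⟶ dayShift H y := α

theorem dayIhomElt_map {F H : C ⊛⥤ Type w} {y y' : C} (g : y ⟶ y')
    (α : (dayIhom F H).functor.obj y) :
    dayIhomElt ((dayIhom F H).functor.map g α) = dayIhomElt α ≫ dayShiftMap H g := rfl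

/-- The tensor-hom adjunction for Day convolution. -/
def dayIhomEquiv (F G H : C ⊛⥤ Type w) : (F ⊗ G ⟶ H) ≃ (G ⟶ dayIhom F H) where
  toFun α := dayHom
    (fun y b => dayHom (G := dayShift H y) (fun x a => ev α (dayPair a b)) (fun {x x'} f a => by
      change _ = H.functor.map (f ▷ y) (ev α (dayPair a b))
      rw [← ev_map, ← tensorHom_id, dayPair_map, day_map_id]))
    (fun {y y'} g b => day_hom_ext fun x a => by
      change ev α (dayPair a (G.functor.map g b)) = H.functor.map (x ◁ g) (ev α (dayPair a b))
      rw [← ev_map, ← id_tensorHom, dayPair_map, day_map_id])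
  invFun β := dayTensorDesc (fun x y a b => dayShiftElt (ev (dayIhomElt (ev β b)) a))
    (fun {x y x' y'} f g a b => by
      rw [ev_map β g b, dayIhomElt_map, ev_comp, dayShiftElt_ev_map, ev_map, dayShiftElt_map,
        ← day_map_comp, MonoidalCategory.tensorHom_def])
  left_inv α := day_tensor_hom_ext fun x y a b => ev_dayTensorDesc _ _ _ _
  right_inv β := day_hom_ext fun y b => day_hom_ext fun x a => ev_dayTensorDesc _ _ _ _

instance (F : C ⊛⥤ Type w) : (tensorLeft F).IsLeftAdjoint :=
  (Adjunction.adjunctionOfEquivRight (F := tensorLeft F) (fun G H => dayIhomEquiv F G H)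
    (fun G' G H f g => day_hom_ext fun y b => day_hom_ext fun x a => by
      change ev (F ◁ f ≫ g) (dayPair a b) = ev g (dayPair a (ev f b))
      rw [ev_comp, ev_whiskerLeft])).isLeftAdjoint

/-! ### Exactness properties, tested on elements. -/

theorem ev_surjective_of_epi {X Y : C ⊛⥤ Type w} (f : X ⟶ Y) [Epi f] (x : C) :
    Function.Surjective (ev f (x := x)) := by
  have h : Epi ((DayFunctor.equiv C (Type w)).functor.map f) := inferInstance
  have h₁ : Epi (((DayFunctor.equiv C (Type w)).functor.map f).app x) := inferInstance
  exact (epi_iff_surjective _).1 h₁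

/-- Elements are morphisms from representables, to which joint monicity applies. -/
theorem ev_injective_of_joint {R X : C ⊛⥤ Type w} {p₁ p₂ : R ⟶ X} (h : JointlyMono₂ p₁ p₂) {x : C}
    {r r' : R.functor.obj x} (h₁ : ev p₁ r = ev p₁ r') (h₂ : ev p₂ r = ev p₂ r') : r = r' := by
  have h₃ := h.right_cancellation (dayYonedaDesc (x := op x) r) (dayYonedaDesc (x := op x) r')
    (by rw [dayYonedaDesc_comp, dayYonedaDesc_comp, h₁])
    (by rw [dayYonedaDesc_comp, dayYonedaDesc_comp, h₂])
  have h₄ := congrArg (fun α => ev α (elt (x := op x) (𝟙 x))) h₃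
  exact (ev_dayYonedaDesc_id (x := op x) r).symm.trans
    (h₄.trans (ev_dayYonedaDesc_id (x := op x) r'))

theorem exists_of_isPullback {P X Y Z : C ⊛⥤ Type w} {fst : P ⟶ X} {snd : P ⟶ Y} {f : X ⟶ Z}
    {g : Y ⟶ Z} (h : IsPullback fst snd f g) {x : C} (a : X.functor.obj x) (b : Y.functor.obj x)
    (hab : ev f a = ev g b) : ∃ p : P.functor.obj x, ev fst p = a ∧ ev snd p = b := by
  have hw : dayYonedaDesc (x := op x) a ≫ f = dayYonedaDesc (x := op x) b ≫ g := by
    rw [dayYonedaDesc_comp, dayYonedaDesc_comp, hab]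
  refine ⟨ev (h.lift _ _ hw) (elt (x := op x) (𝟙 x)), ?_, ?_⟩
  · rw [← ev_comp, h.lift_fst]
    exact ev_dayYonedaDesc_id (x := op x) a
  · rw [← ev_comp, h.lift_snd]
    exact ev_dayYonedaDesc_id (x := op x) b

theorem day_isCokernelOfKernelPair {X Y : C ⊛⥤ Type w} (f : X ⟶ Y)
    (hf : ∀ x : C, Function.Surjective (ev f (x := x))) : IsCokernelOfKernelPair f := by
  intro R a b h
  have key (s : Cofork a b) {x : C} (u v : X.functor.obj x) (huv : ev f u = ev f v) :
      ev s.π u = ev s.π v := by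
    obtain ⟨r, rfl, rfl⟩ := exists_of_isPullback h u v huv
    rw [← ev_comp, ← ev_comp, s.condition]
  -- A morphism out of `Y` is defined by chosen preimages. Two preimages of one element come from an
  -- element of the kernel pair, so by `key` the choice is immaterial.
  choose l hl using hf
  refine ⟨Cofork.IsColimit.mk _ (fun s => dayHom (fun x y => ev s.π (l x y)) (fun {x x'} k y => ?_))
    (fun s => day_hom_ext fun x u => ?_) (fun s m hm => day_hom_ext fun x y => ?_)⟩
  · change Y.functor.obj x at y
    rw [← ev_map]
    refine key s _ _ ((hl x' _).trans ?_)
    rw [ev_map, hl]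
    rfl
  · exact key s _ _ (hl x _)
  · change ev m y = ev s.π (l x y)
    rw [← hm]
    change ev m y = ev m (ev f (l x y))
    rw [hl]

/-- The quotient of a Day functor by a pointwise equivalence relation. -/
def dayQuot (X : C ⊛⥤ Type w) (r : ∀ x, Setoid (X.functor.obj x))
    (hr : ∀ {x y : C} (f : x ⟶ y) (a b : X.functor.obj x), r x a b →
      r y (X.functor.map f a) (X.functor.map f b)) : C ⊛⥤ Type w :=
  ⟨{ obj := fun x => Quotient (r x)
     map := fun f => TypeCat.ofHom (Quotient.map (X.functor.map f) (fun a b h => hr f a b h))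
     map_id := fun x => by
      ext a
      induction a using Quotient.ind with
      | _ a => exact congrArg _ (day_map_id X a)
     map_comp := fun f g => by
      ext a
      induction a using Quotient.ind with
      | _ a => exact congrArg _ (day_map_comp X f g a) }⟩

theorem day_equivalenceRelation_effective {R X : C ⊛⥤ Type w} (p₁ p₂ : R ⟶ X)
    (h : IsEquivalenceRelation p₁ p₂) (c : Cofork p₁ p₂) (hc : IsColimit c) :
    IsKernelPair c.π p₁ p₂ := by
  obtain ⟨e⟩ := h.nonempty_equivalenceRelation
  have hmono : JointlyMono₂ p₁ p₂ := e.toJointlyMono₂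
  let r (x : C) : Setoid (X.functor.obj x) :=
    { r := fun a b => ∃ s : R.functor.obj x, ev p₁ s = a ∧ ev p₂ s = b
      iseqv :=
        { refl := fun a => ⟨ev e.r a, by rw [← ev_comp, e.reflexivity₁, ev_id],
            by rw [← ev_comp, e.reflexivity₂, ev_id]⟩
          symm := by
            rintro _ _ ⟨s, rfl, rfl⟩
            exact ⟨ev e.s s, by rw [← ev_comp, e.symmetry₁], by rw [← ev_comp, e.symmetry₂]⟩
          trans := by
            rintro _ _ _ ⟨s, rfl, hs⟩ ⟨t, ht, rfl⟩
            -- Composable pairs of related elements are the elements of the pullback on which the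
            -- transitivity morphism is defined.
            obtain ⟨q, rfl, rfl⟩ := exists_of_isPullback
              (IsPullback.of_isLimit e.isLimit) s t (hs.trans ht.symm)
            exact ⟨ev e.t q, by rw [← ev_comp, e.transitivity₁, ev_comp],
              by rw [← ev_comp, e.transitivity₂, ev_comp]⟩ } }
  let Q := dayQuot X r (by
    rintro x y f _ _ ⟨s, rfl, rfl⟩
    exact ⟨R.functor.map f s, ev_map _ _ _, ev_map _ _ _⟩)
  let π : X ⟶ Q := dayHom (fun x a => (Quotient.mk (r x) a)) (fun _ _ => rfl)
  have hπ : p₁ ≫ π = p₂ ≫ π := day_hom_ext fun x s => Quotient.sound ⟨s, rfl, rfl⟩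
  -- The pointwise quotient `Q` need not be shown to be the coequalizer: its projection factors
  -- through `c.π`, so elements identified by `c.π` are identified in `Q`, hence related.
  have key {x : C} (a b : X.functor.obj x) (hab : ev c.π a = ev c.π b) :
      ∃ s : R.functor.obj x, ev p₁ s = a ∧ ev p₂ s = b := by
    have h₁ : c.π ≫ hc.desc (Cofork.ofπ π hπ) = π := hc.fac _ WalkingParallelPair.one
    have h₂ := congrArg (ev (hc.desc (Cofork.ofπ π hπ))) hab
    rw [← ev_comp, ← ev_comp] at h₂
    have h₃ : ev π a = ev π b := by
      rw [← h₁]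
      exact h₂
    exact Quotient.exact h₃
  have hlift {T : C ⊛⥤ Type w} (f g : T ⟶ X) (hfg : f ≫ c.π = g ≫ c.π) :
      ∃ l : T ⟶ R, l ≫ p₁ = f ∧ l ≫ p₂ = g := by
    choose l hl₁ hl₂ using fun (x : C) (t : T.functor.obj x) => key (ev f t) (ev g t)
      (by rw [← ev_comp, ← ev_comp, hfg])
    refine ⟨dayHom l (fun {x y} k t => ev_injective_of_joint hmono ?_ ?_),
      day_hom_ext fun x t => ?_, day_hom_ext fun x t => ?_⟩
    · rw [hl₁, ev_map, ev_map, hl₁]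
    · rw [hl₂, ev_map, ev_map, hl₂]
    · exact hl₁ x t
    · exact hl₂ x t
  choose l hl₁ hl₂ using @hlift
  exact ⟨⟨c.condition⟩, ⟨PullbackCone.IsLimit.mk _ (fun s => l s.fst s.snd s.condition)
    (fun s => hl₁ _ _ s.condition) (fun s => hl₂ _ _ s.condition)
    (fun s m h₁ h₂ => hmono.right_cancellation _ _ (h₁.trans (hl₁ _ _ s.condition).symm)
      (h₂.trans (hl₂ _ _ s.condition).symm))⟩⟩

/-- The canonical cocone of representable functors over a Day functor. -/
def dayDensityCocone (P : C ⊛⥤ Type w) : Cocone (dayDiagram (dayYoneda C) P) where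
  pt := P
  ι :=
    { app := fun p => dayYonedaDesc (x := op p.unop.1) p.unop.2
      naturality := fun p q k => by
        have h := dayYoneda_map_dayYonedaDesc (x := op p.unop.1) k.unop.1.op q.unop.2
        refine h.trans ?_
        refine Eq.trans ?_ (Category.comp_id _).symm
        exact congrArg (dayYonedaDesc (x := op p.unop.1)) k.unop.2 }

/-- Day functors are colimits of representable functors. -/
def isColimitDayDensityCocone (P : C ⊛⥤ Type w) : IsColimit (dayDensityCocone P) where
  desc s := dayHom (fun x p => ev (s.ι.app (op ⟨x, p⟩)) (elt (x := op x) (𝟙 x)))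
    (fun {x y} k p => by
      let a : P.functor.Elements := ⟨x, p⟩
      let b : P.functor.Elements := ⟨y, P.functor.map k p⟩
      let m : a ⟶ b := ⟨k, rfl⟩
      let t (c : P.functor.Elements) : (dayYoneda C).obj (op c.1) ⟶ s.pt := s.ι.app (op c)
      have h : (dayYoneda C).map k.op ≫ t a = t b := s.w m.op
      change ev (t b) (elt (x := op y) (𝟙 y)) = s.pt.functor.map k (ev (t a) (elt (x := op x) (𝟙 x)))
      rw [← h, ev_comp, ← ev_map]
      exact congrArg (ev (t a)) ((Category.comp_id k).trans (Category.id_comp k).symm))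
  fac s p := dayYoneda_hom_ext (by
    rw [ev_comp]
    exact congrArg _ (ev_dayYonedaDesc_id (x := op p.unop.1) p.unop.2))
  uniq s m hm := day_hom_ext fun x p => by
    change P.functor.obj x at p
    refine Eq.trans ?_ (congrArg (fun α => ev α (elt (x := op x) (𝟙 x))) (hm (op ⟨x, p⟩)))
    exact congrArg (ev m) (ev_dayYonedaDesc_id (x := op x) p).symm

/-! ### Representability of presheaves turning colimits into limits. -/

section Representable

variable (F : (C ⊛⥤ Type w)ᵒᵖ ⥤ Type w)

theorem presheaf_map_comp {X Y Z : C ⊛⥤ Type w} (f : X ⟶ Y) (g : Y ⟶ Z) (s : F.obj (op Z)) :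
    F.map (f ≫ g).op s = F.map f.op (F.map g.op s) :=
  ConcreteCategory.congr_hom (F.map_comp g.op f.op) s

/-- The restriction of a presheaf on Day functors along the Yoneda embedding. -/
def dayRestrict : C ⊛⥤ Type w :=
  ⟨{ obj := fun x => F.obj (op ((dayYoneda C).obj (op x)))
     map := fun f => F.map ((dayYoneda C).map f.op).op
     map_id := fun x => by
      rw [op_id, (dayYoneda C).map_id, op_id, F.map_id]
     map_comp := fun f g => by
      rw [op_comp, (dayYoneda C).map_comp, op_comp, F.map_comp] }⟩

/-- The morphism to the restriction of `F` given by a section of `F`. -/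
def dayRestrictHom {P : C ⊛⥤ Type w} (s : F.obj (op P)) : P ⟶ dayRestrict F :=
  dayHom (fun x p => F.map (dayYonedaDesc (x := op x) p).op s) (fun {x y} k p => by
    change _ = F.map ((dayYoneda C).map k.op).op (F.map (dayYonedaDesc (x := op x) p).op s)
    rw [← presheaf_map_comp, dayYoneda_map_dayYonedaDesc]
    rfl)

/-- As `P` is the colimit of the representables over it, `F` sends `P` to the limit of its values on
them. A point of that limit is a compatible family indexed by the elements of `P`, that is, a
morphism from `P` to the restriction of `F`. -/
theorem dayRestrictHom_bijective [PreservesLimitsOfSize.{w, w} F] (P : C ⊛⥤ Type w) :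
    Function.Bijective (dayRestrictHom F (P := P)) := by
  have hP := isLimitOfPreserves F (isColimitDayDensityCocone P).op
  constructor
  · intro s t hst
    have h : (TypeCat.ofHom fun _ : PUnit.{w + 1} => s) = TypeCat.ofHom fun _ => t := by
      refine hP.hom_ext fun p => ?_
      ext
      exact congrArg (fun α => ev α p.unop.unop.2) hst
    exact ConcreteCategory.congr_hom h PUnit.unit
  · intro α
    -- A compatible family of sections is a cone with a one-point vertex; its lift picks out the
    -- required section over `P`.
    let c : Cone ((dayDiagram (dayYoneda C) P).op ⋙ F) :=
      { pt := PUnit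
        π :=
          { app := fun p => TypeCat.ofHom fun _ => ev α p.unop.unop.2
            naturality := fun p q k => by
              ext
              have h := ev_map α k.unop.unop.1 p.unop.unop.2
              rw [k.unop.unop.2] at h
              exact h } }
    exact ⟨hP.lift c PUnit.unit, day_hom_ext fun x p =>
      ConcreteCategory.congr_hom (hP.fac c (op (op ⟨x, p⟩))) PUnit.unit⟩

theorem isRepresentable_of_preservesLimits [PreservesLimitsOfSize.{w, w} F] :
    F.IsRepresentable :=
  Functor.RepresentableBy.isRepresentable (Y := dayRestrict F)
    { homEquiv := (Equiv.ofBijective _ (dayRestrictHom_bijective F _)).symm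
      homEquiv_comp := fun {X X'} f g => by
        rw [Equiv.symm_apply_eq]
        obtain ⟨s, rfl⟩ := (dayRestrictHom_bijective F X').2 g
        change _ = dayRestrictHom F (F.map f.op ((Equiv.ofBijective _
          (dayRestrictHom_bijective F X')).symm ((Equiv.ofBijective _
            (dayRestrictHom_bijective F X')) s)))
        rw [Equiv.symm_apply_apply]
        refine day_hom_ext fun x a => ?_
        change F.map (dayYonedaDesc (x := op x) (ev f a)).op s =
          F.map (dayYonedaDesc (x := op x) a).op (F.map f.op s)
        rw [← presheaf_map_comp, dayYonedaDesc_comp] }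

end Representable

instance isVectoid_day : IsVectoid (C ⊛⥤ Type w) where
  hasColimits := inferInstance
  tensorLeft_cocontinuous X := inferInstance
  tensorRight_cocontinuous X :=
    preservesColimits_of_natIso (BraidedCategory.tensorLeftIsoTensorRight X)
  hasFiniteLimits := inferInstance
  epi_universally_effective X' X Y' Y g' f' f g hf h := by
    -- Epimorphisms are surjective on elements, and surjectivity is stable under pullback.
    refine day_isCokernelOfKernelPair f' fun x y => ?_
    obtain ⟨a, ha⟩ := ev_surjective_of_epi f x (ev g y)
    obtain ⟨p, -, hp⟩ := exists_of_isPullback h a y ha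
    exact ⟨p, hp⟩
  equivalenceRelation_effective R X p₁ p₂ h c hc :=
    day_equivalenceRelation_effective p₁ p₂ h c hc
  exists_generators := ⟨C, fun x => (dayYoneda C).obj (op x), fun X Y f g h =>
    day_hom_ext fun x a => by
      have h₁ := congrArg (fun α => ev α (elt (x := op x) (𝟙 x)))
        (h _ ⟨x⟩ (dayYonedaDesc (x := op x) a))
      simp only [ev_comp] at h₁
      rw [ev_dayYonedaDesc_id (x := op x)] at h₁
      exact h₁⟩
  complete F _ := isRepresentable_of_preservesLimits F

end DayVectoid

end
end ClassifyingVectoid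

theorem mainTheorem4 :
    -- `Qc` is a vectoid and classifies cocommutative coalgebras, with universal coalgebra `h_1`
    IsCoalgClassifier.{w, u} Qc.{w} univCoalg.{w} ∧
    ∀ (A : Type u) [Category.{w} A] [MonoidalCategory A] [SymmetricCategory A] [IsVectoid A]
      (C : CommComon A),
      -- each map is a permutation followed by a non-decreasing map
      (∀ (m n : ℕ) (f : Fin m → Fin n), ∃ (σ : Equiv.Perm (Fin m)) (φ : Fin m →o Fin n),
        f = φ ∘ σ) ∧
      -- the induced morphism does not depend on the decomposition
      (∀ (m n : ℕ) (σ σ' : Equiv.Perm (Fin m)) (φ φ' : Fin m →o Fin n),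
        (φ ∘ σ : Fin m → Fin n) = φ' ∘ σ' →
          monoMap C.X φ ≫ permMap C.X m σ = monoMap C.X φ' ≫ permMap C.X m σ') ∧
      -- the tensor functor `n ↦ C ^ n` on the opposite of the category of standard finite sets
      ∃ (Φ : StdFin.{w}ᵒᵖ ⥤ A) (_ : Φ.Braided)
        (e : ∀ n : ℕ, Φ.obj (op (StdFin.mk n)) ≅ tensorPow C.X n),
        (∀ (m n : ℕ) (σ : Equiv.Perm (Fin m)) (φ : Fin m →o Fin n),
          Φ.map (StdFin.ofFun (φ ∘ σ)).op =
            (e n).hom ≫ (monoMap C.X φ ≫ permMap C.X m σ) ≫ (e m).inv) ∧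
        Functor.LaxMonoidal.ε Φ ≫ (e 0).hom = 𝟙 (𝟙_ A) ∧
        (∀ m n : ℕ,
          Functor.LaxMonoidal.μ Φ (op (StdFin.mk m)) (op (StdFin.mk n)) ≫ (e (m + n)).hom =
            ((e m).hom ⊗ₘ (e n).hom) ≫ (tensorPowAdd C.X m n).hom) ∧
        -- its cocontinuous extension to `Qc` is the inverse image functor of a morphism of
        -- vectoids, which sends the universal coalgebra to `C`
        ∃ (F : VectoidHom A Qc.{w}) (i : dayYoneda StdFin.{w} ⋙ F.inverseImage ≅ Φ)
          (j : mapCoalg F.inverseImage univCoalg ≅ C),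
          NatTrans.IsMonoidal i.hom ∧
          j.hom.hom.hom = i.hom.app (op (StdFin.mk 1)) ≫ (e 1).hom ≫ (λ_ C.X).hom := by
  refine ⟨⟨inferInstance, fun A _ _ _ _ => inverseImageCoalg_isEquivalence⟩,
    fun A _ _ _ _ C => ⟨fun m n f => exists_perm_monotone f,
      fun m n σ σ' φ φ' h => monoMap_permMap_eq C h, coalgPow C, inferInstance, coalgPowIso C,
      fun m n σ φ => coalgPow_map C σ φ, coalgPow_ε C, coalgPow_μ C, classifyingHom C,
      dayExtYonedaIso (coalgPow C), classifyingCoalgIso C,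
      dayExtYonedaIso_isMonoidal (coalgPow C), und_classifyingCoalgHom C⟩⟩
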